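/- \textbf{Setting.} Let $n\ge 1$, $0=x_0<x_1<\dots<x_n=1$, and $a_1,\dots,a_n>0$ with $\sum_k a_k=1$. Let $A(t)=\sum_{k:\,x_k\le t}a_k$ ($t\in[0,1]$), and let $\bar A$ be its concave hull, i.e. the smallest concave function on $[0,1]$ with $\bar A\ge A$. Let $0=y_0<y_1<\dots<y_m=1$ be points of $\{x_0,\dots,x_n\}$ with $A(y_l)=\bar A(y_l)$ such that $\bar A$ is affine on each $[y_{l-1},y_l]$ (for instance, all points $x_k$ at which $A$ and $\bar A$ agree, or the endpoints of the maximal linear segments of $\bar A$). Put $L_l=y_l-y_{l-1}$, $\bar a_l=A(y_l)-A(y_{l-1})$, $\gamma_l=\bar a_l/L_l>0$, and for $\beta\ge 0$ $$\varphi^{(l)}(\beta)=\begin{cases}\tfrac12\beta^2\bar a_l+L_l\ln 2 & \text{if } \beta\le\sqrt{(2\ln 2)\gamma_l^{-1}},\\ \beta\sqrt{(2\ln 2)\,\bar a_l L_l} & \text{if } \beta>\sqrt{(2\ln 2)\gamma_l^{-1}},\end{cases}\qquad \Gamma_c^{(l)}=\frac1\beta\,\operatorname{arcosh}\Big(\tfrac12\exp\big(\varphi^{(l)}(\beta)/L_l\big)\Big)$$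 (for $\beta=0$ put $\Gamma_c^{(l)}=0$). For each $N\in\mathbb N$, let $U_N$ be a random potential on $\mathcal Q_N=\{-1,1\}^N$ which has the same law as $$\sigma\mapsto\sqrt N\,\big(\sqrt{a_1}X_{\sigma_1}+\sqrt{a_2}X_{\sigma_1\sigma_2}+\dots+\sqrt{a_n}X_{\sigma_1\cdots\sigma_n}\big),$$ where $\sigma=(\sigma_1,\dots,\sigma_n)$ is split into consecutive blocks such that $\sigma_1\cdots\sigma_k$ consists of the first $\lceil x_kN\rceil$ spins, and $X_{\sigma_1},X_{\sigma_1\sigma_2},\dots,X_{\sigma_1\cdots\sigma_n}$ are independent standard Gaussian variables. All $U_N$ are defined on one probability space, with an arbitrary joint distribution for different $N$. For $\Gamma>0$ let $H_N=U_N-\Gamma T$ on $\ell^2(\mathcal Q_N)$ with $(T\psi)(\sigma)=\sum_{j=1}^N\psi(\sigma_1,\dots,-\sigma_j,\dots,\sigma_N)$, where $\sigma_j$ now denotes the $j$-th spin, and let $\Phi_N(\beta,\Gamma)=\frac1N\ln\operatorname{Tr}e^{-\beta H_N}$. \textbf{Claim.} For every $\beta\ge 0$ and every $\Gamma>0$,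 almost surely, $$\lim_{N\to\infty}\Phi_N(\beta,\Gamma)=\Phi(\beta,\Gamma):=\max_{0\le K\le m}\Big[\sum_{l=1}^K\varphi^{(l)}(\beta)+(1-y_K)\ln\big(2\cosh(\beta\Gamma)\big)\Big],$$ and $$\Phi(\beta,\Gamma)=\sum_{l=1}^m\Big(\varphi^{(l)}(\beta)\,\mathbf 1_{\Gamma<\Gamma_c^{(l)}}+L_l\ln\big(2\cosh(\beta\Gamma)\big)\,\mathbf 1_{\Gamma\ge\Gamma_c^{(l)}}\Big).$$ -/

import Mathlib

open MeasureTheory ProbabilityTheory Filter Topology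

noncomputable section

namespace QGREM

/-! ### Concave hull on the unit interval -/

/-- `IsConcaveMajorant f g`: `g` is concave on `[0,1]` and `f ≤ g` there. -/
def IsConcaveMajorant (f g : ℝ → ℝ) : Prop :=
  ConcaveOn ℝ (Set.Icc 0 1) g ∧ ∀ t ∈ Set.Icc (0 : ℝ) 1, f t ≤ g t

/-- The concave hull of `f` on `[0,1]`: the pointwise smallest concave majorant
(for bounded `f`, and evaluated at points of `[0,1]`). -/
def concaveHull (f : ℝ → ℝ) (t : ℝ) : ℝ :=
  sInf {v | ∃ g, IsConcaveMajorant f g ∧ v = g t}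

/-! ### Parameters of the GREM -/

/-- Parameters of a GREM with `n` species: jump points `0 = x 0 < x 1 < ⋯ < x n = 1` and jump
heights `a k > 0` adding up to one. The jump at `x (k+1)` has height `a k`, `k : Fin n`. -/
structure Params (n : ℕ) where
  x : Fin (n + 1) → ℝ
  a : Fin n → ℝ
  x_zero : x 0 = 0
  x_last : x (Fin.last n) = 1
  x_strictMono : StrictMono x
  a_pos : ∀ k, 0 < a k
  a_sum : ∑ k, a k = 1

variable {n : ℕ}

/-- The distribution function `A`: the right-continuous step function which jumps by `a k` at
`x (k+1)`. -/
def Params.dist (G : Params n) (t : ℝ) : ℝ :=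
  ∑ k : Fin n, if G.x k.succ ≤ t then G.a k else 0

/-- `0 = y 0 < y 1 < ⋯ < y m = 1` are points among the `x k` at which `A` agrees with its concave
hull, such that the concave hull is affine between consecutive ones. The set of all
points `x k` where `A` and its hull agree, and the (possibly smaller) set of endpoints of the
maximal linear pieces of the hull, are both of this kind. -/
structure Params.IsHullSubdivision (G : Params n) {m : ℕ} (y : Fin (m + 1) → ℝ) : Prop where
  strictMono : StrictMono y
  zero : y 0 = 0
  last : y (Fin.last m) = 1
  mem : ∀ l, y l ∈ Set.range G.x
  agree : ∀ l, G.dist (y l) = concaveHull G.dist (y l)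
  affine : ∀ l : Fin m, ∃ c d : ℝ, ∀ t ∈ Set.Icc (y l.castSucc) (y l.succ),
    concaveHull G.dist t = c * t + d

/-! A subdivision of this kind exists for all parameters, so that the notion is not void. -/

lemma Params.dist_le_line (G : Params n) {c d : ℝ} (hc : 0 ≤ c)
    (h : ∀ k, G.dist (G.x k) ≤ c * G.x k + d) {t : ℝ} (ht : 0 ≤ t) :
    G.dist t ≤ c * t + d := by
  classical
  obtain ⟨k, hk, hmax⟩ := Finset.exists_max_image
    (Finset.univ.filter fun k => G.x k ≤ t) G.x ⟨0, by simp [G.x_zero, ht]⟩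
  simp only [Finset.mem_filter, Finset.mem_univ, true_and] at hk hmax
  have h1 : G.dist t ≤ G.dist (G.x k) := by
    refine Finset.sum_le_sum fun j _ => ?_
    have := (G.a_pos j).le
    by_cases hj : G.x j.succ ≤ t
    · simp [hj, hmax _ hj]
    · simp only [hj, if_false]; split_ifs <;> simp [this]
  nlinarith [h k, mul_le_mul_of_nonneg_left hk hc]

lemma Params.dist_mono (G : Params n) : Monotone G.dist := by
  intro s t hst
  refine Finset.sum_le_sum fun j _ => ?_
  have := (G.a_pos j).le
  by_cases hj : G.x j.succ ≤ s
  · simp [hj, hj.trans hst]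
  · simp only [hj, if_false]; split_ifs <;> simp [this]

lemma Params.exists_chain (G : Params n) (r : ℕ) : ∀ (i : Fin (n + 1)), n - i ≤ r → ∀ s : ℝ,
    0 ≤ s → (∀ k, G.dist (G.x k) ≤ G.dist (G.x i) + s * (G.x k - G.x i)) →
    ∃ (m : ℕ) (y : Fin (m + 1) → ℝ), StrictMono y ∧ y 0 = G.x i ∧ y (Fin.last m) = 1 ∧
      (∀ l, y l ∈ Set.range G.x) ∧
      ∀ l : Fin m, ∃ c d : ℝ, 0 ≤ c ∧ (∀ k, G.dist (G.x k) ≤ c * G.x k + d) ∧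
        G.dist (y l.castSucc) = c * y l.castSucc + d ∧ G.dist (y l.succ) = c * y l.succ + d := by
  classical
  induction r with
  | zero =>
    intro i hi s hs h
    have : i = Fin.last n := by ext; simp; omega
    subst this
    exact ⟨0, fun _ => 1, Fin.strictMono_iff_lt_succ.2 fun l => l.elim0, by simp [G.x_last], rfl,
      fun _ => ⟨_, G.x_last⟩, fun l => l.elim0⟩
  | succ r ih =>
    intro i hi s hs h
    by_cases hl : i = Fin.last n
    · subst hl
      exact ⟨0, fun _ => 1, Fin.strictMono_iff_lt_succ.2 fun l => l.elim0, by simp [G.x_last], rfl,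
        fun _ => ⟨_, G.x_last⟩, fun l => l.elim0⟩
    obtain ⟨j, hj, hmax⟩ := Finset.exists_max_image (Finset.univ.filter fun k => i < k)
      (fun k => (G.dist (G.x k) - G.dist (G.x i)) / (G.x k - G.x i))
      ⟨Fin.last n, by simpa using Fin.lt_last_iff_ne_last.2 hl⟩
    simp only [Finset.mem_filter, Finset.mem_univ, true_and] at hj hmax
    set c := (G.dist (G.x j) - G.dist (G.x i)) / (G.x j - G.x i) with hcdef
    have hxj : 0 < G.x j - G.x i := sub_pos.2 (G.x_strictMono hj)
    have hcj : G.dist (G.x j) = G.dist (G.x i) + c * (G.x j - G.x i) := by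
      rw [hcdef]; field_simp; ring
    have hc0 : 0 ≤ c := div_nonneg (sub_nonneg.2 (G.dist_mono (by linarith))) hxj.le
    have hcs : c ≤ s := by
      rw [hcdef, div_le_iff₀ hxj]; linarith [h j]
    have hsup : ∀ k, G.dist (G.x k) ≤ G.dist (G.x i) + c * (G.x k - G.x i) := by
      intro k
      rcases lt_trichotomy i k with hk | rfl | hk
      · have hxk : 0 < G.x k - G.x i := sub_pos.2 (G.x_strictMono hk)
        have := hmax k hk
        rw [div_le_iff₀ hxk] at this; linarith
      · simp
      · have hxk : G.x k - G.x i < 0 := sub_neg.2 (G.x_strictMono hk)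
        nlinarith [h k]
    obtain ⟨m, y, y1, y2, y3, y4, y5⟩ := ih j (by have : i.1 < j.1 := hj; omega) c hc0
      (fun k => by clear_value c; linear_combination hsup k - hcj)
    refine ⟨m + 1, Fin.cons (G.x i) y, ?_, by simp, ?_, ?_, ?_⟩
    · rw [Fin.strictMono_iff_lt_succ]
      intro l
      refine Fin.cases ?_ (fun l => ?_) l
      · simp only [Fin.castSucc_zero, Fin.cons_zero, Fin.cons_succ, y2]; linarith
      · rw [← Fin.succ_castSucc, Fin.cons_succ, Fin.cons_succ]
        exact y1 Fin.castSucc_lt_succ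
    · rw [← Fin.succ_last, Fin.cons_succ, y3]
    · intro l
      refine Fin.cases ⟨i, by simp⟩ (fun l => ?_) l
      simpa using y4 l
    · intro l
      refine Fin.cases ?_ (fun l => ?_) l
      · refine ⟨c, G.dist (G.x i) - c * G.x i, hc0, fun k => by linarith [hsup k], ?_, ?_⟩
        · simp
        · simp only [Fin.cons_succ, y2]; linarith
      · rw [← Fin.succ_castSucc, Fin.cons_succ, Fin.cons_succ]
        exact y5 l

/-- A subdivision as in `IsHullSubdivision` always exists. -/
theorem Params.exists_isHullSubdivision (G : Params n) :
    ∃ (m : ℕ) (y : Fin (m + 1) → ℝ), G.IsHullSubdivision y := by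
  have hd0 : G.dist 0 = 0 := by
    refine Finset.sum_eq_zero fun k _ => if_neg ?_
    have := G.x_strictMono (Fin.succ_pos k); rw [G.x_zero] at this; linarith
  have hd1 : ∀ t, G.dist t ≤ 1 := by
    intro t; rw [← G.a_sum]
    refine Finset.sum_le_sum fun j _ => ?_
    split_ifs <;> simp [(G.a_pos j).le]
  have hdn : ∀ t, 0 ≤ G.dist t := by
    intro t
    refine Finset.sum_nonneg fun j _ => ?_
    split_ifs <;> simp [(G.a_pos j).le]
  have hn : n ≠ 0 := by
    rintro rfl
    have h1 := G.a_sum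
    simp at h1
  -- a steep enough line through the origin
  have hs : ∃ s : ℝ, 0 ≤ s ∧ ∀ k, G.dist (G.x k) ≤ G.dist (G.x 0) + s * (G.x k - G.x 0) := by
    obtain ⟨n, rfl⟩ := Nat.exists_eq_succ_of_ne_zero hn
    have hp : 0 < G.x (Fin.succ 0) := by
      have := G.x_strictMono (Fin.succ_pos (0 : Fin (n + 1)))
      rwa [G.x_zero] at this
    refine ⟨(G.x (Fin.succ 0))⁻¹, by positivity, fun k => ?_⟩
    rw [G.x_zero, hd0, zero_add, sub_zero]
    by_cases hk : k = 0
    · subst hk; rw [G.x_zero, hd0]; simp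
    · refine (hd1 _).trans ?_
      have : G.x (Fin.succ 0) ≤ G.x k := G.x_strictMono.monotone (by
        rw [Fin.le_def]
        exact Nat.one_le_iff_ne_zero.2 fun h => hk (Fin.ext h))
      rw [← inv_mul_cancel₀ hp.ne']
      gcongr
  obtain ⟨s, hs0, hs⟩ := hs
  obtain ⟨m, y, y1, y2, y3, y4, y5⟩ := G.exists_chain n 0 (by simp) s hs0 hs
  rw [G.x_zero] at y2
  have hmaj : ∀ c d : ℝ, 0 ≤ c → (∀ k, G.dist (G.x k) ≤ c * G.x k + d) →
      IsConcaveMajorant G.dist (fun t => c * t + d) := by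
    intro c d hc h
    refine ⟨⟨convex_Icc _ _, fun u _ v _ p q _ _ hpq => ?_⟩,
      fun t ht => G.dist_le_line hc h ht.1⟩
    simp only [smul_eq_mul]
    have : q = 1 - p := by linarith
    subst this; ring_nf; rfl
  have hub : ∀ g, IsConcaveMajorant G.dist g → ∀ t ∈ Set.Icc (0 : ℝ) 1,
      concaveHull G.dist t ≤ g t := by
    intro g hg t ht
    exact csInf_le ⟨G.dist t, by rintro _ ⟨g', hg', rfl⟩; exact hg'.2 t ht⟩ ⟨g, hg, rfl⟩
  have hlb : ∀ t v, (∀ g, IsConcaveMajorant G.dist g → v ≤ g t) → v ≤ concaveHull G.dist t := by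
    intro t v h
    refine le_csInf ⟨_, fun t => 0 * t + 1, hmaj 0 1 le_rfl (by simpa using fun k => hd1 _), rfl⟩ ?_
    rintro _ ⟨g, hg, rfl⟩; exact h g hg
  have hyI : ∀ l, y l ∈ Set.Icc (0 : ℝ) 1 := fun l =>
    ⟨y2 ▸ y1.monotone (Fin.zero_le l), y3 ▸ y1.monotone (Fin.le_last l)⟩
  have hm : m ≠ 0 := by
    rintro rfl
    have h01 : y 0 = y (Fin.last 0) := rfl
    rw [y2, y3] at h01; norm_num at h01
  have htouch : ∀ l, ∃ c d : ℝ, 0 ≤ c ∧ (∀ k, G.dist (G.x k) ≤ c * G.x k + d) ∧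
      G.dist (y l) = c * y l + d := by
    intro l
    by_cases hl : l = Fin.last m
    · obtain ⟨m, rfl⟩ := Nat.exists_eq_succ_of_ne_zero hm
      obtain ⟨c, d, h0, h1, -, h2⟩ := y5 (Fin.last m)
      rw [Fin.succ_last, ← hl] at h2
      exact ⟨c, d, h0, h1, h2⟩
    · obtain ⟨c, d, h0, h1, h2, -⟩ := y5 (l.castPred hl)
      exact ⟨c, d, h0, h1, by simpa using h2⟩
  refine ⟨m, y, y1, y2, y3, y4, fun l => ?_, fun l => ?_⟩
  · obtain ⟨c, d, h0, h1, h2⟩ := htouch l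
    refine le_antisymm (hlb _ _ fun g hg => hg.2 _ (hyI l)) ?_
    rw [h2]; exact hub _ (hmaj c d h0 h1) _ (hyI l)
  · obtain ⟨c, d, h0, h1, h2, h3⟩ := y5 l
    refine ⟨c, d, fun t ht => ?_⟩
    have hlt : 0 < y l.succ - y l.castSucc := sub_pos.2 (y1 Fin.castSucc_lt_succ)
    refine le_antisymm (hub _ (hmaj c d h0 h1) t
      ⟨(hyI _).1.trans ht.1, ht.2.trans (hyI _).2⟩) (hlb _ _ fun g hg => ?_)
    set p := (y l.succ - t) / (y l.succ - y l.castSucc) with hp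
    set q := (t - y l.castSucc) / (y l.succ - y l.castSucc) with hq
    have hp0 : 0 ≤ p := div_nonneg (by linarith [ht.2]) hlt.le
    have hq0 : 0 ≤ q := div_nonneg (by linarith [ht.1]) hlt.le
    have hpq : p + q = 1 := by rw [hp, hq]; field_simp; ring
    have hpt : p * y l.castSucc + q * y l.succ = t := by rw [hp, hq]; field_simp; ring
    have := hg.1.2 (hyI l.castSucc) (hyI l.succ) hp0 hq0 hpq
    simp only [smul_eq_mul, hpt] at this
    have e1 := mul_le_mul_of_nonneg_left (hg.2 _ (hyI l.castSucc)) hp0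
    have e2 := mul_le_mul_of_nonneg_left (hg.2 _ (hyI l.succ)) hq0
    rw [h2] at e1; rw [h3] at e2
    have : c * t + d = p * (c * y l.castSucc + d) + q * (c * y l.succ + d) := by
      rw [← hpt]; linear_combination (-d) * hpq
    linarith

/-! ### The random potential -/

/-- The Hamming cube `{-1, 1}^N`. -/
abbrev Cube (N : ℕ) : Type := Fin N → ℤˣ

/-- The spin configurations of the first `⌈x_k N⌉` sites, i.e. the possible values of
`σ₁ σ₂ ⋯ σ_k`, where `σ_k` is the block of the sites in `(⌈x_{k-1} N⌉, ⌈x_k N⌉]`. -/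
abbrev Params.Prefix (G : Params n) (N : ℕ) (k : Fin n) : Type :=
  {i : Fin N // (i : ℕ) < ⌈G.x k.succ * N⌉₊} → ℤˣ

/-- The GREM potential as a linear function of the variables `X_{σ₁ ⋯ σ_k}`:
`U(σ) = √N ∑_k √a_k X_{σ₁ ⋯ σ_k}`. -/
def Params.potential (G : Params n) (N : ℕ) (X : (Σ k : Fin n, G.Prefix N k) → ℝ)
    (σ : Cube N) : ℝ :=
  √(N : ℝ) * ∑ k : Fin n, √(G.a k) * X ⟨k, fun i => σ i.1⟩

/-- The law of the GREM potential on the Hamming cube: the `X_{σ₁ ⋯ σ_k}` are independent standard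
Gaussian variables. -/
def Params.law (G : Params n) (N : ℕ) : Measure (Cube N → ℝ) :=
  (Measure.pi fun _ : (Σ k : Fin n, G.Prefix N k) => gaussianReal 0 1).map (G.potential N)

/-- The law is a probability measure. -/
instance (G : Params n) (N : ℕ) : IsProbabilityMeasure (G.law N) := by
  refine Measure.isProbabilityMeasure_map (Measurable.aemeasurable ?_)
  unfold Params.potential
  fun_prop

/-! ### The quantum Hamiltonian and its pressure -/

/-- The configuration in which the spin at site `j` is flipped. -/
def flip {N : ℕ} (j : Fin N) (σ : Cube N) : Cube N := Function.update σ j (-σ j)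

/-- The matrix of the transversal field `(B ψ)(σ) = ∑_j b_j ψ(flip j σ)`. -/
def transversalField {N : ℕ} (b : Fin N → ℝ) : Matrix (Cube N) (Cube N) ℝ :=
  Matrix.of fun σ τ => ∑ j, b j * if τ = flip j σ then 1 else 0

/-- The Hamiltonian `H = U - B`. -/
def hamiltonian {N : ℕ} (U : Cube N → ℝ) (b : Fin N → ℝ) : Matrix (Cube N) (Cube N) ℝ :=
  Matrix.diagonal U - transversalField b

/-- The pressure `N⁻¹ ln Tr exp(-β H)`. -/
def pressure {N : ℕ} (β : ℝ) (U : Cube N → ℝ) (b : Fin N → ℝ) : ℝ :=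
  (1 / (N : ℝ)) * Real.log (Matrix.trace (NormedSpace.exp (-β • hamiltonian U b)))

/-! ### The limiting expressions -/

/-- The length `L_l = y_l - y_{l-1}` of the `l`-th interval. Here and below `l : Fin m` stands for
the interval from `y l.castSucc` to `y l.succ`. -/
def blockLength {m : ℕ} (y : Fin (m + 1) → ℝ) (l : Fin m) : ℝ := y l.succ - y l.castSucc

/-- The increment `A(y_l) - A(y_{l-1})` of the (hull of the) distribution function. -/
def Params.increment (G : Params n) {m : ℕ} (y : Fin (m + 1) → ℝ) (l : Fin m) : ℝ :=
  G.dist (y l.succ) - G.dist (y l.castSucc)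

/-- The slope `γ_l` of the hull on the `l`-th interval (it is always positive). -/
def Params.slope (G : Params n) {m : ℕ} (y : Fin (m + 1) → ℝ) (l : Fin m) : ℝ :=
  G.increment y l / blockLength y l

/-- The partial pressure `φ^{(l)}(β)`. -/
def Params.partialPressure (G : Params n) {m : ℕ} (y : Fin (m + 1) → ℝ) (β : ℝ) (l : Fin m) : ℝ :=
  if β ≤ √(2 * Real.log 2 * (G.slope y l)⁻¹) then
    1 / 2 * β ^ 2 * G.increment y l + blockLength y l * Real.log 2
  else
    β * √(2 * Real.log 2 * G.increment y l * blockLength y l)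

/-- The critical field strength `Γ_c^{(l)}`; the argument of `arcosh` is always at least one. -/
def Params.criticalField (G : Params n) {m : ℕ} (y : Fin (m + 1) → ℝ) (β : ℝ) (l : Fin m) : ℝ :=
  1 / β * Real.arcosh (1 / 2 * Real.exp (G.partialPressure y β l / blockLength y l))

/-- The variational expression
`max_{0 ≤ K ≤ m} (∑_{l ≤ K} φ^{(l)}(β) + (1 - y_K) ln (2 cosh (β Γ)))`. -/
def Params.variationalPressure (G : Params n) {m : ℕ} (y : Fin (m + 1) → ℝ) (β Γ : ℝ) : ℝ :=
  Finset.univ.sup' Finset.univ_nonempty fun K : Fin (m + 1) =>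
    (∑ l : Fin m, if l.castSucc < K then G.partialPressure y β l else 0) +
      (1 - y K) * Real.log (2 * Real.cosh (β * Γ))

end QGREM

end

noncomputable section

namespace QGREM

variable {n : ℕ}

/-! ### Trace inequalities for exponentials of symmetric matrices -/

section TraceInequalities

open Matrix

variable {I : Type*} [Fintype I] [DecidableEq I]

/-! On a block where the hull has slope g, the GREM behaves like a REM with variance g per site,
with pressure `remPressure β g`; the field alone yields ln(2 cosh βΓ) per site. Deep values of the
potential are too isolated for the field to act on them, so each block is either classical or
paramagnetic. Slopes decrease along the hull and `remPressure β` is monotone, so the classical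
blocks form an initial segment. This identifies the maximum over K with the blockwise formula
(`exists_variationalPressure_eq`, `lt_criticalField_iff`).

Upper bound (`expSmall_pressure_ge`). Sort the configurations by the last level whose variable is
below -ε√N. Later levels are negligible and are dropped. Flips that change the class, or act within
the first cut(κ) sites of class κ, meet a low variable at one end. With overwhelming probability
only boundedly many neighbours are low at each level, so these flips form an operator of norm O(√N).
Jensen's inequality for spectral measures then bounds the trace by n+1 traces that can be computed
exactly: a truncated potential on the first sites and free flips on the others
(`trace_exp_le_of_few_low_neighbours`). In the frozen phase a plain first moment of these sums is
too large. The levels are therefore observed at inverse temperatures β/h_k, with h_k the inflation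
factor of the hull slope. The first moment is sharp there, and Abel summation with the antitone
weights h_k - 1 returns to β (`neg_mul_truncated_le`).

Lower bound (`expSmall_pressure_le`). Peierls–Bogoliubov is applied to states that fix the spins of
the first κ blocks and are characters in the remaining spins. Averaging over the remaining spins
wipes out the later levels. A second moment computation shows that the number of configurations with
variables below -θ_k√(a_k N), with θ_k slightly less than β/h_k, is at least half its mean.

In both directions the increments a_k must be exchanged for hull increments. The error is a partial
sum that collapses to a multiple of hull minus A, because the hull slope changes only where the two
agree (`psum_hullSlope_sub`). All exceptional probabilities decay exponentially, so Borel–Cantelli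
gives almost sure convergence for any coupling of the U_N. -/

lemma exists_orthogonal_diagonalization {B : Matrix I I ℝ} (hB : B.IsSymm) :
    ∃ (O : Matrix I I ℝ) (l : I → ℝ), Oᵀ * O = 1 ∧ B = O * diagonal l * Oᵀ := by
  have h : B.IsHermitian := by
    rw [Matrix.IsHermitian, conjTranspose_eq_transpose_of_trivial]; exact hB
  refine ⟨h.eigenvectorUnitary, h.eigenvalues, ?_, ?_⟩
  · have := (mem_unitaryGroup_iff' (A := (h.eigenvectorUnitary : Matrix I I ℝ))).1
      h.eigenvectorUnitary.2
    rwa [star_eq_conjTranspose, conjTranspose_eq_transpose_of_trivial] at this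
  · have := h.spectral_theorem
    rw [Unitary.conjStarAlgAut_apply, star_eq_conjTranspose,
      conjTranspose_eq_transpose_of_trivial] at this
    simpa [Function.comp_def] using this

lemma exp_orthogonal_conj {O : Matrix I I ℝ} (hO : Oᵀ * O = 1) (l : I → ℝ) :
    NormedSpace.exp (O * diagonal l * Oᵀ) = O * diagonal (fun i => Real.exp (l i)) * Oᵀ := by
  have h2 : O * Oᵀ = 1 := mul_eq_one_comm.1 hO
  have hinv : O⁻¹ = Oᵀ := inv_eq_left_inv hO
  have hu : IsUnit O := IsUnit.of_mul_eq_one _ h2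
  rw [← hinv, exp_conj _ _ hu, exp_diagonal]
  congr 3
  funext i
  rw [Real.exp_eq_exp_ℝ]; exact Pi.coe_exp l i

lemma dotProduct_conj_diagonal (O : Matrix I I ℝ) (l v : I → ℝ) :
    v ⬝ᵥ (O * diagonal l * Oᵀ) *ᵥ v = ∑ i, (Oᵀ *ᵥ v) i ^ 2 * l i := by
  rw [← mulVec_mulVec, ← mulVec_mulVec, dotProduct_mulVec, ← mulVec_transpose]
  simp only [dotProduct, mulVec_diagonal]
  exact Finset.sum_congr rfl fun i _ => by ring

lemma sum_sq_transpose_mulVec {O : Matrix I I ℝ} (hO : Oᵀ * O = 1) (v : I → ℝ) :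
    ∑ i, (Oᵀ *ᵥ v) i ^ 2 = v ⬝ᵥ v := by
  have h2 : O * Oᵀ = 1 := mul_eq_one_comm.1 hO
  have := dotProduct_conj_diagonal O (fun _ => 1) v
  simp only [mul_one] at this
  rw [← this, show (diagonal fun _ : I => (1 : ℝ)) = 1 from diagonal_one, mul_one, h2,
    one_mulVec]

/-- Jensen's inequality for the spectral measures of finitely many symmetric matrices. -/
lemma exp_sum_quadratic_le {κ : Type*} [Fintype κ] {B : κ → Matrix I I ℝ}
    (hB : ∀ k, (B k).IsSymm) {w : κ → I → ℝ} (hw : ∑ k, w k ⬝ᵥ w k = 1) :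
    Real.exp (∑ k, w k ⬝ᵥ B k *ᵥ w k) ≤ ∑ k, w k ⬝ᵥ NormedSpace.exp (B k) *ᵥ w k := by
  choose O l hO hl using fun k => exists_orthogonal_diagonalization (hB k)
  have h1 : ∀ k, w k ⬝ᵥ B k *ᵥ w k = ∑ i, ((O k)ᵀ *ᵥ w k) i ^ 2 * l k i := fun k => by
    conv_lhs => rw [hl k]
    exact dotProduct_conj_diagonal _ _ _
  have h2 : ∀ k, w k ⬝ᵥ NormedSpace.exp (B k) *ᵥ w k =
      ∑ i, ((O k)ᵀ *ᵥ w k) i ^ 2 * Real.exp (l k i) := fun k => by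
    conv_lhs => rw [hl k, exp_orthogonal_conj (hO k)]
    exact dotProduct_conj_diagonal _ _ _
  simp only [h1, h2]
  -- The squared coordinates of all `w k` in the eigenbases of the `B k` form a single probability
  -- vector on κ × I, so the scalar Jensen inequality for exp suffices.
  have h3 : ∑ q : κ × I, ((O q.1)ᵀ *ᵥ w q.1) q.2 ^ 2 = 1 := by
    rw [Fintype.sum_prod_type]
    simp only [sum_sq_transpose_mulVec (hO _), hw]
  have := convexOn_exp.map_sum_le (t := Finset.univ)
    (w := fun q : κ × I => ((O q.1)ᵀ *ᵥ w q.1) q.2 ^ 2) (p := fun q => l q.1 q.2)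
    (fun q _ => sq_nonneg _) h3 (fun q _ => Set.mem_univ _)
  simpa only [smul_eq_mul, Fintype.sum_prod_type] using this

lemma sum_col_quadratic {V : Matrix I I ℝ} (hV : Vᵀ * V = 1) (B : Matrix I I ℝ) :
    ∑ i, (V.col i) ⬝ᵥ B *ᵥ (V.col i) = trace B := by
  have h2 : V * Vᵀ = 1 := mul_eq_one_comm.1 hV
  have : trace (Vᵀ * (B * V)) = trace B := by
    rw [trace_mul_comm, mul_assoc, h2, mul_one]
  rw [← this]
  rfl

/-- The Peierls–Bogoliubov inequality. -/
lemma sum_exp_quadratic_le_trace_exp {A V : Matrix I I ℝ} (hA : A.IsSymm) (hV : Vᵀ * V = 1) :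
    ∑ i, Real.exp (V.col i ⬝ᵥ A *ᵥ V.col i) ≤ trace (NormedSpace.exp A) := by
  rw [← sum_col_quadratic hV]
  refine Finset.sum_le_sum fun i _ => ?_
  have hi : V.col i ⬝ᵥ V.col i = 1 := by
    exact (congrFun (congrFun hV i) i).trans (one_apply_eq i)
  have := exp_sum_quadratic_le (κ := Unit) (B := fun _ => A) (w := fun _ => V.col i)
    (fun _ => hA) (by simpa using hi)
  simpa using this

lemma trace_exp_conj_diagonal {O : Matrix I I ℝ} (hO : Oᵀ * O = 1) (l : I → ℝ) :
    trace (NormedSpace.exp (O * diagonal l * Oᵀ)) = ∑ i, Real.exp (l i) := by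
  rw [exp_orthogonal_conj hO, trace_mul_comm, ← mul_assoc, hO, one_mul, trace_diagonal]

lemma quadratic_exp_nonneg {B : Matrix I I ℝ} (hB : B.IsSymm) (v : I → ℝ) :
    0 ≤ v ⬝ᵥ NormedSpace.exp B *ᵥ v := by
  obtain ⟨O, l, hO, rfl⟩ := exists_orthogonal_diagonalization hB
  rw [exp_orthogonal_conj hO, dotProduct_conj_diagonal]
  positivity

lemma trace_exp_pos [Nonempty I] {A : Matrix I I ℝ} (hA : A.IsSymm) :
    0 < trace (NormedSpace.exp A) := by
  obtain ⟨O, l, hO, rfl⟩ := exists_orthogonal_diagonalization hA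
  rw [trace_exp_conj_diagonal hO]
  positivity

/-- If the quadratic form of `A` is bounded by that of a family `B k` acting on the pieces of a
partition of the coordinates, then the trace of the exponential is bounded accordingly. -/
lemma trace_exp_le_sum_of_partition {κ : Type*} [Fintype κ] [DecidableEq κ] {A : Matrix I I ℝ}
    (hA : A.IsSymm) {B : κ → Matrix I I ℝ} (hB : ∀ k, (B k).IsSymm) (q : I → κ) (e : ℝ)
    (h : ∀ v : I → ℝ, v ⬝ᵥ A *ᵥ v ≤ e * (v ⬝ᵥ v) +
      ∑ k, (fun i => if q i = k then v i else 0) ⬝ᵥ B k *ᵥ (fun i => if q i = k then v i else 0)) :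
    trace (NormedSpace.exp A) ≤ Real.exp e * ∑ k, trace (NormedSpace.exp (B k)) := by
  obtain ⟨O, l, hO, hl⟩ := exists_orthogonal_diagonalization hA
  have hO2 : O * Oᵀ = 1 := mul_eq_one_comm.1 hO
  have hdiag : ∀ i, O.col i ⬝ᵥ A *ᵥ O.col i = l i := by
    intro i
    have : Oᵀ * (A * O) = diagonal l := by
      rw [hl, ← mul_assoc, ← mul_assoc, ← mul_assoc, hO, one_mul, mul_assoc, hO, mul_one]
    have := congrFun (congrFun this i) i
    rw [diagonal_apply_eq] at this
    exact this
  have hone : ∀ i, O.col i ⬝ᵥ O.col i = 1 := fun i =>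
    (congrFun (congrFun hO i) i).trans (one_apply_eq i)
  set P : κ → (I → ℝ) → I → ℝ := fun k v i => if q i = k then v i else 0 with hP
  have hPsum : ∀ v, ∑ k, P k v ⬝ᵥ P k v = v ⬝ᵥ v := by
    intro v
    simp only [hP, dotProduct]
    rw [Finset.sum_comm]
    refine Finset.sum_congr rfl fun i _ => ?_
    simp
  -- The pieces of a unit eigenvector under the partition have squared norms adding up to one, as
  -- the Jensen inequality requires.
  have hstep : ∀ i, Real.exp (l i) ≤
      Real.exp e * ∑ k, P k (O.col i) ⬝ᵥ NormedSpace.exp (B k) *ᵥ P k (O.col i) := by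
    intro i
    have h1 := h (O.col i)
    rw [hdiag, hone, mul_one] at h1
    refine (Real.exp_le_exp.2 h1).trans ?_
    rw [Real.exp_add]
    refine mul_le_mul_of_nonneg_left ?_ (Real.exp_pos _).le
    exact exp_sum_quadratic_le hB (by rw [hPsum, hone])
  -- Summed over an orthonormal basis, the compressed forms give the trace of D exp(B k) D, which
  -- keeps only the diagonal entries in class k; the discarded ones are nonnegative.
  have htr : ∀ k, ∑ i, P k (O.col i) ⬝ᵥ NormedSpace.exp (B k) *ᵥ P k (O.col i) ≤
      trace (NormedSpace.exp (B k)) := by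
    intro k
    set D : Matrix I I ℝ := diagonal fun i => if q i = k then 1 else 0 with hD
    have hPD : ∀ v, P k v = D *ᵥ v := by
      intro v; funext i; simp [hP, hD, mulVec_diagonal]
    have h1 : ∀ i, P k (O.col i) ⬝ᵥ NormedSpace.exp (B k) *ᵥ P k (O.col i) =
        O.col i ⬝ᵥ (D * NormedSpace.exp (B k) * D) *ᵥ O.col i := by
      intro i
      rw [hPD, ← mulVec_mulVec, ← mulVec_mulVec, dotProduct_mulVec (O.col i) D, ← mulVec_transpose,
        hD, diagonal_transpose]
    simp only [h1]
    rw [sum_col_quadratic hO]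
    refine Finset.sum_le_sum fun i _ => ?_
    have hnn : 0 ≤ NormedSpace.exp (B k) i i := by
      have := quadratic_exp_nonneg (hB k) (Pi.single i 1)
      simpa using this
    simp only [hD, diag_apply, mul_diagonal, diagonal_mul]
    split_ifs <;> simp [hnn]
  calc trace (NormedSpace.exp A) = ∑ i, Real.exp (l i) := by
        conv_lhs => rw [hl]
        exact trace_exp_conj_diagonal hO l
    _ ≤ ∑ i, Real.exp e * ∑ k, P k (O.col i) ⬝ᵥ NormedSpace.exp (B k) *ᵥ P k (O.col i) :=
        Finset.sum_le_sum fun i _ => hstep i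
    _ = Real.exp e * ∑ k, ∑ i, P k (O.col i) ⬝ᵥ NormedSpace.exp (B k) *ᵥ P k (O.col i) := by
        rw [← Finset.mul_sum, Finset.sum_comm]
    _ ≤ _ := mul_le_mul_of_nonneg_left (Finset.sum_le_sum fun k _ => htr k) (Real.exp_pos _).le

end TraceInequalities

/-! ### Partial diagonalization of the transversal field -/

section Cube

open Matrix

variable {N : ℕ}

lemma sum_units_int (f : ℤˣ → ℝ) : ∑ s, f s = f 1 + f (-1) := by
  have : (Finset.univ : Finset ℤˣ) = {1, -1} := rfl
  rw [this, Finset.sum_pair (by decide)]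

lemma sum_cube_prod (f : Fin N → ℤˣ → ℝ) :
    ∑ σ : Cube N, ∏ i, f i (σ i) = ∏ i, (f i 1 + f i (-1)) := by
  simp only [← sum_units_int]
  rw [Finset.prod_univ_sum, Fintype.piFinset_univ]

lemma flip_flip (j : Fin N) (σ : Cube N) : flip j (flip j σ) = σ := by
  simp [flip]

lemma flip_apply_of_ne {i j : Fin N} (h : i ≠ j) (σ : Cube N) : flip j σ i = σ i := by
  simp [flip, h]

lemma flip_apply_self (j : Fin N) (σ : Cube N) : flip j σ j = -σ j := by
  simp [flip]

lemma sum_flip (j : Fin N) (f : Cube N → ℝ) : ∑ σ, f (flip j σ) = ∑ σ, f σ :=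
  Fintype.sum_equiv (Function.Involutive.toPerm (flip j) (flip_flip j)) _ _ fun _ => rfl

lemma transversalField_mulVec (b : Fin N → ℝ) (v : Cube N → ℝ) (σ : Cube N) :
    (transversalField b *ᵥ v) σ = ∑ j, b j * v (flip j σ) := by
  simp only [transversalField, mulVec, dotProduct, of_apply, Finset.sum_mul]
  rw [Finset.sum_comm]
  refine Finset.sum_congr rfl fun j _ => ?_
  simp [mul_ite, ite_mul]

lemma transversalField_isSymm (b : Fin N → ℝ) : (transversalField b).IsSymm := by
  ext σ τ
  simp only [transversalField, transpose_apply, of_apply]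
  refine Finset.sum_congr rfl fun j _ => ?_
  have : σ = flip j τ ↔ τ = flip j σ := by
    constructor <;> rintro rfl <;> rw [flip_flip]
  simp [this]

lemma diagonal_add_transversalField_isSymm (D : Cube N → ℝ) (b : Fin N → ℝ) :
    (diagonal D + transversalField b).IsSymm :=
  (isSymm_diagonal D).add (transversalField_isSymm b)

lemma diagonal_add_transversalField_quadratic (D : Cube N → ℝ) (b : Fin N → ℝ) (v : Cube N → ℝ) :
    v ⬝ᵥ (diagonal D + transversalField b) *ᵥ v =
      ∑ σ, D σ * v σ ^ 2 + ∑ σ, ∑ j, b j * (v σ * v (flip j σ)) := by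
  rw [add_mulVec, dotProduct_add]
  simp only [dotProduct, mulVec_diagonal, transversalField_mulVec, Finset.mul_sum]
  congr 1
  · exact Finset.sum_congr rfl fun _ _ => by ring
  · exact Finset.sum_congr rfl fun _ _ => Finset.sum_congr rfl fun _ _ => by ring

lemma neg_smul_hamiltonian (β Γ : ℝ) (U : Cube N → ℝ) :
    -β • hamiltonian U (fun _ => Γ) =
      diagonal (fun σ => -β * U σ) + transversalField (fun _ => β * Γ) := by
  ext σ τ
  simp only [hamiltonian, Matrix.smul_apply, Matrix.sub_apply, Matrix.add_apply, diagonal_apply,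
    transversalField, of_apply, smul_eq_mul]
  rw [← Finset.mul_sum, ← Finset.mul_sum]
  split_ifs <;> ring

/-- One-site factor of `partialFourier`. -/
def siteFactor (c : ℕ) (i : Fin N) (s e : ℤˣ) : ℝ :=
  if (i : ℕ) < c then (if s = e then 1 else 0) else (√2)⁻¹ * (if e = 1 then 1 else ((s : ℤ) : ℝ))

/-- The orthogonal matrix which diagonalizes all spin flips at the sites `i ≥ c`. -/
def partialFourier (c : ℕ) : Matrix (Cube N) (Cube N) ℝ :=
  of fun σ η => ∏ i, siteFactor c i (σ i) (η i)

/-- The field which acts with strength `t` on the sites `i ≥ c`. -/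
def tailField (c : ℕ) (t : ℝ) (j : Fin N) : ℝ := if c ≤ (j : ℕ) then t else 0

lemma units_int_cases (s : ℤˣ) : s = 1 ∨ s = -1 := Int.units_eq_one_or s

lemma siteFactor_orthogonal (c : ℕ) (i : Fin N) (e e' : ℤˣ) :
    siteFactor c i 1 e * siteFactor c i 1 e' + siteFactor c i (-1) e * siteFactor c i (-1) e' =
      if e = e' then 1 else 0 := by
  have h2 : (√2)⁻¹ * (√2)⁻¹ = (1 / 2 : ℝ) := by
    rw [← mul_inv, Real.mul_self_sqrt (by norm_num)]; norm_num
  have hne : (1 : ℤˣ) ≠ -1 := by decide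
  by_cases h : (i : ℕ) < c <;> rcases units_int_cases e with rfl | rfl <;>
    rcases units_int_cases e' with rfl | rfl <;> simp [siteFactor, h, hne, hne.symm] <;> linarith

lemma partialFourier_orthogonal (c : ℕ) :
    (partialFourier c : Matrix (Cube N) (Cube N) ℝ)ᵀ * partialFourier c = 1 := by
  ext η η'
  simp only [mul_apply, transpose_apply, partialFourier, of_apply, ← Finset.prod_mul_distrib]
  rw [sum_cube_prod (fun i s => siteFactor c i s (η i) * siteFactor c i s (η' i))]
  simp only [siteFactor_orthogonal, one_apply]
  rw [Finset.prod_ite_zero]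
  simp [funext_iff]

/-- Each column is a character in the spins from c on, hence an eigenvector of these flips with
eigenvalue the label η_j. -/
lemma partialFourier_flip_of_le {c : ℕ} {j : Fin N} (hj : c ≤ j) (σ η : Cube N) :
    partialFourier c (flip j σ) η = ((η j : ℤ) : ℝ) * partialFourier c σ η := by
  simp only [partialFourier, of_apply]
  rw [← Finset.mul_prod_erase _ _ (Finset.mem_univ j),
    ← Finset.mul_prod_erase _ (fun i => siteFactor c i (σ i) (η i)) (Finset.mem_univ j),
    ← mul_assoc]
  congr 1
  · rw [flip_apply_self]
    simp only [siteFactor, hj.not_gt, if_false]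
    rcases units_int_cases (σ j) with h | h <;> rcases units_int_cases (η j) with h' | h' <;>
      simp [h, h']
  · refine Finset.prod_congr rfl fun i hi => ?_
    rw [flip_apply_of_ne (Finset.ne_of_mem_erase hi)]

lemma partialFourier_eq_zero {c : ℕ} {i : Fin N} (hi : i < c) {σ η : Cube N} (h : σ i ≠ η i) :
    partialFourier c σ η = 0 := by
  simp only [partialFourier, of_apply]
  exact Finset.prod_eq_zero (Finset.mem_univ i) (by simp [siteFactor, hi, h])

/-- A column is supported on configurations with prescribed spins below c, and flipping such a spin
leaves the support. These flips therefore have zero expectation in the trial states. -/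
lemma partialFourier_mul_flip_of_lt {c : ℕ} {j : Fin N} (hj : j < c) (σ η : Cube N) :
    partialFourier c σ η * partialFourier c (flip j σ) η = 0 := by
  by_cases h : σ j = η j
  · rw [partialFourier_eq_zero (σ := flip j σ) hj, mul_zero]
    rw [flip_apply_self, ← h]
    rcases units_int_cases (σ j) with h | h <;> rw [h] <;> decide
  · rw [partialFourier_eq_zero hj h, zero_mul]

/-- The trace of the exponential of an operator which is diagonal in the first `c` spins. -/
lemma trace_exp_diagonal_add_tailField (c : ℕ) (t : ℝ) {D : Cube N → ℝ}
    (hD : ∀ σ η : Cube N, (∀ i : Fin N, (i : ℕ) < c → σ i = η i) → D σ = D η) :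
    trace (NormedSpace.exp (diagonal D + transversalField (tailField c t))) =
      ∑ η, Real.exp (D η + ∑ j, tailField c t j * ((η j : ℤ) : ℝ)) := by
  set V : Matrix (Cube N) (Cube N) ℝ := partialFourier c with hV
  have horth : Vᵀ * V = 1 := partialFourier_orthogonal c
  have horth2 : V * Vᵀ = 1 := mul_eq_one_comm.1 horth
  rw [← trace_exp_conj_diagonal horth]
  congr 2
  have key : (diagonal D + transversalField (tailField c t)) * V =
      V * diagonal fun η => D η + ∑ j, tailField c t j * ((η j : ℤ) : ℝ) := by
    ext σ η
    rw [mul_diagonal]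
    have h1 : ((diagonal D + transversalField (tailField c t)) * V : Matrix _ _ ℝ) σ η =
        D σ * V σ η + ∑ j, tailField c t j * V (flip j σ) η := by
      have := congrFun (add_mulVec (diagonal D) (transversalField (tailField c t)) (V.col η)) σ
      rw [Pi.add_apply, mulVec_diagonal, transversalField_mulVec] at this
      exact this
    rw [h1, mul_add, Finset.mul_sum]
    congr 1
    -- Wherever the column η is nonzero, σ and η share the first c spins, so D has the constant
    -- value D η there.
    · by_cases h : ∀ i : Fin N, (i : ℕ) < c → σ i = η i
      · rw [hD σ η h, mul_comm]
      · push Not at h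
        obtain ⟨i, hi, hne⟩ := h
        rw [hV, partialFourier_eq_zero hi hne, mul_zero, zero_mul]
    · refine Finset.sum_congr rfl fun j _ => ?_
      by_cases hj : c ≤ (j : ℕ)
      · rw [hV, partialFourier_flip_of_le hj]; ring
      · simp [tailField, hj]
  rw [← key, mul_assoc, horth2, mul_one]

/-- The weights of the uniform distribution on the configurations which agree with `η` at the
sites `i < c`. -/
def tailWeight (c : ℕ) (η σ : Cube N) : ℝ :=
  ∏ i : Fin N, if (i : ℕ) < c then (if σ i = η i then 1 else 0) else 1 / 2

lemma sq_partialFourier (c : ℕ) (η σ : Cube N) :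
    partialFourier c σ η ^ 2 = tailWeight c η σ := by
  simp only [partialFourier, of_apply, tailWeight, ← Finset.prod_pow]
  refine Finset.prod_congr rfl fun i _ => ?_
  have h2 : (√2)⁻¹ ^ 2 = (1 / 2 : ℝ) := by
    rw [inv_pow, Real.sq_sqrt (by norm_num)]; norm_num
  unfold siteFactor
  split_ifs with h1 h3 h4
  · norm_num
  · norm_num
  · rw [mul_pow, h2]; norm_num
  · rw [mul_pow, h2]
    rcases units_int_cases (σ i) with h | h <;> simp [h]

lemma sum_tailWeight (c : ℕ) (η : Cube N) : ∑ σ, tailWeight c η σ = 1 := by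
  have := congrFun (congrFun (partialFourier_orthogonal (N := N) c) η) η
  rw [mul_apply, one_apply_eq] at this
  rw [← this]
  refine Finset.sum_congr rfl fun σ _ => ?_
  rw [← sq_partialFourier, sq, transpose_apply]

lemma tailWeight_nonneg (c : ℕ) (η σ : Cube N) : 0 ≤ tailWeight c η σ := by
  rw [← sq_partialFourier]; positivity

/-- Peierls–Bogoliubov bound obtained by diagonalizing the flips at the sites `i ≥ c`. -/
lemma sum_exp_average_le_trace_exp (c : ℕ) (t : ℝ) (D : Cube N → ℝ) :
    ∑ η : Cube N, Real.exp (∑ σ, tailWeight c η σ * D σ +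
        ∑ j, tailField c t j * ((η j : ℤ) : ℝ)) ≤
      trace (NormedSpace.exp (diagonal D + transversalField (fun _ => t))) := by
  refine le_of_eq_of_le ?_ (sum_exp_quadratic_le_trace_exp
    (diagonal_add_transversalField_isSymm D _) (partialFourier_orthogonal c))
  refine Finset.sum_congr rfl fun η _ => ?_
  rw [diagonal_add_transversalField_quadratic]
  congr 2
  · refine Finset.sum_congr rfl fun σ _ => ?_
    rw [← sq_partialFourier, mul_comm, col_apply]
  · rw [Finset.sum_comm]
    refine Finset.sum_congr rfl fun j _ => ?_
    simp only [col_apply]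
    by_cases hj : c ≤ (j : ℕ)
    · simp only [partialFourier_flip_of_le hj, tailField, hj, if_true]
      have h : ∀ σ, t * (partialFourier c σ η * (((η j : ℤ) : ℝ) * partialFourier c σ η)) =
          t * ((η j : ℤ) : ℝ) * tailWeight c η σ := fun σ => by
        rw [← sq_partialFourier]; ring
      simp only [h]
      rw [← Finset.mul_sum, sum_tailWeight, mul_one]
    · simp only [partialFourier_mul_flip_of_lt (not_le.1 hj), tailField, hj, if_false]
      simp

lemma pressure_eq (β Γ : ℝ) (U : Cube N → ℝ) :
    pressure β U (fun _ => Γ) = (1 / (N : ℝ)) * Real.log (trace (NormedSpace.exp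
      (diagonal (fun σ => -β * U σ) + transversalField (fun _ => β * Γ)))) := by
  rw [pressure, neg_smul_hamiltonian]

lemma continuous_trace_exp (β Γ : ℝ) : Continuous fun U : Cube N → ℝ =>
    trace (NormedSpace.exp (-β • hamiltonian U (fun _ => Γ))) := by
  -- An auxiliary submultiplicative norm, chosen only to have continuity of the exponential.
  let _ : NormedRing (Matrix (Cube N) (Cube N) ℝ) := Matrix.linftyOpNormedRing
  let _ : NormedAlgebra ℝ (Matrix (Cube N) (Cube N) ℝ) := Matrix.linftyOpNormedAlgebra
  let _ : NormedAlgebra ℚ (Matrix (Cube N) (Cube N) ℝ) := NormedAlgebra.restrictScalars ℚ ℝ _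
  have h1 : Continuous fun A : Matrix (Cube N) (Cube N) ℝ => NormedSpace.exp A :=
    NormedSpace.exp_continuous
  have h2 : Continuous fun U : Cube N → ℝ => -β • hamiltonian U (fun _ => Γ) := by
    unfold hamiltonian
    fun_prop
  exact (h1.comp h2).matrix_trace

lemma measurable_pressure (β Γ : ℝ) :
    Measurable fun U : Cube N → ℝ => pressure β U (fun _ => Γ) := by
  unfold pressure
  exact ((continuous_trace_exp β Γ).measurable.log).const_mul _

end Cube

/-! ### Partial sums -/

/-- The sum of the first `κ` values of `f`. -/
def psum (f : Fin n → ℝ) (κ : ℕ) : ℝ := ∑ k : Fin n, if (k : ℕ) < κ then f k else 0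

@[simp] lemma psum_zero (f : Fin n → ℝ) : psum f 0 = 0 := by simp [psum]

lemma psum_succ (f : Fin n → ℝ) {κ : ℕ} (h : κ < n) : psum f (κ + 1) = psum f κ + f ⟨κ, h⟩ := by
  have : f ⟨κ, h⟩ = ∑ k : Fin n, if k = ⟨κ, h⟩ then f k else 0 := by simp
  rw [this, psum, psum, ← Finset.sum_add_distrib]
  refine Finset.sum_congr rfl fun k _ => ?_
  have e : k = ⟨κ, h⟩ ↔ (k : ℕ) = κ := Fin.ext_iff
  by_cases h1 : (k : ℕ) < κ
  · have : ¬ (k : ℕ) = κ := by omega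
    simp [e, h1, this, Nat.lt_succ_of_lt h1]
  · by_cases h2 : (k : ℕ) = κ
    · simp [e, h2]
    · have : ¬ (k : ℕ) < κ + 1 := by omega
      simp [e, h1, h2, this]

lemma psum_all (f : Fin n → ℝ) : psum f n = ∑ k, f k := by
  simp [psum]

lemma psum_add (f g : Fin n → ℝ) (κ : ℕ) :
    psum (fun k => f k + g k) κ = psum f κ + psum g κ := by
  simp only [psum, ← Finset.sum_add_distrib]
  exact Finset.sum_congr rfl fun k _ => by split_ifs <;> simp

lemma psum_const_mul (c : ℝ) (f : Fin n → ℝ) (κ : ℕ) :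
    psum (fun k => c * f k) κ = c * psum f κ := by
  simp only [psum, Finset.mul_sum]
  exact Finset.sum_congr rfl fun k _ => by split_ifs <;> simp

lemma psum_sub (f g : Fin n → ℝ) (κ : ℕ) :
    psum (fun k => f k - g k) κ = psum f κ - psum g κ := by
  simp only [psum, ← Finset.sum_sub_distrib]
  exact Finset.sum_congr rfl fun k _ => by split_ifs <;> simp

lemma psum_mono {f g : Fin n → ℝ} (h : ∀ k, f k ≤ g k) (κ : ℕ) : psum f κ ≤ psum g κ :=
  Finset.sum_le_sum fun k _ => by split_ifs <;> simp [h k]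

lemma psum_nonneg {f : Fin n → ℝ} (h : ∀ k, 0 ≤ f k) (κ : ℕ) : 0 ≤ psum f κ :=
  Finset.sum_nonneg fun k _ => by split_ifs <;> simp [h k]

/-- Abel summation: a nonincreasing weight preserves lower bounds on partial sums. -/
lemma psum_mul_ge_of_antitone {e d : Fin n → ℝ} (he : Antitone e) (he0 : ∀ k, 0 ≤ e k)
    {ε E : ℝ} (hε : 0 ≤ ε) (hE0 : 0 ≤ E) (hE : ∀ k, e k ≤ E)
    (hd : ∀ κ ≤ n, -ε ≤ psum d κ) {κ : ℕ} (hκ : κ ≤ n) :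
    -(E * ε) ≤ psum (fun k => e k * d k) κ := by
  -- The induction needs this stronger bound. The shift by ε makes the bracket nonnegative, so
  -- passing to the smaller weight of the next index only decreases the left side.
  have key : ∀ κ, ∀ h : κ < n,
      e ⟨κ, h⟩ * (psum d (κ + 1) + ε) - E * ε ≤ psum (fun k => e k * d k) (κ + 1) := by
    intro κ
    induction κ with
    | zero =>
      intro h
      rw [psum_succ _ h, psum_succ _ h, psum_zero, psum_zero]
      nlinarith [mul_le_mul_of_nonneg_right (hE ⟨0, h⟩) hε]
    | succ κ ih =>
      intro h
      have h1 := ih (by omega)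
      rw [psum_succ _ h, psum_succ (fun k => e k * d k) h]
      have h2 : e ⟨κ + 1, h⟩ ≤ e ⟨κ, by omega⟩ := he (by simp [Fin.le_def])
      have h3 := hd (κ + 1) (by omega)
      nlinarith [mul_le_mul_of_nonneg_right h2 (by linarith : 0 ≤ psum d (κ + 1) + ε)]
  rcases κ with _ | κ
  · rw [psum_zero]; nlinarith [mul_nonneg hE0 hε]
  · have h1 := key κ (by omega)
    have h2 := hd (κ + 1) hκ
    nlinarith [mul_nonneg (he0 ⟨κ, by omega⟩) (by linarith : 0 ≤ psum d (κ + 1) + ε)]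

/-! ### The concave hull of the distribution function -/

/-- The length of the `k`-th interval between jump points. -/
def Params.gap (G : Params n) (k : Fin n) : ℝ := G.x k.succ - G.x k.castSucc

lemma Params.gap_pos (G : Params n) (k : Fin n) : 0 < G.gap k :=
  sub_pos.2 (G.x_strictMono Fin.castSucc_lt_succ)

lemma Params.x_mem (G : Params n) (k : Fin (n + 1)) : G.x k ∈ Set.Icc (0 : ℝ) 1 :=
  ⟨G.x_zero ▸ G.x_strictMono.monotone (Fin.zero_le k),
    G.x_last ▸ G.x_strictMono.monotone (Fin.le_last k)⟩

lemma Params.psum_gap (G : Params n) (κ : Fin (n + 1)) : psum G.gap κ = G.x κ := by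
  induction κ using Fin.induction with
  | zero => simp [G.x_zero]
  | succ k ih =>
    rw [Fin.val_succ, psum_succ _ k.2]
    rw [Fin.val_castSucc] at ih
    simp [ih, Params.gap]

lemma Params.dist_x (G : Params n) (κ : Fin (n + 1)) : G.dist (G.x κ) = psum G.a κ := by
  refine Finset.sum_congr rfl fun k _ => ?_
  simp only [G.x_strictMono.le_iff_le, Fin.le_def, Fin.val_succ, Nat.succ_le_iff]

lemma Params.dist_le_one (G : Params n) (t : ℝ) : G.dist t ≤ 1 := by
  rw [← G.a_sum]
  refine Finset.sum_le_sum fun j _ => ?_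
  split_ifs <;> simp [(G.a_pos j).le]

lemma Params.exists_isConcaveMajorant (G : Params n) : ∃ g, IsConcaveMajorant G.dist g :=
  ⟨fun _ => 1, concaveOn_const _ (convex_Icc _ _), fun t _ => G.dist_le_one t⟩

lemma le_concaveHull (G : Params n) {t v : ℝ} (h : ∀ g, IsConcaveMajorant G.dist g → v ≤ g t) :
    v ≤ concaveHull G.dist t := by
  -- Some majorant must exist, since otherwise the infimum would take the default value 0.
  obtain ⟨g, hg⟩ := G.exists_isConcaveMajorant
  refine le_csInf ⟨_, g, hg, rfl⟩ ?_
  rintro _ ⟨g, hg, rfl⟩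
  exact h g hg

lemma concaveHull_le {f g : ℝ → ℝ} (hg : IsConcaveMajorant f g) {t : ℝ}
    (ht : t ∈ Set.Icc (0 : ℝ) 1) : concaveHull f t ≤ g t :=
  csInf_le ⟨f t, by rintro _ ⟨g', hg', rfl⟩; exact hg'.2 t ht⟩ ⟨g, hg, rfl⟩

lemma Params.dist_le_concaveHull (G : Params n) {t : ℝ} (ht : t ∈ Set.Icc (0 : ℝ) 1) :
    G.dist t ≤ concaveHull G.dist t :=
  le_concaveHull G fun _ hg => hg.2 t ht

lemma Params.concaveOn_concaveHull (G : Params n) :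
    ConcaveOn ℝ (Set.Icc 0 1) (concaveHull G.dist) := by
  refine ⟨convex_Icc _ _, fun u hu v hv p q hp hq hpq => le_concaveHull G fun g hg => ?_⟩
  refine le_trans ?_ (hg.1.2 hu hv hp hq hpq)
  have h1 := concaveHull_le hg hu
  have h2 := concaveHull_le hg hv
  simp only [smul_eq_mul]
  gcongr

lemma slope_le_slope_of_concaveOn {s : Set ℝ} {f : ℝ → ℝ} (hf : ConcaveOn ℝ s f) {a b c d : ℝ}
    (ha : a ∈ s) (hb : b ∈ s) (hd : d ∈ s) (hc : c ∈ s) (hab : a < b) (hbc : b ≤ c)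
    (hcd : c < d) : (f d - f c) / (d - c) ≤ (f b - f a) / (b - a) := by
  rcases hbc.eq_or_lt with rfl | h
  · exact hf.slope_anti_adjacent ha hd hab hcd
  · exact (hf.slope_anti_adjacent hb hd h hcd).trans (hf.slope_anti_adjacent ha hc hab h)

/-- The slope of the hull on the `k`-th interval between jump points. -/
def Params.hullSlope (G : Params n) (k : Fin n) : ℝ :=
  (concaveHull G.dist (G.x k.succ) - concaveHull G.dist (G.x k.castSucc)) / G.gap k

lemma Params.hullSlope_antitone (G : Params n) : Antitone G.hullSlope := by
  intro i j hij
  rcases hij.eq_or_lt with rfl | h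
  · exact le_rfl
  · exact slope_le_slope_of_concaveOn G.concaveOn_concaveHull (G.x_mem _) (G.x_mem _) (G.x_mem _)
      (G.x_mem _) (G.x_strictMono Fin.castSucc_lt_succ)
      (G.x_strictMono.monotone (by
        rw [Fin.le_def, Fin.val_succ, Fin.val_castSucc]; exact Nat.succ_le_of_lt h))
      (G.x_strictMono Fin.castSucc_lt_succ)

lemma Params.hullSlope_mul_gap (G : Params n) (k : Fin n) : G.hullSlope k * G.gap k =
    concaveHull G.dist (G.x k.succ) - concaveHull G.dist (G.x k.castSucc) :=
  div_mul_cancel₀ _ (G.gap_pos k).ne'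

section Subdivision

variable {G : Params n} {m : ℕ} {y : Fin (m + 1) → ℝ}

lemma blockLength_pos (hy : G.IsHullSubdivision y) (l : Fin m) : 0 < blockLength y l :=
  sub_pos.2 (hy.strictMono Fin.castSucc_lt_succ)

lemma IsHullSubdivision.mem_Icc (hy : G.IsHullSubdivision y) (l : Fin (m + 1)) :
    y l ∈ Set.Icc (0 : ℝ) 1 := by
  obtain ⟨k, hk⟩ := hy.mem l
  exact hk ▸ G.x_mem k

lemma increment_eq (hy : G.IsHullSubdivision y) (l : Fin m) : G.increment y l =
    concaveHull G.dist (y l.succ) - concaveHull G.dist (y l.castSucc) := by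
  rw [Params.increment, hy.agree, hy.agree]

lemma increment_pos (hy : G.IsHullSubdivision y) (l : Fin m) : 0 < G.increment y l := by
  obtain ⟨i, hi⟩ := hy.mem l.castSucc
  obtain ⟨j, hj⟩ := hy.mem l.succ
  have hlt : i < j := by
    rw [← G.x_strictMono.lt_iff_lt, hi, hj]
    exact hy.strictMono Fin.castSucc_lt_succ
  rw [Params.increment, ← hi, ← hj, G.dist_x, G.dist_x, sub_pos]
  have hi' : (i : ℕ) < n := by have : (i : ℕ) < j := hlt; omega
  have h1 : psum G.a i < psum G.a (i + 1) := by
    rw [psum_succ _ hi']; linarith [G.a_pos ⟨i, hi'⟩]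
  refine h1.trans_le (Finset.sum_le_sum fun k _ => ?_)
  have hij : (i : ℕ) < j := hlt
  have := (G.a_pos k).le
  split_ifs <;> first | omega | linarith

lemma slope_pos (hy : G.IsHullSubdivision y) (l : Fin m) : 0 < G.slope y l :=
  div_pos (increment_pos hy l) (blockLength_pos hy l)

lemma slope_antitone (hy : G.IsHullSubdivision y) : Antitone (G.slope y) := by
  intro i j hij
  rcases hij.eq_or_lt with rfl | h
  · exact le_rfl
  · simp only [Params.slope, increment_eq hy]
    exact slope_le_slope_of_concaveOn G.concaveOn_concaveHull (IsHullSubdivision.mem_Icc hy _)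
      (IsHullSubdivision.mem_Icc hy _) (IsHullSubdivision.mem_Icc hy _)
      (IsHullSubdivision.mem_Icc hy _) (hy.strictMono Fin.castSucc_lt_succ)
      (hy.strictMono.monotone (by
        rw [Fin.le_def, Fin.val_succ, Fin.val_castSucc]; exact Nat.succ_le_of_lt h))
      (hy.strictMono Fin.castSucc_lt_succ)

lemma hullSlope_eq_slope (hy : G.IsHullSubdivision y) {l : Fin m} {k : Fin n}
    (h1 : y l.castSucc ≤ G.x k.castSucc) (h2 : G.x k.succ ≤ y l.succ) :
    G.hullSlope k = G.slope y l := by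
  obtain ⟨c, d, hcd⟩ := hy.affine l
  have hk : G.x k.castSucc < G.x k.succ := G.x_strictMono Fin.castSucc_lt_succ
  have hl := blockLength_pos hy l
  have hg := G.gap_pos k
  rw [Params.hullSlope, Params.slope, increment_eq hy, hcd _ ⟨h1, by linarith⟩,
    hcd _ ⟨by linarith, h2⟩, hcd _ ⟨le_rfl, by linarith⟩, hcd _ ⟨by linarith, le_rfl⟩,
    div_eq_div_iff hg.ne' hl.ne', Params.gap, blockLength]
  ring

/-- The slope of the hull changes only at points where the hull touches `A`. -/
lemma hullSlope_eq_or_agree (hy : G.IsHullSubdivision y) {k : ℕ} (hk : k + 1 < n) :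
    G.hullSlope ⟨k + 1, hk⟩ = G.hullSlope ⟨k, by omega⟩ ∨
      concaveHull G.dist (G.x ⟨k + 1, by omega⟩) = G.dist (G.x ⟨k + 1, by omega⟩) := by
  classical
  set j : Fin (n + 1) := ⟨k + 1, by omega⟩ with hj
  -- Take the last subdivision point not beyond x_{k+1}. Either it equals x_{k+1}, where the hull
  -- touches A, or x_{k+1} is interior to a block and both adjacent slopes are the slope of that
  -- block.
  obtain ⟨l, hl, hmax⟩ := Finset.exists_max_image
    (Finset.univ.filter fun l => y l ≤ G.x j) id
    ⟨0, by simp [hy.zero, (G.x_mem j).1]⟩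
  simp only [Finset.mem_filter, Finset.mem_univ, true_and, id] at hl hmax
  rcases hl.eq_or_lt with h | h
  · right
    rw [← h, hy.agree]
  left
  have hlast : l ≠ Fin.last m := by
    rintro rfl
    rw [hy.last] at h
    linarith [(G.x_mem j).2]
  obtain ⟨l, rfl⟩ := Fin.exists_castSucc_eq.2 hlast
  have hsucc : G.x j < y l.succ := by
    by_contra! hcon
    exact absurd (hmax _ hcon) (not_le.2 Fin.castSucc_lt_succ)
  obtain ⟨p, hp⟩ := hy.mem l.castSucc
  obtain ⟨q, hq⟩ := hy.mem l.succ
  rw [← hp, G.x_strictMono.lt_iff_lt, Fin.lt_def] at h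
  rw [← hq, G.x_strictMono.lt_iff_lt, Fin.lt_def] at hsucc
  simp only [hj] at h hsucc
  rw [hullSlope_eq_slope hy (l := l), hullSlope_eq_slope hy (l := l)]
  all_goals
    first | rw [← hp] | rw [← hq]
    refine G.x_strictMono.monotone ?_
    rw [Fin.le_def]
    simp
    omega

/-- The second factors are the increments of hull minus A. In the summation by parts every interior
boundary term cancels: where the weight changes, hull minus A is zero. -/
lemma psum_hullSlope_sub (hy : G.IsHullSubdivision y) (F : ℝ → ℝ) {κ : ℕ} (hκ : κ < n) :
    psum (fun k => F (G.hullSlope k) * (G.hullSlope k * G.gap k - G.a k)) (κ + 1) =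
      F (G.hullSlope ⟨κ, hκ⟩) * (concaveHull G.dist (G.x ⟨κ + 1, by omega⟩) -
        G.dist (G.x ⟨κ + 1, by omega⟩)) := by
  have hstep : ∀ k : Fin n, G.hullSlope k * G.gap k - G.a k =
      (concaveHull G.dist (G.x k.succ) - G.dist (G.x k.succ)) -
      (concaveHull G.dist (G.x k.castSucc) - G.dist (G.x k.castSucc)) := by
    intro k
    rw [G.hullSlope_mul_gap, G.dist_x, G.dist_x, Fin.val_succ, Fin.val_castSucc,
      psum_succ _ k.2]
    ring
  induction κ with
  | zero =>
    rw [psum_succ _ hκ, psum_zero, hstep]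
    have h0 := hy.agree 0
    rw [hy.zero, ← G.x_zero] at h0
    have : (⟨0, hκ⟩ : Fin n).castSucc = 0 := rfl
    rw [this, ← h0]
    simp
  | succ κ ih =>
    rw [psum_succ _ hκ, ih (by omega), hstep]
    have e1 : (⟨κ + 1, hκ⟩ : Fin n).castSucc = ⟨κ + 1, by omega⟩ := rfl
    have e2 : (⟨κ + 1, hκ⟩ : Fin n).succ = ⟨κ + 1 + 1, by omega⟩ := rfl
    rw [e1, e2]
    rcases hullSlope_eq_or_agree hy hκ with h | h
    · rw [h]; ring
    · rw [h]; ring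

/-- Under nonnegative weights depending only on the slope, hull increments dominate the jumps a_k at
every level, and they give exactly the same sums at subdivision points
(`psum_hullSlope_sub_eq_zero`). -/
lemma psum_hullSlope_sub_nonneg (hy : G.IsHullSubdivision y) {F : ℝ → ℝ} (hF : ∀ g, 0 ≤ F g)
    {κ : ℕ} (hκ : κ ≤ n) :
    0 ≤ psum (fun k => F (G.hullSlope k) * (G.hullSlope k * G.gap k - G.a k)) κ := by
  rcases κ with _ | κ
  · simp
  · rw [psum_hullSlope_sub hy F (by omega)]
    exact mul_nonneg (hF _) (sub_nonneg.2 (G.dist_le_concaveHull (G.x_mem _)))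

lemma psum_hullSlope_sub_eq_zero (hy : G.IsHullSubdivision y) (F : ℝ → ℝ) {l : Fin (m + 1)}
    {κ : Fin (n + 1)} (hκ : G.x κ = y l) :
    psum (fun k => F (G.hullSlope k) * (G.hullSlope k * G.gap k - G.a k)) κ = 0 := by
  obtain ⟨κ, hlt⟩ := κ
  rcases κ with _ | κ
  · simp
  · simp only
    rw [psum_hullSlope_sub hy F (by omega), hκ, hy.agree]
    simp

/-- Sums over the intervals between jump points can be grouped by the blocks of the subdivision. -/
lemma psum_gap_mul_hullSlope (hy : G.IsHullSubdivision y) (F : ℝ → ℝ) (K : Fin (m + 1))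
    (κ : Fin (n + 1)) (hκ : G.x κ = y K) :
    psum (fun k => G.gap k * F (G.hullSlope k)) κ =
      psum (fun l => blockLength y l * F (G.slope y l)) K := by
  induction K using Fin.induction generalizing κ with
  | zero =>
    rw [hy.zero, ← G.x_zero] at hκ
    rw [G.x_strictMono.injective hκ]
    simp
  | succ K ih =>
    obtain ⟨i, hi⟩ := hy.mem K.castSucc
    have hik : i < κ := by
      rw [← G.x_strictMono.lt_iff_lt, hi, hκ]
      exact hy.strictMono Fin.castSucc_lt_succ
    -- Walk through the jump points inside block K; between any two neighbours the hull has the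
    -- slope of the block.
    have key : ∀ d : ℕ, ∀ h : i + d < n + 1, i + d ≤ κ →
        psum (fun k => G.gap k * F (G.hullSlope k)) (i + d) =
          psum (fun k => G.gap k * F (G.hullSlope k)) i +
            (G.x ⟨i + d, h⟩ - G.x i) * F (G.slope y K) := by
      intro d
      induction d with
      | zero => intro h _; simp
      | succ d ihd =>
        intro h hle
        have h1 : (i : ℕ) + d < n := by omega
        have e : psum (fun k => G.gap k * F (G.hullSlope k)) (i + (d + 1)) =
            psum (fun k => G.gap k * F (G.hullSlope k)) (i + d + 1) := rfl
        rw [e, psum_succ _ h1, ihd (by omega) (by omega), hullSlope_eq_slope hy (l := K)]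
        · simp only [Params.gap, Fin.succ_mk, Fin.castSucc_mk, add_assoc]
          ring
        · rw [← hi]
          exact G.x_strictMono.monotone (by rw [Fin.le_def]; simp)
        · rw [← hκ]
          refine G.x_strictMono.monotone ?_
          rw [Fin.le_def]
          simp
          omega
    have hlt : (i : ℕ) < κ := hik
    have := key (κ - i) (by omega) (by omega)
    have e : (i : ℕ) + (κ - i) = κ := by omega
    simp only [e, Fin.eta] at this
    rw [this, ih i hi, Fin.val_succ, psum_succ _ K.2, Fin.val_castSucc, hi, hκ]
    rfl

end Subdivision

/-! ### The pressure per site as a function of the slope -/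

/-- The ratio of `β` and the inverse temperature at which a REM with variance `g` per site
is effectively observed: it exceeds one exactly in the frozen phase. -/
def inflation (β g : ℝ) : ℝ := max 1 (β * √(g / (2 * Real.log 2)))

/-- The pressure of a REM with variance `g` per site. -/
def remPressure (β g : ℝ) : ℝ :=
  inflation β g * Real.log 2 + β ^ 2 * g / (2 * inflation β g)

lemma one_le_inflation (β g : ℝ) : 1 ≤ inflation β g := le_max_left _ _

lemma inflation_mono {β : ℝ} (hβ : 0 ≤ β) : Monotone (inflation β) := by
  intro g g' h
  have := Real.log_pos (by norm_num : (1 : ℝ) < 2)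
  unfold inflation
  gcongr

lemma sq_mul_le_inflation {β : ℝ} (hβ : 0 ≤ β) (g : ℝ) :
    β ^ 2 * g ≤ 2 * Real.log 2 * inflation β g ^ 2 := by
  have hlog := Real.log_pos (by norm_num : (1 : ℝ) < 2)
  rcases le_or_gt 0 g with hg | hg
  · have h1 : β * √(g / (2 * Real.log 2)) ≤ inflation β g := le_max_right _ _
    have h2 := pow_le_pow_left₀ (by positivity) h1 2
    rw [mul_pow, Real.sq_sqrt (by positivity)] at h2
    calc β ^ 2 * g = 2 * Real.log 2 * (β ^ 2 * (g / (2 * Real.log 2))) := by field_simp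
      _ ≤ _ := by gcongr
  · have : 0 ≤ 2 * Real.log 2 * inflation β g ^ 2 := by positivity
    nlinarith [sq_nonneg β]

/-- The dichotomy between high temperature and freezing. The second alternative says that at inverse
temperature β/w, with w the inflation, the entropy log 2 - (β/w)²g/2 is exactly used up. -/
lemma inflation_eq_one_or (β g : ℝ) :
    inflation β g = 1 ∨ β ^ 2 * g = 2 * Real.log 2 * inflation β g ^ 2 := by
  have hlog := Real.log_pos (by norm_num : (1 : ℝ) < 2)
  rcases le_or_gt (β * √(g / (2 * Real.log 2))) 1 with h | h
  · left; exact max_eq_left h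
  · right
    have hg : 0 ≤ g := by
      by_contra! hg
      rw [Real.sqrt_eq_zero_of_nonpos (div_nonpos_of_nonpos_of_nonneg hg.le (by positivity)),
        mul_zero] at h
      linarith
    rw [inflation, max_eq_right h.le, mul_pow, Real.sq_sqrt (by positivity)]
    field_simp

/-- Entropy plus energy at depth θ = β/w: the entropy is log 2 - θ²g/2 and the energy gain is βθg.
The lower bound produces this form, while the definition is the form produced by the upper bound. -/
lemma remPressure_eq (β g : ℝ) : remPressure β g =
    Real.log 2 - (β / inflation β g) ^ 2 * g / 2 + β * (β / inflation β g) * g := by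
  have h0 : inflation β g ≠ 0 := (zero_lt_one.trans_le (one_le_inflation β g)).ne'
  unfold remPressure
  rcases inflation_eq_one_or β g with h | h
  · rw [h]; ring
  · have e1 : (β / inflation β g) ^ 2 * g / 2 = Real.log 2 := by
      rw [div_pow, div_mul_eq_mul_div, h]; field_simp
    have e2 : β * (β / inflation β g) * g = 2 * Real.log 2 * inflation β g := by
      rw [show β * (β / inflation β g) * g = β ^ 2 * g / inflation β g by ring, h]; field_simp
    rw [e1, e2, h]
    field_simp
    ring

lemma half_sq_mul_le_log_two {β : ℝ} (hβ : 0 ≤ β) (g : ℝ) :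
    (β / inflation β g) ^ 2 * g / 2 ≤ Real.log 2 := by
  have h0 : 0 < inflation β g := zero_lt_one.trans_le (one_le_inflation β g)
  rw [div_pow, div_mul_eq_mul_div, div_div, div_le_iff₀ (by positivity)]
  linarith [sq_mul_le_inflation hβ g]

/-- Both branches, log 2 + β²g/2 and 2w log 2, increase with g. The first is at most 2 log 2 before
freezing and the second at least 2 log 2 after it. -/
lemma remPressure_mono {β : ℝ} (hβ : 0 ≤ β) : Monotone (remPressure β) := by
  intro g g' hg
  have hlog := Real.log_pos (by norm_num : (1 : ℝ) < 2)
  have h1 := one_le_inflation β g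
  have h1' := one_le_inflation β g'
  have hm := inflation_mono hβ hg
  have hb : 0 ≤ β / inflation β g := by positivity
  rw [remPressure_eq β g]
  have hh := half_sq_mul_le_log_two hβ g'
  rcases inflation_eq_one_or β g with h | h
  · -- compare with the line of slope `β² / 2`
    rw [remPressure_eq β g', h, div_one]
    rcases inflation_eq_one_or β g' with h' | h'
    · rw [h', div_one]; nlinarith [sq_nonneg β]
    · have e1 : (β / inflation β g') ^ 2 * g' / 2 = Real.log 2 := by
        rw [div_pow, div_mul_eq_mul_div, h']; field_simp
      have e2 : β * (β / inflation β g') * g' = 2 * Real.log 2 * inflation β g' := by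
        rw [show β * (β / inflation β g') * g' = β ^ 2 * g' / inflation β g' by ring, h']
        field_simp
      have e3 := half_sq_mul_le_log_two hβ g
      rw [h, div_one] at e3
      rw [e1, e2]
      nlinarith
  · have e1 : (β / inflation β g) ^ 2 * g / 2 = Real.log 2 := by
      rw [div_pow, div_mul_eq_mul_div, h]; field_simp
    have e2 : β * (β / inflation β g) * g = 2 * Real.log 2 * inflation β g := by
      rw [show β * (β / inflation β g) * g = β ^ 2 * g / inflation β g by ring, h]; field_simp
    rw [e1, e2]
    rw [remPressure_eq β g']
    rcases inflation_eq_one_or β g' with h' | h'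
    · have h2 : inflation β g = 1 := le_antisymm (h' ▸ hm) h1
      rw [h'] at hh ⊢
      rw [h2] at h ⊢
      simp only [div_one] at hh ⊢
      nlinarith [sq_nonneg β, mul_le_mul_of_nonneg_left hg (sq_nonneg β)]
    · have e1 : (β / inflation β g') ^ 2 * g' / 2 = Real.log 2 := by
        rw [div_pow, div_mul_eq_mul_div, h']; field_simp
      have e2 : β * (β / inflation β g') * g' = 2 * Real.log 2 * inflation β g' := by
        rw [show β * (β / inflation β g') * g' = β ^ 2 * g' / inflation β g' by ring, h']
        field_simp
      rw [e1, e2]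
      nlinarith

lemma log_two_le_remPressure {β g : ℝ} (hg : 0 ≤ g) :
    Real.log 2 ≤ remPressure β g := by
  have hlog := Real.log_pos (by norm_num : (1 : ℝ) < 2)
  have h1 := one_le_inflation β g
  have : 0 ≤ β ^ 2 * g / (2 * inflation β g) := by positivity
  unfold remPressure
  nlinarith

/-- The threshold for β is the condition `inflation β g = 1`, and the increment is slope times
length. Hence everything about a block depends on its slope, up to the factor L_l. -/
lemma partialPressure_eq {G : Params n} {m : ℕ} {y : Fin (m + 1) → ℝ}
    (hy : G.IsHullSubdivision y) (β : ℝ) (l : Fin m) :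
    G.partialPressure y β l = blockLength y l * remPressure β (G.slope y l) := by
  have hlog := Real.log_pos (by norm_num : (1 : ℝ) < 2)
  have hL := blockLength_pos hy l
  have hg := slope_pos hy l
  have hinc : G.increment y l = G.slope y l * blockLength y l :=
    (div_mul_cancel₀ _ hL.ne').symm
  rw [Params.partialPressure, hinc]
  set g := G.slope y l
  set L := blockLength y l
  have hs : √(g / (2 * Real.log 2)) * √(2 * Real.log 2 * g⁻¹) = 1 := by
    rw [← Real.sqrt_mul (by positivity)]
    rw [show g / (2 * Real.log 2) * (2 * Real.log 2 * g⁻¹) = 1 by field_simp, Real.sqrt_one]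
  have hs0 : 0 < √(g / (2 * Real.log 2)) := by positivity
  split_ifs with h
  · have h1 : inflation β g = 1 := by
      refine max_eq_left ?_
      rw [← hs, mul_comm]
      gcongr
    rw [remPressure, h1]
    ring
  · have h1 : inflation β g = β * √(g / (2 * Real.log 2)) := by
      refine max_eq_right ?_
      rw [← hs, mul_comm]
      push Not at h
      gcongr
    have h2 : 1 ≤ inflation β g := one_le_inflation _ _
    have h3 : β ^ 2 * g = 2 * Real.log 2 * inflation β g ^ 2 := by
      rw [h1, mul_pow, Real.sq_sqrt (by positivity)]
      field_simp
    have h4 : √(2 * Real.log 2 * (g * L) * L) = 2 * Real.log 2 * L * √(g / (2 * Real.log 2)) := by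
      rw [Real.sqrt_eq_iff_mul_self_eq (by positivity) (by positivity)]
      have := Real.mul_self_sqrt (show 0 ≤ g / (2 * Real.log 2) by positivity)
      symm
      calc _ = (2 * Real.log 2 * L) ^ 2 *
            (√(g / (2 * Real.log 2)) * √(g / (2 * Real.log 2))) := by ring
        _ = _ := by rw [this]; field_simp
    rw [h4, remPressure, h3, h1, show β * (2 * Real.log 2 * L * √(g / (2 * Real.log 2))) =
      2 * Real.log 2 * L * (β * √(g / (2 * Real.log 2))) by ring]
    rw [h1] at h2
    have h5 : β * √(g / (2 * Real.log 2)) ≠ 0 := (zero_lt_one.trans_le h2).ne'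
    generalize β * √(g / (2 * Real.log 2)) = w at h5 ⊢
    field_simp
    ring

/-! ### The variational formula -/

section Variational

variable {G : Params n} {m : ℕ} {y : Fin (m + 1) → ℝ}

lemma psum_blockLength (hy : G.IsHullSubdivision y) (K : Fin (m + 1)) :
    psum (blockLength y) K = y K := by
  have := psum_gap_mul_hullSlope hy (fun _ => 1) K
  obtain ⟨κ, hκ⟩ := hy.mem K
  have := this κ hκ
  simp only [mul_one] at this
  rw [← this, ← hκ, G.psum_gap]

lemma exists_threshold {p : Fin m → Prop} (hp : ∀ i j, i ≤ j → p j → p i) :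
    ∃ K : Fin (m + 1), ∀ l : Fin m, (l : ℕ) < K ↔ p l := by
  classical
  by_cases h : ∃ k, ∃ hk : k < m, ¬ p ⟨k, hk⟩
  · obtain ⟨hk, hpk⟩ := Nat.find_spec h
    refine ⟨⟨Nat.find h, by omega⟩, fun l => ⟨fun hl => ?_, fun hl => ?_⟩⟩
    · by_contra hcon
      exact Nat.find_min h hl ⟨l.2, hcon⟩
    · by_contra! hcon
      exact hpk (hp _ l hcon hl)
  · push Not at h
    exact ⟨Fin.last m, fun l => ⟨fun _ => h l l.2, fun _ => l.2⟩⟩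

/-- Since 1 - y_K is the total length of the blocks from K on, a choice of K amounts to choosing one
of two pressures on each block. -/
lemma variational_term_eq (hy : G.IsHullSubdivision y) (β p : ℝ) (K : Fin (m + 1)) :
    (∑ l : Fin m, if l.castSucc < K then G.partialPressure y β l else 0) + (1 - y K) * p =
      ∑ l : Fin m, blockLength y l *
        if (l : ℕ) < K then remPressure β (G.slope y l) else p := by
  have h1 : 1 - y K = psum (blockLength y) m - psum (blockLength y) K := by
    rw [psum_blockLength hy K]
    have := psum_blockLength hy (Fin.last m)
    rw [Fin.val_last] at this
    rw [this, hy.last]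
  rw [h1, psum_all, psum, ← Finset.sum_sub_distrib, Finset.sum_mul, ← Finset.sum_add_distrib]
  refine Finset.sum_congr rfl fun l _ => ?_
  simp only [partialPressure_eq hy, Fin.lt_def, Fin.val_castSucc]
  split_ifs <;> ring

/-- The variational pressure is attained blockwise. -/
lemma exists_variationalPressure_eq (hy : G.IsHullSubdivision y) {β : ℝ} (hβ : 0 ≤ β) (Γ : ℝ) :
    ∃ K : Fin (m + 1), G.variationalPressure y β Γ =
        (∑ l : Fin m, if l.castSucc < K then G.partialPressure y β l else 0) +
          (1 - y K) * Real.log (2 * Real.cosh (β * Γ)) ∧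
      G.variationalPressure y β Γ = ∑ l : Fin m, blockLength y l *
        max (remPressure β (G.slope y l)) (Real.log (2 * Real.cosh (β * Γ))) := by
  set p := Real.log (2 * Real.cosh (β * Γ)) with hp
  -- Decreasing slopes and monotonicity of `remPressure β` make the blocks where the REM beats the
  -- paramagnet an initial segment, so the free blockwise maximum is attained by a single K.
  obtain ⟨K, hK⟩ := exists_threshold (m := m) (p := fun l => p < remPressure β (G.slope y l))
    fun i j hij h => h.trans_le (remPressure_mono hβ (slope_antitone hy hij))
  have hterm : (∑ l : Fin m, if l.castSucc < K then G.partialPressure y β l else 0) +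
      (1 - y K) * p = ∑ l : Fin m, blockLength y l * max (remPressure β (G.slope y l)) p := by
    rw [variational_term_eq hy]
    refine Finset.sum_congr rfl fun l _ => ?_
    simp only [hK l]
    split_ifs with h
    · rw [max_eq_left h.le]
    · rw [max_eq_right (not_lt.1 h)]
  have hmax : G.variationalPressure y β Γ =
      ∑ l : Fin m, blockLength y l * max (remPressure β (G.slope y l)) p := by
    refine le_antisymm (Finset.sup'_le _ _ fun K' _ => ?_) ?_
    · rw [variational_term_eq hy]
      refine Finset.sum_le_sum fun l _ => mul_le_mul_of_nonneg_left ?_ (blockLength_pos hy l).le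
      split_ifs
      · exact le_max_left _ _
      · exact le_max_right _ _
    · rw [← hterm]
      exact Finset.le_sup' (fun K : Fin (m + 1) =>
        (∑ l : Fin m, if l.castSucc < K then G.partialPressure y β l else 0) +
        (1 - y K) * Real.log (2 * Real.cosh (β * Γ))) (Finset.mem_univ K)
  exact ⟨K, hmax.trans hterm.symm, hmax⟩

lemma lt_criticalField_iff (hy : G.IsHullSubdivision y) {β Γ : ℝ} (hβ : 0 ≤ β) (hΓ : 0 < Γ)
    (l : Fin m) : Γ < G.criticalField y β l ↔
      Real.log (2 * Real.cosh (β * Γ)) < remPressure β (G.slope y l) := by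
  have hL := blockLength_pos hy l
  have hψ := log_two_le_remPressure (β := β) (slope_pos hy l).le
  rw [Params.criticalField, partialPressure_eq hy, mul_div_cancel_left₀ _ hL.ne']
  rcases hβ.eq_or_lt with rfl | hβ
  -- At β = 0 division by zero makes the critical field 0, as the convention asks, and both
  -- pressures equal log 2.
  · simp only [zero_mul, div_zero, Real.cosh_zero, mul_one, hΓ.not_gt, false_iff, not_lt]
    simp [remPressure, inflation]
  have hexp : 1 ≤ 1 / 2 * Real.exp (remPressure β (G.slope y l)) := by
    have := Real.exp_le_exp.2 hψ
    rw [Real.exp_log (by norm_num)] at this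
    linarith
  have hc : 0 < Real.cosh (β * Γ) := Real.cosh_pos _
  rw [Real.log_lt_iff_lt_exp (by positivity), one_div_mul_eq_div, lt_div_iff₀ hβ, mul_comm Γ,
    ← Real.arcosh_cosh (show 0 ≤ β * Γ by positivity), Real.arcosh_lt_arcosh hc (by linarith),
    Real.arcosh_cosh (show 0 ≤ β * Γ by positivity)]
  constructor <;> intro h <;> linarith

lemma variationalPressure_eq_sum (hy : G.IsHullSubdivision y) {β Γ : ℝ} (hβ : 0 ≤ β)
    (hΓ : 0 < Γ) : G.variationalPressure y β Γ =
      ∑ l : Fin m, if Γ < G.criticalField y β l then G.partialPressure y β l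
        else blockLength y l * Real.log (2 * Real.cosh (β * Γ)) := by
  obtain ⟨-, -, h⟩ := exists_variationalPressure_eq hy hβ Γ
  rw [h]
  refine Finset.sum_congr rfl fun l _ => ?_
  simp only [lt_criticalField_iff hy hβ hΓ, partialPressure_eq hy]
  split_ifs with h
  · rw [max_eq_left h.le]
  · rw [max_eq_right (not_lt.1 h)]

/-- The inflation factors of the individual levels, together with their optimality
properties. -/
theorem exists_optimal_profile (hy : G.IsHullSubdivision y) {β : ℝ} (hβ : 0 ≤ β) (Γ : ℝ) :
    ∃ h : Fin n → ℝ, Antitone h ∧ (∀ k, 1 ≤ h k) ∧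
      (∀ κ : Fin (n + 1),
        psum (fun k => h k * (G.gap k * Real.log 2) + β ^ 2 * G.a k / (2 * h k)) κ +
          (1 - G.x κ) * Real.log (2 * Real.cosh (β * Γ)) ≤ G.variationalPressure y β Γ) ∧
      (∃ κ : Fin (n + 1), G.variationalPressure y β Γ =
        psum (fun k => G.gap k * Real.log 2 - (β / h k) ^ 2 * G.a k / 2 +
          β * (β / h k) * G.a k) κ + (1 - G.x κ) * Real.log (2 * Real.cosh (β * Γ))) ∧
      (∀ κ ≤ n, 0 ≤ psum (fun k => G.gap k * Real.log 2 - (β / h k) ^ 2 * G.a k / 2) κ) := by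
  set p := Real.log (2 * Real.cosh (β * Γ)) with hp
  obtain ⟨K, hK, hmax⟩ := exists_variationalPressure_eq hy hβ Γ
  have hpos : ∀ g, 0 < inflation β g := fun g => zero_lt_one.trans_le (one_le_inflation β g)
  have hVP : G.variationalPressure y β Γ =
      psum (fun k => G.gap k * max (remPressure β (G.hullSlope k)) p) n := by
    have := psum_gap_mul_hullSlope hy (fun g => max (remPressure β g) p) (Fin.last m) (Fin.last n)
      (by rw [G.x_last, hy.last])
    rw [Fin.val_last, Fin.val_last] at this
    rw [this, psum_all, hmax]
  -- The factor of level k is determined by the hull slope and not by a_k itself; this is what makes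
  -- it antitone.
  refine ⟨fun k => inflation β (G.hullSlope k),
    fun i j hij => inflation_mono hβ (G.hullSlope_antitone hij), fun k => one_le_inflation _ _,
    fun κ => ?_, ?_, fun κ hκ => ?_⟩
  · have h1 : psum (fun k => inflation β (G.hullSlope k) * (G.gap k * Real.log 2) +
        β ^ 2 * G.a k / (2 * inflation β (G.hullSlope k))) κ ≤
        psum (fun k => G.gap k * remPressure β (G.hullSlope k)) κ := by
      have h2 := psum_hullSlope_sub_nonneg hy (F := fun g => β ^ 2 / (2 * inflation β g))
        (fun g => by have := hpos g; positivity) (κ := κ) (by omega)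
      rw [← sub_nonneg, ← psum_sub]
      refine h2.trans_eq ?_
      congr 1
      funext k
      have := (hpos (G.hullSlope k)).ne'
      unfold remPressure
      field_simp
      ring
    have h3 : 1 - G.x κ = psum G.gap n - psum G.gap κ := by
      rw [G.psum_gap κ]
      have := G.psum_gap (Fin.last n)
      rw [Fin.val_last] at this
      rw [this, G.x_last]
    refine (add_le_add_left h1 _).trans ?_
    rw [hVP, h3, psum_all, psum_all, psum, psum, ← Finset.sum_sub_distrib, Finset.sum_mul,
      ← Finset.sum_add_distrib]
    refine Finset.sum_le_sum fun k _ => ?_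
    have hg := (G.gap_pos k).le
    split_ifs
    · have := mul_le_mul_of_nonneg_left (le_max_left (remPressure β (G.hullSlope k)) p) hg
      linarith
    · have := mul_le_mul_of_nonneg_left (le_max_right (remPressure β (G.hullSlope k)) p) hg
      linarith
  · obtain ⟨κ, hκ⟩ := hy.mem K
    refine ⟨κ, ?_⟩
    have h1 : (∑ l : Fin m, if l.castSucc < K then G.partialPressure y β l else 0) =
        psum (fun l => blockLength y l * remPressure β (G.slope y l)) K := by
      refine Finset.sum_congr rfl fun l _ => ?_
      rw [partialPressure_eq hy]; rfl
    rw [hK, h1, ← psum_gap_mul_hullSlope hy (remPressure β) K κ hκ, hκ]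
    congr 1
    -- Since x_κ = y_K is a contact point, exchanging a_k for hull increments costs nothing,
    -- whatever the weight.
    have h2 := psum_hullSlope_sub_eq_zero hy
      (fun g => -(β / inflation β g) ^ 2 / 2 + β * (β / inflation β g)) hκ
    rw [← sub_eq_zero, ← psum_sub, ← h2]
    congr 1
    funext k
    rw [remPressure_eq]
    ring
  -- With hull increments each level has nonnegative entropy. The true partial sums exceed these
  -- because A lies below its hull.
  · have h1 := psum_hullSlope_sub_nonneg hy (F := fun g => (β / inflation β g) ^ 2 / 2)
      (fun g => by positivity) hκ
    have h2 : 0 ≤ psum (fun k => G.gap k *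
        (Real.log 2 - (β / inflation β (G.hullSlope k)) ^ 2 * G.hullSlope k / 2)) κ :=
      psum_nonneg (fun k => mul_nonneg (G.gap_pos k).le
        (sub_nonneg.2 (half_sq_mul_le_log_two hβ _))) κ
    have h3 := add_nonneg h1 h2
    rw [← psum_add] at h3
    refine h3.trans_eq ?_
    congr 1
    funext k
    ring

end Variational

/-! ### Truncated potentials and the decomposition of the Hamiltonian -/

/-- The number of sites which belong to the first `κ` blocks. -/
def Params.cut (G : Params n) (N : ℕ) (κ : Fin (n + 1)) : ℕ := ⌈G.x κ * N⌉₊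

/-- The Gaussian variables which enter the GREM potential. -/
abbrev Params.Index (G : Params n) (N : ℕ) : Type := Σ k : Fin n, G.Prefix N k

/-- The index of the variable `X_{σ₁ ⋯ σ_k}`. -/
def Params.idx (G : Params n) {N : ℕ} (k : Fin n) (σ : Cube N) : G.Index N :=
  ⟨k, fun i => σ i.1⟩

/-- The contribution of the first `κ` levels to the potential. -/
def Params.truncated (G : Params n) {N : ℕ} (X : G.Index N → ℝ) (κ : ℕ) (σ : Cube N) : ℝ :=
  √(N : ℝ) * psum (fun k => √(G.a k) * X (G.idx k σ)) κ

lemma Params.cut_zero (G : Params n) (N : ℕ) : G.cut N 0 = 0 := by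
  simp [Params.cut, G.x_zero]

lemma Params.cut_mono (G : Params n) (N : ℕ) : Monotone (G.cut N) := by
  intro i j hij
  refine Nat.ceil_mono ?_
  have := G.x_strictMono.monotone hij
  gcongr

lemma Params.cut_le (G : Params n) (N : ℕ) (κ : Fin (n + 1)) : G.cut N κ ≤ N := by
  refine Nat.ceil_le.2 ?_
  have := (G.x_mem κ).2
  exact mul_le_of_le_one_left (Nat.cast_nonneg _) this

lemma Params.le_cut (G : Params n) (N : ℕ) (κ : Fin (n + 1)) : G.x κ * N ≤ G.cut N κ :=
  Nat.le_ceil _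

lemma Params.cut_lt (G : Params n) (N : ℕ) (κ : Fin (n + 1)) : (G.cut N κ : ℝ) < G.x κ * N + 1 :=
  Nat.ceil_lt_add_one (mul_nonneg (G.x_mem κ).1 (Nat.cast_nonneg _))

lemma Params.potential_eq (G : Params n) {N : ℕ} (X : G.Index N → ℝ) (σ : Cube N) :
    G.potential N X σ = G.truncated X n σ := by
  simp only [Params.potential, Params.truncated, psum_all]
  rfl

lemma Params.idx_eq_iff (G : Params n) {N : ℕ} (k : Fin n) (σ τ : Cube N) :
    G.idx k σ = G.idx k τ ↔ ∀ i : Fin N, (i : ℕ) < G.cut N k.succ → σ i = τ i := by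
  simp only [Params.idx, Sigma.mk.injEq, heq_eq_eq, true_and, funext_iff, Subtype.forall]
  rfl

lemma Params.idx_flip (G : Params n) {N : ℕ} {k : Fin n} {j : Fin N} (h : G.cut N k.succ ≤ j)
    (σ : Cube N) : G.idx k (flip j σ) = G.idx k σ := by
  rw [G.idx_eq_iff]
  intro i hi
  refine flip_apply_of_ne ?_ σ
  rintro rfl
  omega

lemma Params.truncated_congr (G : Params n) {N : ℕ} (X : G.Index N → ℝ) (κ : Fin (n + 1))
    {σ τ : Cube N} (h : ∀ i : Fin N, (i : ℕ) < G.cut N κ → σ i = τ i) :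
    G.truncated X κ σ = G.truncated X κ τ := by
  unfold Params.truncated psum
  congr 1
  refine Finset.sum_congr rfl fun k _ => ?_
  split_ifs with hk
  · have : G.idx k σ = G.idx k τ := by
      rw [G.idx_eq_iff]
      intro i hi
      refine h i (hi.trans_le (G.cut_mono N ?_))
      rw [Fin.le_def, Fin.val_succ]
      omega
    simp only [this]
  · rfl

section Decomposition

open Matrix

variable (G : Params n) {N : ℕ} (X : G.Index N → ℝ) (ε : ℝ)

/-- The variable at level `k` is extremely negative. -/
def Params.IsLow (k : Fin n) (σ : Cube N) : Prop := X (G.idx k σ) ≤ -(ε * √(N : ℝ))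

open Classical in
/-- The number of levels up to and including the last one at which the variable is extremely
negative. -/
def Params.lastLow (σ : Cube N) : Fin (n + 1) :=
  Finset.univ.sup fun k : Fin n => if G.IsLow X ε k σ then k.succ else 0

variable {G X ε}

lemma succ_le_lastLow {k : Fin n} {σ : Cube N} (h : G.IsLow X ε k σ) :
    k.succ ≤ G.lastLow X ε σ := by
  classical
  have := Finset.le_sup (f := fun k : Fin n => if G.IsLow X ε k σ then k.succ else 0)
    (Finset.mem_univ k)
  simp only [h, if_true] at this
  exact this

lemma lastLow_eq_zero_or (σ : Cube N) :
    G.lastLow X ε σ = 0 ∨ ∃ k : Fin n, G.IsLow X ε k σ ∧ G.lastLow X ε σ = k.succ := by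
  classical
  rcases (Finset.univ : Finset (Fin n)).eq_empty_or_nonempty with h | h
  · left; rw [Params.lastLow, h]; rfl
  · obtain ⟨k, -, hk⟩ := Finset.exists_mem_eq_sup _ h
      (fun k : Fin n => if G.IsLow X ε k σ then k.succ else 0)
    change G.lastLow X ε σ = _ at hk
    by_cases hl : G.IsLow X ε k σ
    · right; exact ⟨k, hl, by simpa [hl] using hk⟩
    · left; simpa [hl] using hk

/-- A spin flip which is not taken into account by the decomposition is located in the support of
some extremely negative variable. -/
lemma exists_isLow_of_removed {σ : Cube N} {j : Fin N}
    (h : ¬ (G.lastLow X ε (flip j σ) = G.lastLow X ε σ ∧ G.cut N (G.lastLow X ε σ) ≤ j)) :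
    ∃ k : Fin n, (j : ℕ) < G.cut N k.succ ∧ (G.IsLow X ε k σ ∨ G.IsLow X ε k (flip j σ)) := by
  by_contra! hcon
  have hσ : ∀ k, G.IsLow X ε k σ → G.cut N k.succ ≤ j := fun k hk => by
    by_contra! hlt; exact (hcon k hlt).1 hk
  have hφ : ∀ k, G.IsLow X ε k (flip j σ) → G.cut N k.succ ≤ j := fun k hk => by
    by_contra! hlt; exact (hcon k hlt).2 hk
  -- If j lies beyond the support of every low variable at σ, flipping j leaves these variables
  -- unchanged and hence low. The same argument from the flipped configuration gives equality.
  have h1 : G.lastLow X ε σ ≤ G.lastLow X ε (flip j σ) := by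
    rcases lastLow_eq_zero_or (G := G) (X := X) (ε := ε) σ with h0 | ⟨k, hk, h0⟩
    · rw [h0]; exact Fin.zero_le _
    · rw [h0]
      refine succ_le_lastLow ?_
      rw [Params.IsLow, G.idx_flip (hσ k hk)]; exact hk
  have h2 : G.lastLow X ε (flip j σ) ≤ G.lastLow X ε σ := by
    rcases lastLow_eq_zero_or (G := G) (X := X) (ε := ε) (flip j σ) with h0 | ⟨k, hk, h0⟩
    · rw [h0]; exact Fin.zero_le _
    · rw [h0]
      refine succ_le_lastLow ?_
      rw [Params.IsLow, ← G.idx_flip (hφ k hk)]; exact hk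
  refine h ⟨le_antisymm h2 h1, ?_⟩
  rcases lastLow_eq_zero_or (G := G) (X := X) (ε := ε) σ with h0 | ⟨k, hk, h0⟩
  · rw [h0, G.cut_zero]; exact Nat.zero_le _
  · rw [h0]; exact hσ k hk

lemma Params.a_le_one (G : Params n) (k : Fin n) : G.a k ≤ 1 := by
  rw [← G.a_sum]
  exact Finset.single_le_sum (fun i _ => (G.a_pos i).le) (Finset.mem_univ k)

/-- Each level after the last low one contributes at most √N·√a_k·ε√N ≤ εN to the negative
potential. -/
lemma neg_truncated_le (hε : 0 ≤ ε) (σ : Cube N) :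
    -G.truncated X n σ ≤ -G.truncated X (G.lastLow X ε σ) σ + n * ε * N := by
  have h1 : psum (fun k => √(G.a k) * X (G.idx k σ)) (G.lastLow X ε σ) - n * (ε * √(N : ℝ)) ≤
      psum (fun k => √(G.a k) * X (G.idx k σ)) n := by
    have h2 : (n : ℝ) * (ε * √(N : ℝ)) = ∑ _k : Fin n, ε * √(N : ℝ) := by simp
    rw [psum_all, h2, psum, ← Finset.sum_sub_distrib]
    refine Finset.sum_le_sum fun k _ => ?_
    have h0 : 0 ≤ ε * √(N : ℝ) := by positivity
    split_ifs with hk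
    · linarith
    · have hnl : ¬ G.IsLow X ε k σ := fun hl => hk (by
        have : k.succ ≤ G.lastLow X ε σ := succ_le_lastLow hl
        rw [Fin.le_def, Fin.val_succ] at this
        omega)
      rw [Params.IsLow, not_le] at hnl
      have ha0 := Real.sqrt_nonneg (G.a k)
      have ha1 : √(G.a k) ≤ 1 := Real.sqrt_le_one.2 (G.a_le_one k)
      nlinarith
  have hs := Real.mul_self_sqrt (Nat.cast_nonneg (α := ℝ) N)
  have := mul_le_mul_of_nonneg_left h1 (Real.sqrt_nonneg (N : ℝ))
  unfold Params.truncated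
  have e : √(N : ℝ) * (psum (fun k => √(G.a k) * X (G.idx k σ)) (G.lastLow X ε σ) -
      n * (ε * √(N : ℝ))) = √(N : ℝ) * psum (fun k => √(G.a k) * X (G.idx k σ))
        (G.lastLow X ε σ) - n * ε * N := by
    linear_combination (-(n : ℝ) * ε) * hs
  linarith

/-- If every configuration has few neighbours in a set, then the edges at the set form an operator
of small norm. -/
lemma sum_low_edges_le (c r : ℕ) (p : Cube N → Prop) [DecidablePred p]
    (hr : ∀ σ, (Finset.univ.filter fun j : Fin N => (j : ℕ) < c ∧ p (flip j σ)).card ≤ r)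
    (v : Cube N → ℝ) :
    ∑ σ, ∑ j : Fin N, (if (j : ℕ) < c ∧ p (flip j σ) then 2 * |v σ| * |v (flip j σ)| else 0) ≤
      (r + 1) * √(N : ℝ) * (v ⬝ᵥ v) := by
  rcases Nat.eq_zero_or_pos N with rfl | hN
  · simp
  have hs : 0 < √(N : ℝ) := by positivity
  have hss := Real.mul_self_sqrt (Nat.cast_nonneg (α := ℝ) N)
  -- The weight √N balances two degrees: a vertex has at most r low neighbours, but a low vertex may
  -- have up to N neighbours.
  have hpt : ∀ a b : ℝ, 2 * |a| * |b| ≤ √(N : ℝ) * a ^ 2 + (√(N : ℝ))⁻¹ * b ^ 2 := by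
    intro a b
    have h1 := sq_nonneg (√(N : ℝ) * |a| - |b|)
    have h2 : √(N : ℝ) * a ^ 2 + (√(N : ℝ))⁻¹ * b ^ 2 - 2 * |a| * |b| =
        (√(N : ℝ))⁻¹ * (√(N : ℝ) * |a| - |b|) ^ 2 := by
      rw [sub_sq, mul_pow, sq_abs, sq_abs]; field_simp; ring
    have h3 : 0 ≤ (√(N : ℝ))⁻¹ * (√(N : ℝ) * |a| - |b|) ^ 2 := by positivity
    linarith
  have hA : ∑ σ, ∑ j : Fin N, (if (j : ℕ) < c ∧ p (flip j σ) then √(N : ℝ) * v σ ^ 2 else 0) ≤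
      r * √(N : ℝ) * (v ⬝ᵥ v) := by
    rw [dotProduct, Finset.mul_sum]
    refine Finset.sum_le_sum fun σ _ => ?_
    rw [← Finset.sum_filter, Finset.sum_const, nsmul_eq_mul]
    have : ((Finset.univ.filter fun j : Fin N => (j : ℕ) < c ∧ p (flip j σ)).card : ℝ) ≤ r :=
      by exact_mod_cast hr σ
    calc _ ≤ (r : ℝ) * (√(N : ℝ) * v σ ^ 2) := by gcongr
      _ = _ := by ring
  have hB : ∑ σ, ∑ j : Fin N,
      (if (j : ℕ) < c ∧ p (flip j σ) then (√(N : ℝ))⁻¹ * v (flip j σ) ^ 2 else 0) ≤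
      √(N : ℝ) * (v ⬝ᵥ v) := by
    rw [Finset.sum_comm]
    have : ∀ j : Fin N, ∑ σ,
        (if (j : ℕ) < c ∧ p (flip j σ) then (√(N : ℝ))⁻¹ * v (flip j σ) ^ 2 else 0) ≤
        (√(N : ℝ))⁻¹ * (v ⬝ᵥ v) := by
      intro j
      rw [sum_flip j (fun τ => if (j : ℕ) < c ∧ p τ then (√(N : ℝ))⁻¹ * v τ ^ 2 else 0),
        dotProduct, Finset.mul_sum]
      refine Finset.sum_le_sum fun τ _ => ?_
      have : 0 ≤ (√(N : ℝ))⁻¹ * v τ ^ 2 := by positivity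
      split_ifs
      · exact (by ring : (√(N : ℝ))⁻¹ * v τ ^ 2 = (√(N : ℝ))⁻¹ * (v τ * v τ)).le
      · linarith [(by ring : (√(N : ℝ))⁻¹ * v τ ^ 2 = (√(N : ℝ))⁻¹ * (v τ * v τ))]
    refine (Finset.sum_le_sum fun j _ => this j).trans_eq ?_
    rw [Finset.sum_const, Finset.card_univ, Fintype.card_fin, nsmul_eq_mul, ← mul_assoc]
    congr 1
    nth_rewrite 1 [← hss]
    field_simp
  calc _ ≤ ∑ σ, ∑ j : Fin N, ((if (j : ℕ) < c ∧ p (flip j σ) then √(N : ℝ) * v σ ^ 2 else 0) +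
        (if (j : ℕ) < c ∧ p (flip j σ) then (√(N : ℝ))⁻¹ * v (flip j σ) ^ 2 else 0)) := by
        refine Finset.sum_le_sum fun σ _ => Finset.sum_le_sum fun j _ => ?_
        split_ifs
        · exact hpt _ _
        · simp
    _ ≤ r * √(N : ℝ) * (v ⬝ᵥ v) + √(N : ℝ) * (v ⬝ᵥ v) := by
        simp only [Finset.sum_add_distrib]; linarith
    _ = _ := by ring

open Classical in
/-- Deterministic upper bound on the partition function in terms of truncated classical
partition functions. -/
lemma trace_exp_le_of_few_low_neighbours {β Γ : ℝ} (hβ : 0 ≤ β) (hΓ : 0 ≤ Γ) (hε : 0 ≤ ε) (r : ℕ)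
    (hr : ∀ (k : Fin n) (σ : Cube N), (Finset.univ.filter fun j : Fin N =>
      (j : ℕ) < G.cut N k.succ ∧ G.IsLow X ε k (flip j σ)).card ≤ r) :
    trace (NormedSpace.exp (diagonal (fun σ => -β * G.potential N X σ) +
        transversalField (fun _ => β * Γ))) ≤
      Real.exp (β * (n * ε * N) + β * Γ * (n * ((r + 1) * √(N : ℝ)))) *
        ∑ κ : Fin (n + 1), ∑ η : Cube N, Real.exp (-β * G.truncated X κ η +
          ∑ j, tailField (G.cut N κ) (β * Γ) j * ((η j : ℤ) : ℝ)) := by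
  have htr : ∀ κ : Fin (n + 1), trace (NormedSpace.exp
      (diagonal (fun σ => -β * G.truncated X κ σ) +
        transversalField (tailField (G.cut N κ) (β * Γ)))) = ∑ η : Cube N,
      Real.exp (-β * G.truncated X κ η +
          ∑ j, tailField (G.cut N κ) (β * Γ) j * ((η j : ℤ) : ℝ)) := fun κ =>
    trace_exp_diagonal_add_tailField _ _ fun σ η h => by rw [G.truncated_congr X κ h]
  simp only [← htr]
  set q : Cube N → Fin (n + 1) := G.lastLow X ε with hq
  refine trace_exp_le_sum_of_partition (diagonal_add_transversalField_isSymm _ _)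
    (fun κ => diagonal_add_transversalField_isSymm _ _) q _ fun v => ?_
  simp only [diagonal_add_transversalField_quadratic]
  rw [Finset.sum_add_distrib, Finset.sum_comm (s := (Finset.univ : Finset (Fin (n + 1))))]
  have hdiag : ∀ σ, ∑ κ : Fin (n + 1), -β * G.truncated X κ σ *
      (if q σ = κ then v σ else 0) ^ 2 = -β * G.truncated X (q σ) σ * v σ ^ 2 := by
    intro σ
    rw [Finset.sum_eq_single (q σ) (fun κ _ h => by simp [h.symm]) (by simp)]
    simp
  -- The block operators see exactly the flips that stay in class κ and act at sites from cut(κ) on;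
  -- every other flip is an error term.
  have hoff : ∑ κ : Fin (n + 1), ∑ σ, ∑ j, tailField (G.cut N κ) (β * Γ) j *
      ((if q σ = κ then v σ else 0) * (if q (flip j σ) = κ then v (flip j σ) else 0)) =
      ∑ σ, ∑ j : Fin N, (if q (flip j σ) = q σ ∧ G.cut N (q σ) ≤ j then
        β * Γ * (v σ * v (flip j σ)) else 0) := by
    rw [Finset.sum_comm]
    refine Finset.sum_congr rfl fun σ _ => ?_
    rw [Finset.sum_comm]
    refine Finset.sum_congr rfl fun j _ => ?_
    rw [Finset.sum_eq_single (q σ) (fun κ _ h => by simp [h.symm]) (by simp)]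
    by_cases h1 : q (flip j σ) = q σ <;> by_cases h2 : G.cut N (q σ) ≤ j <;>
      simp [tailField, h1, h2]
  simp only [hdiag]
  rw [hoff]
  have hD : ∑ σ, -β * G.potential N X σ * v σ ^ 2 ≤ β * (n * ε * N) * (v ⬝ᵥ v) +
      ∑ σ, -β * G.truncated X (q σ) σ * v σ ^ 2 := by
    rw [dotProduct, Finset.mul_sum, ← Finset.sum_add_distrib]
    refine Finset.sum_le_sum fun σ _ => ?_
    rw [G.potential_eq]
    have := mul_le_mul_of_nonneg_left (neg_truncated_le (G := G) (X := X) hε σ)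
      (mul_nonneg hβ (sq_nonneg (v σ)))
    rw [← hq] at this
    linarith
  have hβΓ : 0 ≤ β * Γ := mul_nonneg hβ hΓ
  -- Each flip is either kept or charged to a level with a low variable at one of its two ends.
  have hedge : ∀ (σ : Cube N) (j : Fin N), β * Γ * (v σ * v (flip j σ)) ≤
      (if q (flip j σ) = q σ ∧ G.cut N (q σ) ≤ j then β * Γ * (v σ * v (flip j σ)) else 0) +
      β * Γ * ∑ k : Fin n,
        ((if (j : ℕ) < G.cut N k.succ ∧ G.IsLow X ε k σ then |v σ| * |v (flip j σ)| else 0) +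
        (if (j : ℕ) < G.cut N k.succ ∧ G.IsLow X ε k (flip j σ) then
          |v σ| * |v (flip j σ)| else 0)) := by
    intro σ j
    have hnn : 0 ≤ |v σ| * |v (flip j σ)| := by positivity
    have hterm : ∀ k : Fin n, 0 ≤
        ((if (j : ℕ) < G.cut N k.succ ∧ G.IsLow X ε k σ then |v σ| * |v (flip j σ)| else 0) +
        (if (j : ℕ) < G.cut N k.succ ∧ G.IsLow X ε k (flip j σ) then
          |v σ| * |v (flip j σ)| else 0)) := fun k =>
      add_nonneg (by split_ifs <;> simp [hnn]) (by split_ifs <;> simp [hnn])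
    split_ifs with h
    · have := mul_nonneg hβΓ (Finset.sum_nonneg fun k (_ : k ∈ Finset.univ) => hterm k)
      linarith
    · obtain ⟨k, hk, hlow⟩ := exists_isLow_of_removed h
      rw [zero_add]
      refine mul_le_mul_of_nonneg_left ?_ hβΓ
      refine le_trans ?_ (Finset.single_le_sum (fun k _ => hterm k) (Finset.mem_univ k))
      have habs : v σ * v (flip j σ) ≤ |v σ| * |v (flip j σ)| := by
        rw [← abs_mul]; exact le_abs_self _
      rcases hlow with hlow | hlow
      · simp only [hk, hlow, and_self, if_true]
        have : 0 ≤ (if True ∧ G.IsLow X ε k (flip j σ) then |v σ| * |v (flip j σ)| else 0) := by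
          split_ifs <;> simp [hnn]
        linarith
      · simp only [hk, hlow, and_self, if_true]
        have : 0 ≤ (if True ∧ G.IsLow X ε k σ then |v σ| * |v (flip j σ)| else 0) := by
          split_ifs <;> simp [hnn]
        linarith
  have hlevel : ∀ k : Fin n, ∑ σ, ∑ j : Fin N,
      ((if (j : ℕ) < G.cut N k.succ ∧ G.IsLow X ε k σ then |v σ| * |v (flip j σ)| else 0) +
        (if (j : ℕ) < G.cut N k.succ ∧ G.IsLow X ε k (flip j σ) then
          |v σ| * |v (flip j σ)| else 0)) ≤ (r + 1) * √(N : ℝ) * (v ⬝ᵥ v) := by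
    intro k
    refine le_trans (le_of_eq ?_) (sum_low_edges_le (G.cut N k.succ) r (G.IsLow X ε k) (hr k) v)
    simp only [Finset.sum_add_distrib]
    -- Flipping exchanges the two ends of an edge, so it is enough to count edges whose far end is
    -- low.
    have hsymm : ∑ σ, ∑ j : Fin N,
        (if (j : ℕ) < G.cut N k.succ ∧ G.IsLow X ε k σ then |v σ| * |v (flip j σ)| else 0) =
        ∑ σ, ∑ j : Fin N, (if (j : ℕ) < G.cut N k.succ ∧ G.IsLow X ε k (flip j σ) then
          |v σ| * |v (flip j σ)| else 0) := by
      rw [Finset.sum_comm, Finset.sum_comm (s := (Finset.univ : Finset (Cube N)))]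
      refine Finset.sum_congr rfl fun j _ => ?_
      rw [← sum_flip j]
      refine Finset.sum_congr rfl fun σ _ => ?_
      rw [flip_flip, mul_comm]
    rw [hsymm, ← Finset.sum_add_distrib]
    refine Finset.sum_congr rfl fun σ _ => ?_
    rw [← Finset.sum_add_distrib]
    refine Finset.sum_congr rfl fun j _ => ?_
    split_ifs <;> ring
  have hO : ∑ σ, ∑ j, β * Γ * (v σ * v (flip j σ)) ≤
      β * Γ * (n * ((r + 1) * √(N : ℝ))) * (v ⬝ᵥ v) +
      ∑ σ, ∑ j : Fin N, (if q (flip j σ) = q σ ∧ G.cut N (q σ) ≤ j then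
        β * Γ * (v σ * v (flip j σ)) else 0) := by
    refine (Finset.sum_le_sum fun σ _ => Finset.sum_le_sum fun j _ => hedge σ j).trans ?_
    simp only [Finset.sum_add_distrib, ← Finset.mul_sum]
    rw [add_comm]
    refine add_le_add_left ?_ _
    rw [mul_assoc (β * Γ)]
    refine mul_le_mul_of_nonneg_left ?_ hβΓ
    have hswap : ∀ F : Cube N → Fin N → Fin n → ℝ, ∑ σ, ∑ j, ∑ k, F σ j k =
        ∑ k, ∑ σ, ∑ j, F σ j k := by
      intro F
      rw [Finset.sum_comm (s := (Finset.univ : Finset (Fin n)))]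
      exact Finset.sum_congr rfl fun σ _ => Finset.sum_comm
    simp only [← Finset.sum_add_distrib]
    rw [hswap]
    refine (Finset.sum_le_sum fun k _ => hlevel k).trans_eq ?_
    rw [Finset.sum_const, Finset.card_univ, Fintype.card_fin, nsmul_eq_mul]
    ring
  rw [add_mul]
  linarith

end Decomposition

/-! ### Exponentially small sequences -/

/-- The sequence decays at least exponentially fast. -/
def ExpSmall (s : ℕ → ℝ) : Prop :=
  ∃ c > 0, ∃ C, ∀ᶠ N : ℕ in atTop, s N ≤ C * Real.exp (-(c * N))

lemma ExpSmall.mono {s t : ℕ → ℝ} (ht : ExpSmall t) (h : ∀ᶠ N in atTop, s N ≤ t N) :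
    ExpSmall s := by
  obtain ⟨c, hc, C, hC⟩ := ht
  exact ⟨c, hc, C, by filter_upwards [h, hC] with N h1 h2 using h1.trans h2⟩

lemma ExpSmall.add {s t : ℕ → ℝ} (hs : ExpSmall s) (ht : ExpSmall t) :
    ExpSmall fun N => s N + t N := by
  obtain ⟨c, hc, C, hC⟩ := hs
  obtain ⟨d, hd, D, hD⟩ := ht
  refine ⟨min c d, lt_min hc hd, |C| + |D|, ?_⟩
  filter_upwards [hC, hD] with N h1 h2
  have e1 : Real.exp (-(c * N)) ≤ Real.exp (-(min c d * N)) := by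
    gcongr; exact min_le_left _ _
  have e2 : Real.exp (-(d * N)) ≤ Real.exp (-(min c d * N)) := by
    gcongr; exact min_le_right _ _
  calc s N + t N ≤ |C| * Real.exp (-(c * N)) + |D| * Real.exp (-(d * N)) := by
        refine add_le_add (h1.trans ?_) (h2.trans ?_)
        · gcongr; exact le_abs_self _
        · gcongr; exact le_abs_self _
    _ ≤ |C| * Real.exp (-(min c d * N)) + |D| * Real.exp (-(min c d * N)) := by gcongr
    _ = _ := by ring

lemma ExpSmall.zero : ExpSmall fun _ => 0 :=
  ⟨1, one_pos, 0, Eventually.of_forall fun N => by simp⟩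

lemma ExpSmall.sum {ι : Type*} (I : Finset ι) {s : ι → ℕ → ℝ} (hs : ∀ i ∈ I, ExpSmall (s i)) :
    ExpSmall fun N => ∑ i ∈ I, s i N := by
  classical
  induction I using Finset.induction_on with
  | empty => simpa using ExpSmall.zero
  | insert i I hi ih =>
    simp only [Finset.sum_insert hi]
    exact (hs i (Finset.mem_insert_self _ _)).add
      (ih fun j hj => hs j (Finset.mem_insert_of_mem hj))

lemma ExpSmall.const_mul {s : ℕ → ℝ} (hs : ExpSmall s) {D : ℝ} (hD : 0 ≤ D) :
    ExpSmall fun N => D * s N := by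
  obtain ⟨c, hc, C, hC⟩ := hs
  refine ⟨c, hc, D * C, ?_⟩
  filter_upwards [hC] with N h
  rw [mul_assoc]
  gcongr

lemma expSmall_exp {c : ℝ} (hc : 0 < c) : ExpSmall fun N => Real.exp (-(c * N)) :=
  ⟨c, hc, 1, Eventually.of_forall fun N => by simp⟩

/-- Borel–Cantelli for exponentially small probabilities. -/
lemma ae_eventually_notMem_of_expSmall {Ω : Type*} [MeasurableSpace Ω] {P : Measure Ω}
    [IsProbabilityMeasure P] {s : ℕ → Set Ω} (h : ExpSmall fun N => P.real (s N)) :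
    ∀ᵐ ω ∂P, ∀ᶠ N in atTop, ω ∉ s N := by
  obtain ⟨c, hc, C, hC⟩ := h
  have hsum : Summable fun N : ℕ => P.real (s N) := by
    have h1 : Summable fun N : ℕ => C * Real.exp (-(c * N)) := by
      refine Summable.mul_left _ ?_
      have := Real.summable_exp_nat_mul_iff.2 (neg_lt_zero.2 hc)
      refine this.congr fun N => ?_
      ring_nf
    refine Summable.of_norm_bounded_eventually_nat h1 ?_
    filter_upwards [hC] with N hN
    rwa [Real.norm_of_nonneg measureReal_nonneg]
  refine ae_eventually_notMem ?_
  have : ∀ N, P (s N) = ENNReal.ofReal (P.real (s N)) := fun N => by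
    rw [ofReal_measureReal]
  simp only [this]
  rw [← ENNReal.ofReal_tsum_of_nonneg (fun _ => measureReal_nonneg) hsum]
  exact ENNReal.ofReal_ne_top

lemma eventually_sqrt_le (A B : ℝ) {ε : ℝ} (hε : 0 < ε) :
    ∀ᶠ N : ℕ in atTop, A + B * √(N : ℝ) ≤ ε * N := by
  have h1 : ∀ᶠ N : ℕ in atTop, 2 * |A| / ε ≤ (N : ℝ) :=
    tendsto_natCast_atTop_atTop.eventually_ge_atTop _
  have h2 : ∀ᶠ N : ℕ in atTop, 2 * |B| / ε ≤ √(N : ℝ) :=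
    (Real.tendsto_sqrt_atTop.comp tendsto_natCast_atTop_atTop).eventually_ge_atTop _
  filter_upwards [h1, h2] with N h1 h2
  rw [div_le_iff₀ hε] at h1 h2
  have hs := Real.mul_self_sqrt (Nat.cast_nonneg (α := ℝ) N)
  have h3 : 2 * |B| * √(N : ℝ) ≤ N * ε := by
    calc 2 * |B| * √(N : ℝ) ≤ √(N : ℝ) * ε * √(N : ℝ) := by gcongr
      _ = N * ε := by rw [mul_right_comm, hs]
  have h4 : B * √(N : ℝ) ≤ |B| * √(N : ℝ) := by gcongr; exact le_abs_self _
  linarith [le_abs_self A]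

/-! ### Gaussian estimates -/

/-- The law of a family of independent standard Gaussian variables. -/
abbrev stdGaussianPi (ι : Type*) [Fintype ι] : Measure (ι → ℝ) :=
  Measure.pi fun _ => gaussianReal 0 1

section Gaussian

variable {ι : Type*} [Fintype ι]

lemma integrable_exp_linear (w : ι → ℝ) :
    Integrable (fun X : ι → ℝ => Real.exp (∑ i, w i * X i)) (stdGaussianPi ι) := by
  simp only [Real.exp_sum]
  exact Integrable.fintype_prod fun i => integrable_exp_mul_gaussianReal (w i)

lemma integral_exp_linear (w : ι → ℝ) :
    ∫ X, Real.exp (∑ i, w i * X i) ∂(stdGaussianPi ι) = Real.exp ((∑ i, w i ^ 2) / 2) := by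
  simp only [Real.exp_sum, Finset.sum_div]
  rw [integral_fintype_prod_eq_prod (𝕜 := ℝ) (f := fun i x => Real.exp (w i * x))]
  refine Finset.prod_congr rfl fun i _ => ?_
  have := congrFun (mgf_id_gaussianReal (μ := 0) (v := 1)) (w i)
  simp only [mgf, id] at this
  rw [this]
  simp

/-- Markov's inequality for sums of exponentials of linear functionals. -/
lemma measureReal_sum_exp_linear_ge_le {κ : Type*} (s : Finset κ) (w : κ → ι → ℝ) (d : κ → ℝ)
    (c : ℝ) :
    (stdGaussianPi ι).real {X | Real.exp c ≤ ∑ k ∈ s, Real.exp (∑ i, w k i * X i + d k)} ≤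
      Real.exp (-c) * ∑ k ∈ s, Real.exp ((∑ i, w k i ^ 2) / 2 + d k) := by
  have hint : ∀ k, Integrable (fun X : ι → ℝ => Real.exp (∑ i, w k i * X i + d k))
      (stdGaussianPi ι) := fun k => by
    simp only [Real.exp_add]
    exact (integrable_exp_linear (w k)).mul_const _
  have h := mul_meas_ge_le_integral_of_nonneg (μ := stdGaussianPi ι)
    (f := fun X => ∑ k ∈ s, Real.exp (∑ i, w k i * X i + d k))
    (Eventually.of_forall fun X => Finset.sum_nonneg fun _ _ => (Real.exp_pos _).le)
    (integrable_finsetSum _ fun k _ => hint k) (Real.exp c)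
  rw [integral_finsetSum _ fun k _ => hint k] at h
  simp only [Real.exp_add _ (d _), integral_mul_const, integral_exp_linear] at h ⊢
  rw [Real.exp_neg, ← div_eq_inv_mul, le_div_iff₀' (Real.exp_pos _)]
  exact h

/-- Union bound with the exponential moment of order one. Other orders are obtained by rescaling `w`
and `c`. -/
lemma measureReal_exists_linear_ge_le {κ : Type*} (s : Finset κ) (w : κ → ι → ℝ) (c v : ℝ)
    (hv : ∀ k ∈ s, ∑ i, w k i ^ 2 ≤ v) :
    (stdGaussianPi ι).real {X | ∃ k ∈ s, c ≤ ∑ i, w k i * X i} ≤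
      s.card * Real.exp (v / 2 - c) := by
  have h1 := measureReal_sum_exp_linear_ge_le s w 0 c
  simp only [Pi.zero_apply, add_zero] at h1
  refine (measureReal_mono ?_).trans (h1.trans ?_)
  · rintro X ⟨k, hk, h⟩
    exact (Real.exp_le_exp.2 h).trans (Finset.single_le_sum
      (f := fun k => Real.exp (∑ i, w k i * X i)) (fun _ _ => (Real.exp_pos _).le) hk)
  · have : ∑ k ∈ s, Real.exp ((∑ i, w k i ^ 2) / 2) ≤ s.card * Real.exp (v / 2) := by
      rw [← nsmul_eq_mul]
      refine Finset.sum_le_card_nsmul _ _ _ fun k hk => ?_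
      have := hv k hk
      gcongr
    calc _ ≤ Real.exp (-c) * (s.card * Real.exp (v / 2)) := by gcongr
      _ = _ := by rw [sub_eq_add_neg, Real.exp_add]; ring

/-- The probability that a standard Gaussian variable is at most `-t`. -/
def gaussianTail (t : ℝ) : ℝ := (gaussianReal 0 1).real (Set.Iic (-t))

lemma gaussianTail_le {t : ℝ} (ht : 0 ≤ t) : gaussianTail t ≤ Real.exp (-(t ^ 2 / 2)) := by
  have := measure_le_le_exp_mul_mgf (μ := gaussianReal 0 1) (X := id) (t := -t) (-t)
    (by linarith) (integrable_exp_mul_gaussianReal (-t))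
  rw [mgf_id_gaussianReal] at this
  refine this.trans_eq ?_
  rw [← Real.exp_add]
  congr 1
  simp
  ring

/-- Only the mass of the unit interval left of -t is kept. At t of order √N the loss is a factor
exp(O(√N)), harmless on the exponential scale. -/
lemma gaussianTail_ge {t : ℝ} (ht : 0 ≤ t) :
    (√(2 * Real.pi))⁻¹ * Real.exp (-((t + 1) ^ 2 / 2)) ≤ gaussianTail t := by
  have h1 : (gaussianReal 0 1).real (Set.Icc (-t - 1) (-t)) ≤ gaussianTail t :=
    measureReal_mono Set.Icc_subset_Iic_self
  refine le_trans ?_ h1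
  have h2 : (gaussianReal 0 1).real (Set.Icc (-t - 1) (-t)) =
      ∫ x in Set.Icc (-t - 1) (-t), gaussianPDFReal 0 1 x := by
    rw [Measure.real, gaussianReal_apply_eq_integral 0 one_ne_zero, ENNReal.toReal_ofReal]
    exact integral_nonneg fun x => gaussianPDFReal_nonneg _ _ _
  rw [h2]
  have h3 : ∫ _x in Set.Icc (-t - 1) (-t), (√(2 * Real.pi))⁻¹ * Real.exp (-((t + 1) ^ 2 / 2)) =
      (√(2 * Real.pi))⁻¹ * Real.exp (-((t + 1) ^ 2 / 2)) := by
    rw [setIntegral_const, Measure.real, Real.volume_Icc]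
    simp
  rw [← h3]
  refine setIntegral_mono_on (integrable_const _) (integrable_gaussianPDFReal 0 1).integrableOn
    measurableSet_Icc fun x hx => ?_
  simp only [gaussianPDFReal, NNReal.coe_one, mul_one, sub_zero]
  have hp := Real.pi_pos
  gcongr
  have : x ^ 2 ≤ (t + 1) ^ 2 := by
    rw [sq_le_sq, abs_of_nonneg (by linarith : 0 ≤ t + 1)]
    exact abs_le.2 ⟨by linarith [hx.1], by linarith [hx.2]⟩
  linarith

lemma gaussianTail_pos {t : ℝ} (ht : 0 ≤ t) : 0 < gaussianTail t :=
  lt_of_lt_of_le (by have := Real.pi_pos; positivity) (gaussianTail_ge ht)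

lemma measureReal_forall_le {t : ι → ℝ} (I : Finset ι) :
    (stdGaussianPi ι).real {X | ∀ i ∈ I, X i ≤ -t i} = ∏ i ∈ I, gaussianTail (t i) := by
  classical
  have h : {X : ι → ℝ | ∀ i ∈ I, X i ≤ -t i} =
      Set.univ.pi fun i => if i ∈ I then Set.Iic (-t i) else Set.univ := by
    ext X
    simp only [Set.mem_ofPred_eq, Set.mem_pi, Set.mem_univ, true_imp_iff]
    refine forall_congr' fun i => ?_
    split_ifs with hi <;> simp [hi]
  rw [h, Measure.real, Measure.pi_pi, ENNReal.toReal_prod]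
  have h2 : ∀ i, ((gaussianReal 0 1) (if i ∈ I then Set.Iic (-t i) else Set.univ)).toReal =
      if i ∈ I then gaussianTail (t i) else 1 := by
    intro i
    split_ifs
    · rfl
    · simp
  simp only [h2]
  rw [Finset.prod_ite_mem, Finset.univ_inter]

end Gaussian

/-! ### Products over the cube -/

lemma prod_ite_lt {N c : ℕ} (hc : c ≤ N) (a b : ℝ) :
    ∏ i : Fin N, (if (i : ℕ) < c then a else b) = a ^ c * b ^ (N - c) := by
  rw [Fin.prod_univ_eq_prod_range (fun i => if i < c then a else b) N,
    ← Finset.prod_range_mul_prod_Ico _ hc]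
  congr 1
  · rw [Finset.prod_congr rfl (g := fun _ => a) fun i hi => by simp [Finset.mem_range.1 hi]]
    simp
  · rw [Finset.prod_congr rfl (g := fun _ => b) fun i hi => by
      simp [(Finset.mem_Ico.1 hi).1.not_gt]]
    simp

/-! ### The upper bound -/

section Upper

variable (G : Params n) {N : ℕ}

open Classical in
/-- The coefficients of the linear functional `X ↦ ∑ k, b k * X_{σ₁ ⋯ σ_k}`. -/
def Params.levelWeight (b : Fin n → ℝ) (σ : Cube N) (i : G.Index N) : ℝ :=
  if i = G.idx i.1 σ then b i.1 else 0

variable {G}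

/-- On each level exactly one index lies on the path of σ. A general `F` vanishing at weight zero
covers both the functional and its variance. -/
lemma sum_levelWeight (F : Fin n → ℝ → ℝ → ℝ) (hF : ∀ k x, F k 0 x = 0) (b : Fin n → ℝ)
    (σ : Cube N) (X : G.Index N → ℝ) : ∑ i, F i.1 (G.levelWeight b σ i) (X i) =
      ∑ k, F k (b k) (X (G.idx k σ)) := by
  classical
  rw [Fintype.sum_sigma]
  refine Finset.sum_congr rfl fun k _ => ?_
  rw [Finset.sum_eq_single (fun i => σ i.1)]
  · have : (⟨k, fun i => σ i.1⟩ : G.Index N) = G.idx k σ := rfl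
    simp only [this, Params.levelWeight]
    rw [if_pos trivial]
  · intro p _ hp
    simp only [Params.levelWeight]
    rw [if_neg, hF]
    intro h
    simp only [Params.idx, Sigma.mk.injEq, heq_eq_eq, true_and] at h
    exact hp h
  · simp

lemma sum_levelWeight_mul (b : Fin n → ℝ) (σ : Cube N) (X : G.Index N → ℝ) :
    ∑ i, G.levelWeight b σ i * X i = ∑ k, b k * X (G.idx k σ) :=
  sum_levelWeight (fun _ a x => a * x) (fun _ _ => zero_mul _) b σ X

lemma sum_levelWeight_sq (b : Fin n → ℝ) (σ : Cube N) :
    ∑ i, G.levelWeight b σ i ^ 2 = ∑ k, b k ^ 2 :=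
  sum_levelWeight (fun _ a _ => a ^ 2) (fun _ _ => by simp) b σ (0 : G.Index N → ℝ)

variable (G) in
/-- The truncated potential in which the levels are observed at reduced inverse temperatures. -/
def Params.reduced (β : ℝ) (h : Fin n → ℝ) (X : G.Index N → ℝ) (κ : ℕ) (σ : Cube N) : ℝ :=
  psum (fun k => -(β * √(N : ℝ) * √(G.a k) / h k) * X (G.idx k σ)) κ

/-- The coefficients of `Params.reduced`. -/
def Params.reducedWeight (G : Params n) (N : ℕ) (β : ℝ) (h : Fin n → ℝ) (κ : ℕ) (k : Fin n) : ℝ :=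
  if (k : ℕ) < κ then -(β * √(N : ℝ) * √(G.a k) / h k) else 0

lemma reduced_eq (β : ℝ) (h : Fin n → ℝ) (X : G.Index N → ℝ) (κ : ℕ) (σ : Cube N) :
    G.reduced β h X κ σ = ∑ i, G.levelWeight (G.reducedWeight N β h κ) σ i * X i := by
  rw [sum_levelWeight_mul, Params.reduced, psum]
  refine Finset.sum_congr rfl fun k _ => ?_
  unfold Params.reducedWeight
  split_ifs <;> simp

lemma reducedWeight_sq (β : ℝ) (h : Fin n → ℝ) (κ : ℕ) (σ : Cube N) :
    (∑ i, G.levelWeight (G.reducedWeight N β h κ) σ i ^ 2) / 2 =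
      N * psum (fun k => β ^ 2 * G.a k / (2 * h k ^ 2)) κ := by
  rw [sum_levelWeight_sq, ← psum_const_mul, psum, Finset.sum_div]
  refine Finset.sum_congr rfl fun k _ => ?_
  unfold Params.reducedWeight
  split_ifs
  · rw [neg_sq, div_pow, mul_pow, mul_pow, Real.sq_sqrt (Nat.cast_nonneg _),
      Real.sq_sqrt (G.a_pos k).le]
    ring
  · simp

lemma reduced_congr (β : ℝ) (h : Fin n → ℝ) (X : G.Index N → ℝ) (κ : Fin (n + 1))
    {σ τ : Cube N} (hστ : ∀ i : Fin N, (i : ℕ) < G.cut N κ → σ i = τ i) :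
    G.reduced β h X κ σ = G.reduced β h X κ τ := by
  unfold Params.reduced psum
  refine Finset.sum_congr rfl fun k _ => ?_
  split_ifs with hk
  · have : G.idx k σ = G.idx k τ := by
      rw [G.idx_eq_iff]
      intro i hi
      refine hστ i (hi.trans_le (G.cut_mono N ?_))
      rw [Fin.le_def, Fin.val_succ]
      omega
    simp only [this]
  · rfl

/-- Representatives of the configurations of the first `c` spins. -/
def prefixes (N c : ℕ) : Finset (Cube N) :=
  Fintype.piFinset fun i : Fin N => if (i : ℕ) < c then Finset.univ else {1}

lemma card_prefixes {c : ℕ} (hc : c ≤ N) : ((prefixes N c).card : ℝ) = 2 ^ c := by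
  rw [prefixes, Fintype.card_piFinset, Nat.cast_prod]
  have h2 : (Finset.univ : Finset ℤˣ).card = 2 := rfl
  rw [Finset.prod_congr rfl (g := fun i : Fin N => if (i : ℕ) < c then (2 : ℝ) else 1)
    fun i _ => by split_ifs <;> simp]
  rw [prod_ite_lt hc]
  simp

lemma exists_mem_prefixes (c : ℕ) (σ : Cube N) :
    ∃ η ∈ prefixes N c, ∀ i : Fin N, (i : ℕ) < c → σ i = η i := by
  refine ⟨fun i => if (i : ℕ) < c then σ i else 1, ?_, fun i hi => by simp [hi]⟩
  rw [prefixes, Fintype.mem_piFinset]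
  intro i
  split_ifs
  · exact Finset.mem_univ _
  · exact Finset.mem_singleton_self _

/-- The factor 2 absorbs the rounding up in ⌈x_κ N⌉. -/
lemma two_pow_cut_le (κ : Fin (n + 1)) :
    (2 : ℝ) ^ G.cut N κ ≤ 2 * Real.exp (N * (G.x κ * Real.log 2)) := by
  have hlog := Real.log_pos (by norm_num : (1 : ℝ) < 2)
  have h1 : (2 : ℝ) ^ G.cut N κ = Real.exp (G.cut N κ * Real.log 2) := by
    rw [Real.exp_nat_mul, Real.exp_log (by norm_num)]
  have h2 : (2 : ℝ) = Real.exp (Real.log 2) := (Real.exp_log (by norm_num)).symm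
  rw [h1]
  nth_rewrite 2 [h2]
  rw [← Real.exp_add]
  refine Real.exp_le_exp.2 ?_
  nlinarith [G.cut_lt N κ]

/-- The exponential growth rate of the first moment of the reduced partition function. -/
def Params.reducedRate (G : Params n) (β : ℝ) (h : Fin n → ℝ) (κ : ℕ) : ℝ :=
  psum (fun k => G.gap k * Real.log 2 + β ^ 2 * G.a k / (2 * h k ^ 2)) κ

lemma reducedRate_eq (β : ℝ) (h : Fin n → ℝ) (κ : Fin (n + 1)) : G.reducedRate β h κ =
    G.x κ * Real.log 2 + psum (fun k => β ^ 2 * G.a k / (2 * h k ^ 2)) κ := by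
  rw [Params.reducedRate, psum_add, ← G.psum_gap κ, mul_comm, ← psum_const_mul]
  congr 2
  funext k
  ring

/-- The union bound runs only over prefixes of length cut(κ), on which the reduced potential
depends; this makes the entropy term x_κ log 2 instead of log 2. Having this for every κ supplies
the partial-sum hypothesis of the Abel summation. -/
lemma expSmall_exists_reduced_ge (β : ℝ) (h : Fin n → ℝ) (κ : Fin (n + 1)) {ε : ℝ} (hε : 0 < ε) :
    ExpSmall fun N => (stdGaussianPi (G.Index N)).real
      {X | ∃ σ, N * (G.reducedRate β h κ + ε) ≤ G.reduced β h X κ σ} := by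
  refine ((expSmall_exp hε).const_mul (D := 2) (by norm_num)).mono
    (Eventually.of_forall fun N => ?_)
  have h1 := measureReal_exists_linear_ge_le (prefixes N (G.cut N κ))
    (fun σ => G.levelWeight (G.reducedWeight N β h κ) σ) (N * (G.reducedRate β h κ + ε))
    (2 * (N * psum (fun k => β ^ 2 * G.a k / (2 * h k ^ 2)) κ))
    (fun σ _ => by rw [← reducedWeight_sq β h κ σ]; linarith)
  refine (measureReal_mono ?_).trans (h1.trans ?_)
  · rintro X ⟨σ, hσ⟩
    obtain ⟨η, hη, he⟩ := exists_mem_prefixes (G.cut N κ) σ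
    refine ⟨η, hη, ?_⟩
    rwa [← reduced_eq, ← reduced_congr β h X κ he]
  · rw [card_prefixes (G.cut_le N κ)]
    calc _ ≤ 2 * Real.exp (N * (G.x κ * Real.log 2)) * Real.exp
          (2 * (N * psum (fun k => β ^ 2 * G.a k / (2 * h k ^ 2)) κ) / 2 -
            N * (G.reducedRate β h κ + ε)) := by gcongr; exact two_pow_cut_le κ
      _ = _ := by
        rw [mul_assoc, ← Real.exp_add, reducedRate_eq]
        congr 2
        ring

lemma sum_exp_tailField (c : ℕ) (hc : c ≤ N) (t : ℝ) :
    ∑ η : Cube N, Real.exp (∑ j, tailField c t j * ((η j : ℤ) : ℝ)) =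
      2 ^ c * (2 * Real.cosh t) ^ (N - c) := by
  simp only [Real.exp_sum]
  rw [sum_cube_prod (fun j s => Real.exp (tailField c t j * ((s : ℤ) : ℝ))), ← prod_ite_lt hc]
  refine Finset.prod_congr rfl fun j _ => ?_
  by_cases hj : (j : ℕ) < c
  · simp [tailField, hj, hj.not_ge]; norm_num
  · simp [tailField, hj, not_lt.1 hj, Real.cosh_eq]; ring

lemma log_two_le_log_two_cosh (t : ℝ) : Real.log 2 ≤ Real.log (2 * Real.cosh t) :=
  Real.log_le_log (by norm_num) (by linarith [Real.one_le_cosh t])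

lemma pow_mul_cosh_pow_eq {c : ℕ} (hc : c ≤ N) (t : ℝ) :
    (2 : ℝ) ^ c * (2 * Real.cosh t) ^ (N - c) =
      Real.exp (c * Real.log 2 + (N - c) * Real.log (2 * Real.cosh t)) := by
  have hcosh : 0 < 2 * Real.cosh t := by linarith [Real.cosh_pos t]
  rw [Real.exp_add, Real.exp_nat_mul, Real.exp_log (by norm_num), ← Nat.cast_sub hc,
    Real.exp_nat_mul, Real.exp_log hcosh]

lemma pow_mul_cosh_pow_le (κ : Fin (n + 1)) (t : ℝ) :
    (2 : ℝ) ^ G.cut N κ * (2 * Real.cosh t) ^ (N - G.cut N κ) ≤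
      2 * Real.exp (N * (G.x κ * Real.log 2 + (1 - G.x κ) * Real.log (2 * Real.cosh t))) := by
  rw [pow_mul_cosh_pow_eq (G.cut_le N κ)]
  have h2 : (2 : ℝ) = Real.exp (Real.log 2) := (Real.exp_log (by norm_num)).symm
  have hlog := Real.log_pos (by norm_num : (1 : ℝ) < 2)
  have hp := log_two_le_log_two_cosh t
  conv_rhs => rw [h2, ← Real.exp_add, ← h2]
  refine Real.exp_le_exp.2 ?_
  nlinarith [G.cut_lt N κ, G.le_cut N κ,
    mul_le_mul_of_nonneg_right (G.cut_lt N κ).le hlog.le,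
    mul_le_mul_of_nonneg_right (G.le_cut N κ) (hlog.le.trans hp)]

/-- Markov's inequality: the Gaussian moment is the same for all η, and the deterministic tail
factor sums to 2^c (2 cosh βΓ)^(N-c). -/
lemma expSmall_sum_exp_reduced_ge (β Γ : ℝ) (h : Fin n → ℝ) (κ : Fin (n + 1)) {ε : ℝ}
    (hε : 0 < ε) : ExpSmall fun N => (stdGaussianPi (G.Index N)).real
      {X | Real.exp (N * (G.reducedRate β h κ + (1 - G.x κ) * Real.log (2 * Real.cosh (β * Γ)) + ε))
        ≤ ∑ η : Cube N, Real.exp (G.reduced β h X κ η +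
          ∑ j, tailField (G.cut N κ) (β * Γ) j * ((η j : ℤ) : ℝ))} := by
  refine ((expSmall_exp hε).const_mul (D := 2) (by norm_num)).mono
    (Eventually.of_forall fun N => ?_)
  have h1 := measureReal_sum_exp_linear_ge_le (Finset.univ : Finset (Cube N))
    (fun σ => G.levelWeight (G.reducedWeight N β h κ) σ)
    (fun η => ∑ j, tailField (G.cut N κ) (β * Γ) j * ((η j : ℤ) : ℝ))
    (N * (G.reducedRate β h κ + (1 - G.x κ) * Real.log (2 * Real.cosh (β * Γ)) + ε))
  simp only [← reduced_eq, reducedWeight_sq, Real.exp_add (_ * _) (∑ j, _)] at h1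
  rw [← Finset.mul_sum, sum_exp_tailField _ (G.cut_le N κ)] at h1
  refine h1.trans ?_
  calc _ ≤ Real.exp (-(N * (G.reducedRate β h κ +
          (1 - G.x κ) * Real.log (2 * Real.cosh (β * Γ)) + ε))) *
        (Real.exp (N * psum (fun k => β ^ 2 * G.a k / (2 * h k ^ 2)) κ) *
        (2 * Real.exp (N * (G.x κ * Real.log 2 +
          (1 - G.x κ) * Real.log (2 * Real.cosh (β * Γ)))))) := by
        have := pow_mul_cosh_pow_le (G := G) (N := N) κ (β * Γ)
        exact mul_le_mul_of_nonneg_left (mul_le_mul_of_nonneg_left this (Real.exp_pos _).le)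
          (Real.exp_pos _).le
    _ = _ := by
      rw [mul_left_comm (Real.exp (N * psum _ _)), ← Real.exp_add, mul_left_comm, ← Real.exp_add,
        reducedRate_eq]
      congr 2
      ring

-- Neighbours of σ across different sites j below the cut have different prefixes, so their level-k
-- variables are independent, each low with probability at most exp(-ε²N/2). Having r low ones costs
-- exp(-rε²N/2), which by the choice of r beats the at most n·4^N triples of a level, a
-- configuration and a set of sites.
open Classical in
lemma expSmall_many_low_neighbours {ε : ℝ} (hε : 0 < ε) {r : ℕ}
    (hr : Real.log 4 + 1 ≤ r * (ε ^ 2 / 2)) :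
    ExpSmall fun N => (stdGaussianPi (G.Index N)).real
      {X | ∃ (k : Fin n) (σ : Cube N), r < (Finset.univ.filter fun j : Fin N =>
        (j : ℕ) < G.cut N k.succ ∧ G.IsLow X ε k (flip j σ)).card} := by
  refine ((expSmall_exp one_pos).const_mul (D := n) (Nat.cast_nonneg _)).mono
    (Eventually.of_forall fun N => ?_)
  set T : Finset (Fin n × Cube N × Finset (Fin N)) := Finset.univ.filter fun q =>
    q.2.2.card = r ∧ ∀ j ∈ q.2.2, (j : ℕ) < G.cut N q.1.succ with hT
  set E : Fin n × Cube N × Finset (Fin N) → Set (G.Index N → ℝ) := fun q =>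
    {X | ∀ i ∈ q.2.2.image fun j => G.idx q.1 (flip j q.2.1), X i ≤ -(ε * √(N : ℝ))} with hE
  have hsub : {X | ∃ (k : Fin n) (σ : Cube N), r < (Finset.univ.filter fun j : Fin N =>
      (j : ℕ) < G.cut N k.succ ∧ G.IsLow X ε k (flip j σ)).card} ⊆ ⋃ q ∈ T, E q := by
    rintro X ⟨k, σ, h⟩
    obtain ⟨J, hJ, hcard⟩ := Finset.exists_subset_card_eq h.le
    refine Set.mem_biUnion (x := (k, σ, J)) ?_ ?_
    · simp only [hT, Finset.coe_filter, Finset.mem_univ, true_and]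
      exact ⟨hcard, fun j hj => (Finset.mem_filter.1 (hJ hj)).2.1⟩
    · intro i hi
      obtain ⟨j, hj, rfl⟩ := Finset.mem_image.1 hi
      exact (Finset.mem_filter.1 (hJ hj)).2.2
  have hmeas : ∀ q ∈ T, (stdGaussianPi (G.Index N)).real (E q) ≤
      Real.exp (-(N * (r * (ε ^ 2 / 2)))) := by
    rintro ⟨k, σ, J⟩ hq
    simp only [hT, Finset.mem_filter, Finset.mem_univ, true_and] at hq
    have h0 : 0 ≤ ε * √(N : ℝ) := by positivity
    rw [hE, measureReal_forall_le (t := fun _ => ε * √(N : ℝ)), Finset.prod_const,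
      Finset.card_image_of_injOn, hq.1]
    · calc _ ≤ Real.exp (-((ε * √(N : ℝ)) ^ 2 / 2)) ^ r :=
            pow_le_pow_left₀ (gaussianTail_pos h0).le (gaussianTail_le h0) _
        _ = _ := by
          rw [← Real.exp_nat_mul, mul_pow, Real.sq_sqrt (Nat.cast_nonneg _)]
          congr 1
          ring
    -- Equal prefixes would agree at site j < cut, where one configuration is flipped and the other
    -- is not.
    · intro j hj j' hj' he
      by_contra hne
      have := (G.idx_eq_iff k _ _).1 he j (hq.2 j hj)
      rw [flip_apply_self, flip_apply_of_ne hne] at this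
      change -σ j = σ j at this
      rcases units_int_cases (σ j) with h | h <;> rw [h] at this <;> exact absurd this (by decide)
  have hcardT : (T.card : ℝ) ≤ n * (2 ^ N * 2 ^ N) := by
    have h1 : T.card ≤ Fintype.card (Fin n × Cube N × Finset (Fin N)) := Finset.card_le_univ _
    have h2 : Fintype.card (Fin n × Cube N × Finset (Fin N)) = n * (2 ^ N * 2 ^ N) := by
      simp [Fintype.card_prod]
    rw [h2] at h1
    exact_mod_cast h1
  refine (measureReal_mono hsub (measure_ne_top _ _)).trans ((measureReal_biUnion_finset_le _ _).trans ?_)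
  refine (Finset.sum_le_card_nsmul _ _ _ hmeas).trans ?_
  rw [nsmul_eq_mul]
  have h4 : (2 : ℝ) ^ N * 2 ^ N = Real.exp (N * Real.log 4) := by
    rw [Real.exp_nat_mul, Real.exp_log (by norm_num), ← mul_pow]; norm_num
  rw [h4] at hcardT
  calc _ ≤ n * Real.exp (N * Real.log 4) * Real.exp (-(N * (r * (ε ^ 2 / 2)))) := by gcongr
    _ = n * Real.exp (N * Real.log 4 + -(N * (r * (ε ^ 2 / 2)))) := by
      rw [Real.exp_add]; ring
    _ ≤ _ := by
      gcongr
      nlinarith [mul_le_mul_of_nonneg_left hr (Nat.cast_nonneg (α := ℝ) N)]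

/-- Deterministic comparison of the truncated and the reduced potential. -/
lemma neg_mul_truncated_le {β : ℝ} {h : Fin n → ℝ} (hh : Antitone h) (h1 : ∀ k, 1 ≤ h k)
    {X : G.Index N → ℝ} {σ : Cube N} {ε E : ℝ} (hε : 0 ≤ ε) (hE0 : 0 ≤ E)
    (hE : ∀ k, h k - 1 ≤ E)
    (hX : ∀ κ : Fin (n + 1), G.reduced β h X κ σ ≤ N * (G.reducedRate β h κ + ε))
    (κ : Fin (n + 1)) :
    -β * G.truncated X κ σ ≤ G.reduced β h X κ σ + N * (psum (fun k =>
      h k * (G.gap k * Real.log 2) + β ^ 2 * G.a k / (2 * h k)) κ - G.reducedRate β h κ) +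
      E * (N * ε) := by
  -- Level k of the negative potential at β is h_k times the reduced one. Writing h_k = 1 + (h_k -
  -- 1), the second part is compared with its rate by Abel summation; `hX` bounds the partial sums
  -- of the deficits from below.
  have habel := psum_mul_ge_of_antitone (e := fun k => h k - 1)
    (d := fun k => N * (G.gap k * Real.log 2 + β ^ 2 * G.a k / (2 * h k ^ 2)) -
      -(β * √(N : ℝ) * √(G.a k) / h k) * X (G.idx k σ))
    (fun i j hij => sub_le_sub_right (hh hij) 1) (fun k => sub_nonneg.2 (h1 k))
    (ε := N * ε) (E := E) (by positivity) hE0 hE (fun κ hκ => by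
      have := hX ⟨κ, by omega⟩
      rw [psum_sub, psum_const_mul]
      simp only [Params.reduced, Params.reducedRate] at this
      linarith) (κ := κ) (by omega)
  have e1 : -β * G.truncated X κ σ - G.reduced β h X κ σ =
      psum (fun k => (h k - 1) * (-(β * √(N : ℝ) * √(G.a k) / h k) * X (G.idx k σ))) κ := by
    rw [Params.truncated, ← psum_const_mul, ← psum_const_mul, Params.reduced, ← psum_sub]
    congr 1
    funext k
    have := (zero_lt_one.trans_le (h1 k)).ne'
    field_simp
    ring
  have e2 : N * (psum (fun k => h k * (G.gap k * Real.log 2) + β ^ 2 * G.a k / (2 * h k)) κ -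
      G.reducedRate β h κ) = psum (fun k => (h k - 1) *
        (N * (G.gap k * Real.log 2 + β ^ 2 * G.a k / (2 * h k ^ 2)))) κ := by
    rw [Params.reducedRate, ← psum_sub, ← psum_const_mul]
    congr 1
    funext k
    have := (zero_lt_one.trans_le (h1 k)).ne'
    field_simp
  simp only [mul_sub (h _ - 1)] at habel
  rw [psum_sub, ← e1, ← e2] at habel
  linarith

/-- With overwhelming probability the pressure is not much larger than its limit. -/
theorem expSmall_pressure_ge {m : ℕ} {y : Fin (m + 1) → ℝ} (hy : G.IsHullSubdivision y) {β Γ : ℝ}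
    (hβ : 0 ≤ β) (hΓ : 0 ≤ Γ) {ε₀ : ℝ} (hε₀ : 0 < ε₀) :
    ExpSmall fun N => (stdGaussianPi (G.Index N)).real
      {X | G.variationalPressure y β Γ + ε₀ ≤ pressure β (G.potential N X) (fun _ => Γ)} := by
  classical
  obtain ⟨h, hanti, hone, hub, -, -⟩ := exists_optimal_profile hy hβ Γ
  set p := Real.log (2 * Real.cosh (β * Γ)) with hp
  set V := G.variationalPressure y β Γ with hV
  set E := ∑ k, (h k - 1) with hE
  have hE0 : 0 ≤ E := Finset.sum_nonneg fun k _ => sub_nonneg.2 (hone k)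
  have hEk : ∀ k, h k - 1 ≤ E := fun k => Finset.single_le_sum
    (f := fun k => h k - 1) (fun k _ => sub_nonneg.2 (hone k)) (Finset.mem_univ k)
  -- The three losses, in units of ε: levels dropped as not low, the first moment bound, and Abel
  -- summation.
  set D := β * n + 1 + E with hD
  have hDpos : 0 < D := by positivity
  set ε := ε₀ / (2 * D) with hεdef
  have hε : 0 < ε := by positivity
  have hDε : D * ε = ε₀ / 2 := by rw [hεdef]; field_simp
  obtain ⟨r, hr⟩ := exists_nat_ge ((Real.log 4 + 1) / (ε ^ 2 / 2))
  rw [div_le_iff₀ (by positivity)] at hr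
  have hsmall := ((expSmall_many_low_neighbours (G := G) hε hr).add
    (ExpSmall.sum Finset.univ fun κ _ => expSmall_exists_reduced_ge (G := G) β h κ hε)).add
    (ExpSmall.sum Finset.univ fun κ _ => expSmall_sum_exp_reduced_ge (G := G) β Γ h κ hε)
  refine hsmall.mono ?_
  -- The remaining corrections are the number n + 1 of classes and the O(√N) norm of the removed
  -- flips.
  filter_upwards [eventually_gt_atTop 0, eventually_sqrt_le (Real.log (n + 1))
    (β * Γ * (n * (r + 1))) (show 0 < ε₀ / 4 by positivity)] with N hN hlarge
  have hNpos : (0 : ℝ) < N := by exact_mod_cast hN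
  refine (measureReal_mono (?_ : _ ⊆ (_ ∪ ⋃ κ ∈ (Finset.univ : Finset (Fin (n + 1))), _) ∪
    ⋃ κ ∈ (Finset.univ : Finset (Fin (n + 1))), _)).trans
    ((measureReal_union_le _ _).trans (add_le_add ((measureReal_union_le _ _).trans
      (add_le_add le_rfl (measureReal_biUnion_finset_le _ _)))
      (measureReal_biUnion_finset_le _ _)))
  intro X hX
  by_contra hcon
  simp only [Set.mem_union, Set.mem_iUnion, Set.mem_ofPred_eq, not_or, not_exists, not_le, not_lt,
    Finset.mem_univ, forall_true_left] at hcon hX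
  obtain ⟨⟨hA, hB⟩, hC⟩ := hcon
  -- The reduced rate enters with opposite signs in the comparison and in the moment bound and
  -- cancels; `hub κ` bounds what is left by V.
  have hbound : ∀ κ : Fin (n + 1), ∑ η : Cube N, Real.exp (-β * G.truncated X κ η +
      ∑ j, tailField (G.cut N κ) (β * Γ) j * ((η j : ℤ) : ℝ)) ≤
      Real.exp (N * (V + (1 + E) * ε)) := by
    intro κ
    calc _ ≤ ∑ η : Cube N, Real.exp (N * (psum (fun k =>
            h k * (G.gap k * Real.log 2) + β ^ 2 * G.a k / (2 * h k)) κ -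
              G.reducedRate β h κ) + E * (N * ε)) * Real.exp (G.reduced β h X κ η +
            ∑ j, tailField (G.cut N κ) (β * Γ) j * ((η j : ℤ) : ℝ)) := by
          refine Finset.sum_le_sum fun η _ => ?_
          rw [← Real.exp_add]
          refine Real.exp_le_exp.2 ?_
          have := neg_mul_truncated_le (G := G) hanti hone hε.le hE0 hEk
            (fun κ => (hB κ η).le) κ
          linarith
      _ ≤ Real.exp (N * (psum (fun k =>
            h k * (G.gap k * Real.log 2) + β ^ 2 * G.a k / (2 * h k)) κ -
              G.reducedRate β h κ) + E * (N * ε)) *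
            Real.exp (N * (G.reducedRate β h κ + (1 - G.x κ) * p + ε)) := by
          rw [← Finset.mul_sum]
          exact mul_le_mul_of_nonneg_left (hC κ).le (Real.exp_pos _).le
      _ ≤ _ := by
          rw [← Real.exp_add]
          refine Real.exp_le_exp.2 ?_
          nlinarith [mul_le_mul_of_nonneg_left (hub κ) hNpos.le]
  have hZ := trace_exp_le_of_few_low_neighbours (G := G) (X := X) hβ hΓ hε.le r hA
  have hZpos := trace_exp_pos (diagonal_add_transversalField_isSymm
    (fun σ => -β * G.potential N X σ) (fun _ => β * Γ))
  rw [pressure_eq, one_div, inv_mul_eq_div, le_div_iff₀ hNpos] at hX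
  have hlog := Real.log_le_log hZpos (hZ.trans (mul_le_mul_of_nonneg_left
    (Finset.sum_le_sum fun κ _ => hbound κ) (Real.exp_pos _).le))
  rw [Finset.sum_const, Finset.card_univ, Fintype.card_fin, nsmul_eq_mul,
    Real.log_mul (Real.exp_pos _).ne' (by positivity), Real.log_mul (by positivity)
    (Real.exp_pos _).ne', Real.log_exp, Real.log_exp] at hlog
  push_cast at hlog
  have := hX.trans hlog
  nlinarith [mul_pos hNpos hε₀, congrArg (fun z : ℝ => (N : ℝ) * z) hDε]

end Upper

/-! ### The second moment method -/

/-- Chebyshev's inequality for the number of events which occur. -/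
lemma measureReal_count_le {S Λ : Type*} [MeasurableSpace S] [Fintype Λ] [Nonempty Λ]
    (μ : Measure S) [IsProbabilityMeasure μ] (C : Λ → Set S) (hC : ∀ l, MeasurableSet (C l))
    {Q : ℝ} (hQ : 0 < Q) (h1 : ∀ l, μ.real (C l) = Q) (ρ : Λ → Λ → ℝ)
    (h2 : ∀ l l', μ.real (C l ∩ C l') ≤ Q ^ 2 * (1 + ρ l l')) :
    μ.real {X | ∑ l, (C l).indicator (fun _ => (1 : ℝ)) X ≤ Fintype.card Λ * Q / 2} ≤
      4 * (∑ l, ∑ l', ρ l l') / (Fintype.card Λ : ℝ) ^ 2 := by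
  set M : ℝ := (Fintype.card Λ : ℝ) with hM
  have hMpos : 0 < M := by rw [hM]; exact_mod_cast Fintype.card_pos
  set Z : S → ℝ := fun X => ∑ l, (C l).indicator (fun _ => (1 : ℝ)) X with hZ
  have hint1 : ∀ D : Set S, MeasurableSet D →
      Integrable (D.indicator fun _ => (1 : ℝ)) μ := fun D hD =>
    (integrable_const (1 : ℝ)).indicator hD
  have hZint : Integrable Z μ := integrable_finsetSum _ fun l _ => hint1 _ (hC l)
  have hZ1 : ∫ X, Z X ∂μ = M * Q := by
    rw [integral_finsetSum _ fun l _ => hint1 _ (hC l)]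
    simp only [integral_indicator_const _ (hC _), h1, smul_eq_mul, mul_one]
    rw [Finset.sum_const, Finset.card_univ, nsmul_eq_mul]
  have hZsq : ∀ X, Z X ^ 2 = ∑ l, ∑ l', (C l ∩ C l').indicator (fun _ => (1 : ℝ)) X := by
    intro X
    rw [sq, hZ, Finset.sum_mul_sum]
    refine Finset.sum_congr rfl fun l _ => Finset.sum_congr rfl fun l' _ => ?_
    by_cases hx : X ∈ C l <;> by_cases hx' : X ∈ C l' <;> simp [hx, hx']
  have hZsqint : Integrable (fun X => Z X ^ 2) μ := by
    simp only [hZsq]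
    exact integrable_finsetSum _ fun l _ => integrable_finsetSum _ fun l' _ =>
      hint1 _ ((hC l).inter (hC l'))
  have hZ2 : ∫ X, Z X ^ 2 ∂μ ≤ M ^ 2 * Q ^ 2 + Q ^ 2 * ∑ l, ∑ l', ρ l l' := by
    simp only [hZsq]
    rw [integral_finsetSum _ fun l _ => integrable_finsetSum _ fun l' _ =>
      hint1 _ ((hC l).inter (hC l'))]
    have : ∀ l, ∫ X, ∑ l', (C l ∩ C l').indicator (fun _ => (1 : ℝ)) X ∂μ ≤
        ∑ l', Q ^ 2 * (1 + ρ l l') := by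
      intro l
      rw [integral_finsetSum _ fun l' _ => hint1 _ ((hC l).inter (hC l'))]
      refine Finset.sum_le_sum fun l' _ => ?_
      rw [integral_indicator_const _ ((hC l).inter (hC l'))]
      simpa using h2 l l'
    refine (Finset.sum_le_sum fun l _ => this l).trans_eq ?_
    simp only [← Finset.mul_sum, Finset.sum_add_distrib, Finset.sum_const, Finset.card_univ,
      nsmul_eq_mul, ← hM]
    ring
  have hcenter : ∫ X, (Z X - M * Q) ^ 2 ∂μ ≤ Q ^ 2 * ∑ l, ∑ l', ρ l l' := by
    have e : ∀ X, (Z X - M * Q) ^ 2 = Z X ^ 2 - 2 * (M * Q) * Z X + (M * Q) ^ 2 := fun X => by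
      ring
    simp only [e]
    have hi : Integrable (fun X => Z X ^ 2 - 2 * (M * Q) * Z X) μ :=
      hZsqint.sub (hZint.const_mul _)
    rw [integral_add hi (integrable_const _),
      integral_sub hZsqint (hZint.const_mul _), integral_const_mul, hZ1]
    simp
    nlinarith
  have hcint : Integrable (fun X => (Z X - M * Q) ^ 2) μ := by
    have e : ∀ X, (Z X - M * Q) ^ 2 = Z X ^ 2 - 2 * (M * Q) * Z X + (M * Q) ^ 2 := fun X => by
      ring
    simp only [e]
    exact (hZsqint.sub (hZint.const_mul _)).add (integrable_const _)
  have hmarkov := mul_meas_ge_le_integral_of_nonneg (μ := μ)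
    (f := fun X => (Z X - M * Q) ^ 2) (Eventually.of_forall fun X => sq_nonneg _) hcint
    ((M * Q / 2) ^ 2)
  have hsub : μ.real {X | Z X ≤ M * Q / 2} ≤ μ.real {X | (M * Q / 2) ^ 2 ≤ (Z X - M * Q) ^ 2} := by
    refine measureReal_mono fun X hX => ?_
    have hX' : Z X ≤ M * Q / 2 := hX
    have hMQ : 0 < M * Q := by positivity
    show (M * Q / 2) ^ 2 ≤ (Z X - M * Q) ^ 2
    nlinarith
  refine hsub.trans ?_
  rw [le_div_iff₀ (by positivity)]
  have h3 := hmarkov.trans hcenter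
  have h4 : Q ^ 2 * (μ.real {X | (M * Q / 2) ^ 2 ≤ (Z X - M * Q) ^ 2} * M ^ 2) ≤
      Q ^ 2 * (4 * ∑ l, ∑ l', ρ l l') := by
    linarith
  exact le_of_mul_le_mul_left h4 (by positivity)

section SecondMoment

variable (G : Params n) {N : ℕ}

/-- The probability that independent Gaussian variables at the first `κ` levels lie below given
thresholds. -/
def tailProd (t : Fin n → ℝ) (κ : ℕ) : ℝ :=
  ∏ k : Fin n, if (k : ℕ) < κ then gaussianTail (t k) else 1

lemma tailProd_pos {t : Fin n → ℝ} (ht : ∀ k, 0 ≤ t k) (κ : ℕ) : 0 < tailProd t κ :=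
  Finset.prod_pos fun k _ => by
    split_ifs
    · exact gaussianTail_pos (ht k)
    · exact one_pos

/-- The event that the variables along `σ` lie below given thresholds at the first `κ` levels. -/
def Params.deepEvent (t : Fin n → ℝ) (κ : ℕ) (σ : Cube N) : Set (G.Index N → ℝ) :=
  {X | ∀ k : Fin n, (k : ℕ) < κ → X (G.idx k σ) ≤ -t k}

variable {G}

lemma measurableSet_deepEvent (t : Fin n → ℝ) (κ : ℕ) (σ : Cube N) :
    MeasurableSet (G.deepEvent t κ σ) := by
  have : G.deepEvent t κ σ = ⋂ k : Fin n, ⋂ _ : (k : ℕ) < κ,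
      (fun X : G.Index N → ℝ => X (G.idx k σ)) ⁻¹' Set.Iic (-t k) := by
    ext X; simp [Params.deepEvent]
  rw [this]
  exact MeasurableSet.iInter fun k => MeasurableSet.iInter fun _ =>
    (measurable_pi_apply _) measurableSet_Iic

open Classical in
/-- The indices of the variables which are relevant for `Params.deepEvent`. -/
def Params.path (G : Params n) (κ : ℕ) (σ : Cube N) : Finset (G.Index N) :=
  (Finset.univ.filter fun k : Fin n => (k : ℕ) < κ).image fun k => G.idx k σ

lemma mem_path {κ : ℕ} {σ : Cube N} {i : G.Index N} :
    i ∈ G.path κ σ ↔ (i.1 : ℕ) < κ ∧ i = G.idx i.1 σ := by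
  classical
  simp only [Params.path, Finset.mem_image, Finset.mem_filter, Finset.mem_univ, true_and]
  constructor
  · rintro ⟨k, hk, rfl⟩
    exact ⟨hk, rfl⟩
  · rintro ⟨h1, h2⟩
    exact ⟨i.1, h1, h2.symm⟩

lemma deepEvent_eq (t : Fin n → ℝ) (κ : ℕ) (σ : Cube N) :
    G.deepEvent t κ σ = {X | ∀ i ∈ G.path κ σ, X i ≤ -t i.1} := by
  classical
  ext X
  simp only [Params.deepEvent, Params.path, Set.mem_ofPred_eq, Finset.forall_mem_image,
    Finset.mem_filter, Finset.mem_univ, true_and]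
  rfl

lemma prod_path (t : Fin n → ℝ) (κ : ℕ) (σ : Cube N) :
    ∏ i ∈ G.path κ σ, gaussianTail (t i.1) = tailProd t κ := by
  classical
  rw [Params.path, Finset.prod_image, Finset.prod_filter]
  · rfl
  · intro k _ k' _ h
    exact congrArg Sigma.fst h

lemma measureReal_deepEvent (t : Fin n → ℝ) (κ : ℕ) (σ : Cube N) :
    (stdGaussianPi (G.Index N)).real (G.deepEvent t κ σ) = tailProd t κ := by
  rw [deepEvent_eq, measureReal_forall_le (t := fun i : G.Index N => t i.1), prod_path]

-- Two paths share precisely the levels up to the last k at which their prefixes agree. Shared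
-- variables are counted once, which multiplies the independent value by the inverse of `tailProd t
-- (k + 1)`. The sum over all common levels majorizes this term and is easy to average over σ and τ.
open Classical in
lemma measureReal_deepEvent_inter_le {t : Fin n → ℝ} (ht : ∀ k, 0 ≤ t k) (κ : ℕ) (σ τ : Cube N) :
    (stdGaussianPi (G.Index N)).real (G.deepEvent t κ σ ∩ G.deepEvent t κ τ) ≤
      tailProd t κ ^ 2 * (1 + ∑ k : Fin n, if (k : ℕ) < κ ∧ G.idx k σ = G.idx k τ then
        (tailProd t (k + 1))⁻¹ else 0) := by
  have h1 : G.deepEvent t κ σ ∩ G.deepEvent t κ τ =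
      {X | ∀ i ∈ G.path κ σ ∪ G.path κ τ, X i ≤ -t i.1} := by
    rw [deepEvent_eq, deepEvent_eq]
    ext X
    simp only [Set.mem_inter_iff, Set.mem_ofPred_eq, Finset.forall_mem_union]
  rw [h1, measureReal_forall_le (t := fun i : G.Index N => t i.1)]
  have h2 := Finset.prod_union_inter (s₁ := G.path κ σ) (s₂ := G.path κ τ)
    (f := fun i => gaussianTail (t i.1))
  rw [prod_path, prod_path, ← sq] at h2
  have hterm : ∀ k : Fin n, 0 ≤ (if (k : ℕ) < κ ∧ G.idx k σ = G.idx k τ then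
      (tailProd t (k + 1))⁻¹ else 0) := fun k => by
    have := tailProd_pos ht (k + 1)
    split_ifs <;> positivity
  have hsq : 0 ≤ tailProd t κ ^ 2 := sq_nonneg _
  rcases (Finset.univ.filter fun k : Fin n => (k : ℕ) < κ ∧ G.idx k σ = G.idx k τ
    ).eq_empty_or_nonempty with h | h
  · have h3 : G.path κ σ ∩ G.path κ τ = ∅ := by
      rw [Finset.eq_empty_iff_forall_notMem]
      intro i hi
      rw [Finset.mem_inter, mem_path, mem_path] at hi
      refine Finset.eq_empty_iff_forall_notMem.1 h i.1 ?_
      simp only [Finset.mem_filter, Finset.mem_univ, true_and]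
      exact ⟨hi.1.1, hi.1.2.symm.trans hi.2.2⟩
    rw [h3, Finset.prod_empty, mul_one] at h2
    rw [h2]
    have := mul_nonneg hsq (Finset.sum_nonneg fun k (_ : k ∈ Finset.univ) => hterm k)
    linarith
  · obtain ⟨k, hk, hmax⟩ := Finset.exists_max_image _ id h
    simp only [Finset.mem_filter, Finset.mem_univ, true_and, id] at hk hmax
    have h3 : G.path κ σ ∩ G.path κ τ = G.path (k + 1) σ := by
      ext i
      rw [Finset.mem_inter, mem_path, mem_path, mem_path]
      constructor
      · rintro ⟨⟨h4, h5⟩, -, h6⟩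
        have : i.1 ≤ k := hmax i.1 ⟨h4, h5.symm.trans h6⟩
        exact ⟨Nat.lt_succ_of_le this, h5⟩
      · rintro ⟨h4, h5⟩
        have hlt : (i.1 : ℕ) < κ := by have := hk.1; omega
        refine ⟨⟨hlt, h5⟩, hlt, h5.trans ?_⟩
        rw [G.idx_eq_iff]
        intro j hj
        refine (G.idx_eq_iff k σ τ).1 hk.2 j (hj.trans_le (G.cut_mono N ?_))
        rw [Fin.le_def, Fin.val_succ, Fin.val_succ]
        omega
    have hpos := tailProd_pos ht (k + 1)
    rw [h3, prod_path] at h2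
    have h4 : ∏ i ∈ G.path κ σ ∪ G.path κ τ, gaussianTail (t i.1) =
        tailProd t κ ^ 2 * (tailProd t (k + 1))⁻¹ := by
      rw [← h2]; field_simp
    rw [h4]
    refine mul_le_mul_of_nonneg_left ?_ hsq
    have h5 := Finset.single_le_sum (fun k _ => hterm k) (Finset.mem_univ k)
    rw [if_pos hk] at h5
    linarith

open Classical in
lemma sum_idx_eq (k : Fin n) (σ : Cube N) :
    ∑ τ : Cube N, (if G.idx k σ = G.idx k τ then (1 : ℝ) else 0) =
      2 ^ N * (1 / 2) ^ G.cut N k.succ := by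
  have h1 : ∀ τ : Cube N, (if G.idx k σ = G.idx k τ then (1 : ℝ) else 0) =
      ∏ i : Fin N, if (i : ℕ) < G.cut N k.succ then (if σ i = τ i then 1 else 0) else 1 := by
    intro τ
    split_ifs with h
    · rw [G.idx_eq_iff] at h
      symm
      refine Finset.prod_eq_one fun i _ => ?_
      split_ifs with h1 h2
      · rfl
      · exact absurd (h i h1) h2
      · rfl
    · rw [G.idx_eq_iff] at h
      push Not at h
      obtain ⟨i, hi, hne⟩ := h
      symm
      exact Finset.prod_eq_zero (Finset.mem_univ i) (by simp [hi, hne])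
  simp only [h1]
  rw [sum_cube_prod (fun i s => if (i : ℕ) < G.cut N k.succ then (if σ i = s then 1 else 0) else 1)]
  have h2 : ∀ i : Fin N, ((if (i : ℕ) < G.cut N k.succ then (if σ i = 1 then (1 : ℝ) else 0) else 1) +
      (if (i : ℕ) < G.cut N k.succ then (if σ i = -1 then (1 : ℝ) else 0) else 1)) =
      if (i : ℕ) < G.cut N k.succ then 1 else 2 := by
    intro i
    have hne : (1 : ℤˣ) ≠ -1 := by decide
    split_ifs <;> rcases units_int_cases (σ i) with h | h <;> simp_all <;> norm_num
  simp only [h2]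
  rw [prod_ite_lt (G.cut_le N k.succ), one_pow, one_mul, pow_sub₀ _ two_ne_zero (G.cut_le N k.succ),
    one_div, inv_pow]

/-- Each summand is the inverse of the expected number of prefixes surviving through level k, so the
bound is useful once all of these expectations are large, not only the last. -/
lemma measureReal_count_deepEvent_le {t : Fin n → ℝ} (ht : ∀ k, 0 ≤ t k) (κ : ℕ) :
    (stdGaussianPi (G.Index N)).real
      {X | ∑ σ : Cube N, (G.deepEvent t κ σ).indicator (fun _ => (1 : ℝ)) X ≤
        2 ^ N * tailProd t κ / 2} ≤
      4 * ∑ k : Fin n, if (k : ℕ) < κ then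
        (1 / 2) ^ G.cut N k.succ * (tailProd t (k + 1))⁻¹ else 0 := by
  classical
  have hcard : (Fintype.card (Cube N) : ℝ) = 2 ^ N := by simp
  have h := measureReal_count_le (stdGaussianPi (G.Index N)) (G.deepEvent t κ)
    (measurableSet_deepEvent t κ) (tailProd_pos ht κ) (measureReal_deepEvent t κ) _
    (measureReal_deepEvent_inter_le ht κ)
  rw [hcard] at h
  refine h.trans_eq ?_
  have hsum : ∀ σ : Cube N, ∑ τ : Cube N, ∑ k : Fin n,
      (if (k : ℕ) < κ ∧ G.idx k σ = G.idx k τ then (tailProd t (k + 1))⁻¹ else 0) =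
      2 ^ N * ∑ k : Fin n, if (k : ℕ) < κ then
        (1 / 2) ^ G.cut N k.succ * (tailProd t (k + 1))⁻¹ else 0 := by
    intro σ
    rw [Finset.sum_comm, Finset.mul_sum]
    refine Finset.sum_congr rfl fun k _ => ?_
    by_cases hk : (k : ℕ) < κ
    · simp only [hk, true_and, if_true]
      rw [← mul_assoc, ← sum_idx_eq k σ, Finset.sum_mul]
      exact Finset.sum_congr rfl fun τ _ => by split_ifs <;> simp
    · simp [hk]
  simp only [hsum, Finset.sum_const, Finset.card_univ, nsmul_eq_mul, hcard]
  field_simp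

lemma eventually_gaussianTail_ge {θ : ℝ} (hθ : 0 ≤ θ) (a : ℝ) {ε : ℝ} (hε : 0 < ε) (ha : 0 ≤ a) :
    ∀ᶠ N : ℕ in atTop, Real.exp (-(N * (θ ^ 2 * a / 2 + ε))) ≤ gaussianTail (θ * √(a * N)) := by
  filter_upwards [eventually_sqrt_le (1 / 2 - Real.log (√(2 * Real.pi))⁻¹) (θ * √a) hε] with N hN
  have hpi := Real.pi_pos
  refine le_trans ?_ (gaussianTail_ge (by positivity))
  rw [← Real.exp_log (show 0 < (√(2 * Real.pi))⁻¹ by positivity), ← Real.exp_add]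
  refine Real.exp_le_exp.2 ?_
  have e : (θ * √(a * N)) ^ 2 = θ ^ 2 * a * N := by
    rw [mul_pow, Real.sq_sqrt (by positivity)]; ring
  rw [Real.sqrt_mul ha] at e ⊢
  have : (θ * (√a * √(N : ℝ)) + 1) ^ 2 =
      θ ^ 2 * a * N + 2 * (θ * √a * √(N : ℝ)) + 1 := by
    rw [add_sq, e]; ring
  rw [this]
  linarith

lemma eventually_tailProd_ge {θ : Fin n → ℝ} (hθ : ∀ k, 0 ≤ θ k) {ε : ℝ} (hε : 0 < ε) :
    ∀ᶠ N : ℕ in atTop, ∀ κ : ℕ, Real.exp (-(N * (psum (fun k => θ k ^ 2 * G.a k / 2) κ + n * ε))) ≤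
      tailProd (fun k => θ k * √(G.a k * N)) κ := by
  have h := eventually_all.2 fun k : Fin n =>
    eventually_gaussianTail_ge (hθ k) (G.a k) hε (G.a_pos k).le
  filter_upwards [h] with N hN κ
  have h1 : -(N * (psum (fun k => θ k ^ 2 * G.a k / 2) κ + n * ε)) ≤
      ∑ k : Fin n, if (k : ℕ) < κ then -(N * (θ k ^ 2 * G.a k / 2 + ε)) else 0 := by
    have e : (n : ℝ) * ε = ∑ _k : Fin n, ε := by simp
    rw [psum, e, ← Finset.sum_add_distrib, Finset.mul_sum, ← Finset.sum_neg_distrib]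
    refine Finset.sum_le_sum fun k _ => ?_
    have : 0 ≤ (N : ℝ) * ε := by positivity
    split_ifs <;> linarith
  refine (Real.exp_le_exp.2 h1).trans ?_
  rw [Real.exp_sum, tailProd]
  refine Finset.prod_le_prod (fun k _ => (Real.exp_pos _).le) fun k _ => ?_
  split_ifs
  · exact hN k
  · simp

/-- If at all levels the expected number of surviving configurations grows exponentially, then with
overwhelming probability there are about as many configurations as expected. -/
theorem expSmall_count_deepEvent {θ : Fin n → ℝ} (hθ : ∀ k, 0 ≤ θ k) (κ : ℕ) {d : ℝ} (hd : 0 < d)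
    (hgrowth : ∀ k : Fin n, d ≤ psum (fun k => G.gap k * Real.log 2 - θ k ^ 2 * G.a k / 2) (k + 1)) :
    ExpSmall fun N => (stdGaussianPi (G.Index N)).real
      {X | ∑ σ : Cube N, (G.deepEvent (fun k => θ k * √(G.a k * N)) κ σ).indicator
        (fun _ => (1 : ℝ)) X ≤ 2 ^ N * tailProd (fun k => θ k * √(G.a k * N)) κ / 2} := by
  -- The tail estimates at n levels may use up at most half of the growth rate d.
  set ε := d / (2 * (n + 1)) with hεdef
  have hε : 0 < ε := by positivity
  have hnε : n * ε ≤ d / 2 := by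
    rw [hεdef]
    rw [mul_div_assoc', div_le_div_iff₀ (by positivity) (by positivity)]
    nlinarith
  refine ((expSmall_exp (c := d / 2) (by positivity)).const_mul (D := 4 * n)
    (by positivity)).mono ?_
  filter_upwards [eventually_tailProd_ge (G := G) hθ hε] with N hN
  have ht : ∀ k, 0 ≤ θ k * √(G.a k * N) := fun k => mul_nonneg (hθ k) (Real.sqrt_nonneg _)
  refine (measureReal_count_deepEvent_le ht κ).trans ?_
  rw [mul_assoc]
  refine mul_le_mul_of_nonneg_left ?_ (by norm_num)
  have hbound : ∀ k : Fin n, (if (k : ℕ) < κ then (1 / 2) ^ G.cut N k.succ *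
      (tailProd (fun k => θ k * √(G.a k * N)) (k + 1))⁻¹ else 0) ≤ Real.exp (-(d / 2 * N)) := by
    intro k
    split_ifs
    · have h1 : (1 / 2 : ℝ) ^ G.cut N k.succ ≤ Real.exp (-(N * (G.x k.succ * Real.log 2))) := by
        have hlog := Real.log_pos (by norm_num : (1 : ℝ) < 2)
        have e : (1 / 2 : ℝ) ^ G.cut N k.succ = Real.exp (-(G.cut N k.succ * Real.log 2)) := by
          rw [Real.exp_neg, Real.exp_nat_mul, Real.exp_log (by norm_num), one_div, inv_pow]
        rw [e]
        refine Real.exp_le_exp.2 ?_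
        nlinarith [mul_le_mul_of_nonneg_right (G.le_cut N k.succ) hlog.le]
      have h2 := inv_anti₀ (Real.exp_pos _) (hN (k + 1))
      rw [← Real.exp_neg, neg_neg] at h2
      calc _ ≤ Real.exp (-(N * (G.x k.succ * Real.log 2))) *
            Real.exp (N * (psum (fun k => θ k ^ 2 * G.a k / 2) (k + 1) + n * ε)) := by
            have := (tailProd_pos ht (k + 1)).le
            gcongr
        _ ≤ _ := by
          rw [← Real.exp_add]
          refine Real.exp_le_exp.2 ?_
          have h3 := hgrowth k
          have h4 : psum (fun k => G.gap k * Real.log 2) (k + 1) = G.x k.succ * Real.log 2 := by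
            have := G.psum_gap k.succ
            rw [Fin.val_succ] at this
            rw [← this, mul_comm, ← psum_const_mul]
            congr 1
            funext k
            ring
          rw [psum_sub, h4] at h3
          nlinarith [mul_le_mul_of_nonneg_left h3 (Nat.cast_nonneg (α := ℝ) N),
            mul_le_mul_of_nonneg_left hnε (Nat.cast_nonneg (α := ℝ) N)]
    · exact (Real.exp_pos _).le
  refine (Finset.sum_le_sum fun k _ => hbound k).trans_eq ?_
  simp

end SecondMoment

/-! ### The lower bound -/

section Lower

variable (G : Params n) {N : ℕ}

/-- The coefficients of the levels `k ≥ κ` in the potential. -/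
def Params.restWeight (N κ : ℕ) (k : Fin n) : ℝ :=
  if (k : ℕ) < κ then 0 else √(N : ℝ) * √(G.a k)

/-- The coefficients of the average of the levels `k ≥ κ` of the potential over the configurations
which agree with `η` in the first `κ` blocks. -/
def Params.averageWeight (κ : Fin (n + 1)) (η : Cube N) (i : G.Index N) : ℝ :=
  ∑ σ, tailWeight (G.cut N κ) η σ * G.levelWeight (G.restWeight N κ) σ i

variable {G}

lemma sum_averageWeight_mul (κ : Fin (n + 1)) (η : Cube N) (X : G.Index N → ℝ) :
    ∑ i, G.averageWeight κ η i * X i =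
      ∑ σ, tailWeight (G.cut N κ) η σ * ∑ k, G.restWeight N κ k * X (G.idx k σ) := by
  simp only [Params.averageWeight, Finset.sum_mul]
  rw [Finset.sum_comm]
  refine Finset.sum_congr rfl fun σ _ => ?_
  rw [← sum_levelWeight_mul, Finset.mul_sum]
  exact Finset.sum_congr rfl fun i _ => by ring

lemma tailWeight_eq_zero {c : ℕ} {η σ : Cube N} {i : Fin N} (hi : (i : ℕ) < c) (h : σ i ≠ η i) :
    tailWeight c η σ = 0 :=
  Finset.prod_eq_zero (Finset.mem_univ i) (by simp [hi, h])

/-- Averages of functions of the first `c` spins. -/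
lemma sum_tailWeight_mul {c : ℕ} {F : Cube N → ℝ}
    (hF : ∀ σ η : Cube N, (∀ i : Fin N, (i : ℕ) < c → σ i = η i) → F σ = F η) (η : Cube N) :
    ∑ σ, tailWeight c η σ * F σ = F η := by
  have : ∀ σ, tailWeight c η σ * F σ = tailWeight c η σ * F η := by
    intro σ
    by_cases h : ∀ i : Fin N, (i : ℕ) < c → σ i = η i
    · rw [hF σ η h]
    · push Not at h
      obtain ⟨i, hi, hne⟩ := h
      rw [tailWeight_eq_zero hi hne, zero_mul, zero_mul]
  simp only [this]
  rw [← Finset.sum_mul, sum_tailWeight, one_mul]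

lemma sum_tailWeight_exp {c : ℕ} (hc : c ≤ N) (t : ℝ) (σ : Cube N) :
    ∑ η, tailWeight c η σ * Real.exp (∑ j, tailField c t j * ((η j : ℤ) : ℝ)) =
      Real.cosh t ^ (N - c) := by
  simp only [tailWeight, Real.exp_sum, ← Finset.prod_mul_distrib]
  rw [sum_cube_prod (fun i s => (if (i : ℕ) < c then (if σ i = s then 1 else 0) else 1 / 2) *
    Real.exp (tailField c t i * ((s : ℤ) : ℝ)))]
  have h : ∀ i : Fin N, (if (i : ℕ) < c then (if σ i = 1 then (1 : ℝ) else 0) else 1 / 2) *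
      Real.exp (tailField c t i * (((1 : ℤˣ) : ℤ) : ℝ)) +
      (if (i : ℕ) < c then (if σ i = -1 then (1 : ℝ) else 0) else 1 / 2) *
      Real.exp (tailField c t i * (((-1 : ℤˣ) : ℤ) : ℝ)) =
      if (i : ℕ) < c then 1 else Real.cosh t := by
    intro i
    have hne : (1 : ℤˣ) ≠ -1 := by decide
    by_cases hi : (i : ℕ) < c
    · rcases units_int_cases (σ i) with h | h <;>
        simp [hi, hi.not_ge, tailField, h, hne, hne.symm]
    · simp [hi, not_lt.1 hi, tailField, Real.cosh_eq]; ring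
  simp only [h]
  rw [prod_ite_lt hc, one_pow, one_mul]

/-- `F` sees only the first c spins, and conditionally on these each remaining site averages to cosh
t. The sum of `F` runs over full configurations, hence cosh t and not 2 cosh t. -/
lemma sum_mul_exp_tailField {c : ℕ} (hc : c ≤ N) (t : ℝ) {F : Cube N → ℝ}
    (hF : ∀ σ η : Cube N, (∀ i : Fin N, (i : ℕ) < c → σ i = η i) → F σ = F η) :
    ∑ η, F η * Real.exp (∑ j, tailField c t j * ((η j : ℤ) : ℝ)) =
      (∑ σ, F σ) * Real.cosh t ^ (N - c) := by
  have h : ∀ η, F η * Real.exp (∑ j, tailField c t j * ((η j : ℤ) : ℝ)) =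
      ∑ σ, F σ * (tailWeight c η σ * Real.exp (∑ j, tailField c t j * ((η j : ℤ) : ℝ))) := by
    intro η
    conv_lhs => rw [← sum_tailWeight_mul hF η, Finset.sum_mul]
    exact Finset.sum_congr rfl fun σ _ => by ring
  simp only [h]
  rw [Finset.sum_comm, Finset.sum_mul]
  refine Finset.sum_congr rfl fun σ _ => ?_
  rw [← Finset.mul_sum, sum_tailWeight_exp hc]

-- The spins from c up to the cut are fair coins under `tailWeight` and must all match σ. It is an
-- inequality because the fixed spins of η may already disagree with σ.
open Classical in
lemma sum_tailWeight_idx_le {c : ℕ} {k : Fin n} (hc : c ≤ G.cut N k.succ) (η σ : Cube N) :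
    ∑ τ, tailWeight c η τ * (if G.idx k σ = G.idx k τ then (1 : ℝ) else 0) ≤
      (1 / 2) ^ (G.cut N k.succ - c) := by
  set c' := G.cut N k.succ with hc'
  have hN : c' ≤ N := G.cut_le N _
  have h1 : ∀ τ, tailWeight c η τ * (if G.idx k σ = G.idx k τ then (1 : ℝ) else 0) ≤
      ∏ i : Fin N, (if (i : ℕ) < c then (if τ i = η i then 1 else 0) else
        if (i : ℕ) < c' then (if σ i = τ i then 1 / 2 else 0) else 1 / 2) := by
    intro τ
    split_ifs with h
    · rw [G.idx_eq_iff] at h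
      rw [mul_one, tailWeight]
      refine le_of_eq (Finset.prod_congr rfl fun i _ => ?_)
      by_cases h1 : (i : ℕ) < c
      · simp [h1]
      · by_cases h2 : (i : ℕ) < c'
        · simp [h1, h2, h i h2]
        · simp [h1, h2]
    · rw [mul_zero]
      exact Finset.prod_nonneg fun i _ => by split_ifs <;> norm_num
  refine (Finset.sum_le_sum fun τ _ => h1 τ).trans ?_
  rw [sum_cube_prod (fun i s => if (i : ℕ) < c then (if s = η i then 1 else 0) else
        if (i : ℕ) < c' then (if σ i = s then 1 / 2 else 0) else 1 / 2)]
  have hne : (1 : ℤˣ) ≠ -1 := by decide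
  have h2 : ∀ i : Fin N, ((if (i : ℕ) < c then (if 1 = η i then (1 : ℝ) else 0) else
        if (i : ℕ) < c' then (if σ i = 1 then 1 / 2 else 0) else 1 / 2) +
      (if (i : ℕ) < c then (if -1 = η i then (1 : ℝ) else 0) else
        if (i : ℕ) < c' then (if σ i = -1 then 1 / 2 else 0) else 1 / 2)) =
      (if (i : ℕ) < c' then 1 / 2 else 1) * (if (i : ℕ) < c then 2 else 1) := by
    intro i
    by_cases h1 : (i : ℕ) < c
    · have : (i : ℕ) < c' := h1.trans_le hc
      rcases units_int_cases (η i) with h | h <;> simp [h1, this, h, hne, hne.symm]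
    · by_cases h2 : (i : ℕ) < c'
      · rcases units_int_cases (σ i) with h | h <;> simp [h1, h2, h, hne, hne.symm]
      · simp [h1, h2]; norm_num
  simp only [h2]
  rw [Finset.prod_mul_distrib, prod_ite_lt hN, prod_ite_lt (hc.trans hN), one_pow, one_pow, mul_one,
    mul_one, pow_sub₀ _ (by norm_num) hc]
  refine le_of_eq ?_
  congr 1
  rw [← inv_pow]
  norm_num

/-- This is the variance of the averaged later levels. The average at level k spreads uniformly over
2^(cut(k+1) - cut(κ)) independent variables, which divides the variance by this number. -/
lemma sum_averageWeight_sq_le (κ : Fin (n + 1)) (η : Cube N) :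
    ∑ i, G.averageWeight κ η i ^ 2 ≤
      ∑ k : Fin n, if (k : ℕ) < κ then 0 else
        N * (1 / 2 : ℝ) ^ (G.cut N k.succ - G.cut N κ) := by
  classical
  have h1 : ∀ (σ : Cube N), ∑ k, G.restWeight N κ k * G.averageWeight κ η (G.idx k σ) ≤
      ∑ k : Fin n, if (k : ℕ) < κ then 0 else
        N * (1 / 2 : ℝ) ^ (G.cut N k.succ - G.cut N κ) := by
    intro σ
    refine Finset.sum_le_sum fun k _ => ?_
    by_cases hk : (k : ℕ) < κ
    · simp [Params.restWeight, hk]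
    · have hcut : G.cut N κ ≤ G.cut N k.succ := G.cut_mono N (by
        rw [Fin.le_def, Fin.val_succ]; omega)
      have h2 : G.averageWeight κ η (G.idx k σ) = G.restWeight N κ k *
          ∑ τ, tailWeight (G.cut N κ) η τ * (if G.idx k σ = G.idx k τ then (1 : ℝ) else 0) := by
        rw [Params.averageWeight, Finset.mul_sum]
        refine Finset.sum_congr rfl fun τ _ => ?_
        have h3 : G.levelWeight (G.restWeight N κ) τ (G.idx k σ) =
            if G.idx k σ = G.idx k τ then G.restWeight N κ k else 0 := rfl
        rw [h3]
        split_ifs <;> ring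
      rw [h2, ← mul_assoc, if_neg hk]
      have h4 : G.restWeight N κ k * G.restWeight N κ k ≤ N := by
        rw [Params.restWeight, if_neg hk, mul_mul_mul_comm,
          Real.mul_self_sqrt (Nat.cast_nonneg _), Real.mul_self_sqrt (G.a_pos k).le]
        exact mul_le_of_le_one_right (Nat.cast_nonneg _) (G.a_le_one k)
      refine mul_le_mul h4 (sum_tailWeight_idx_le hcut η σ) ?_ (Nat.cast_nonneg _)
      exact Finset.sum_nonneg fun τ _ => mul_nonneg (tailWeight_nonneg _ _ _)
        (by split_ifs <;> norm_num)
  -- Evaluating the averaged functional at its own coefficient vector turns the sum of squares into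
  -- an average over σ, which `h1` bounds pointwise.
  have h5 := sum_averageWeight_mul κ η (G.averageWeight κ η)
  simp only [sq]
  rw [h5]
  refine (Finset.sum_le_sum fun σ _ =>
    mul_le_mul_of_nonneg_left (h1 σ) (tailWeight_nonneg _ _ _)).trans ?_
  rw [← Finset.sum_mul, sum_tailWeight, one_mul]

lemma eventually_averageVariance_le (κ : Fin (n + 1)) :
    ∀ᶠ N : ℕ in atTop, (∑ k : Fin n, if (k : ℕ) < κ then 0 else
        N * (1 / 2 : ℝ) ^ (G.cut N k.succ - G.cut N κ)) ≤ n := by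
  have hlog := Real.log_pos (by norm_num : (1 : ℝ) < 2)
  have h := eventually_all.2 fun k : Fin n =>
    eventually_sqrt_le (Real.log 2) 2 (mul_pos (G.gap_pos k) hlog)
  filter_upwards [h, eventually_gt_atTop 0] with N hN hN0
  have hNpos : (0 : ℝ) < N := by exact_mod_cast hN0
  have hb : ∀ k : Fin n, (if (k : ℕ) < κ then 0 else
        N * (1 / 2 : ℝ) ^ (G.cut N k.succ - G.cut N κ)) ≤ 1 := by
    intro k
    split_ifs with hk
    · exact zero_le_one
    · have hcut : G.cut N κ ≤ G.cut N k.succ := G.cut_mono N (by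
        rw [Fin.le_def, Fin.val_succ]; omega)
      have hx : G.x κ ≤ G.x k.castSucc := G.x_strictMono.monotone (by
        rw [Fin.le_def, Fin.val_castSucc]; omega)
      have e1 : (1 / 2 : ℝ) ^ (G.cut N k.succ - G.cut N κ) =
          Real.exp (-((G.cut N k.succ - G.cut N κ) * Real.log 2)) := by
        rw [Real.exp_neg, ← Nat.cast_sub hcut, Real.exp_nat_mul, Real.exp_log (by norm_num),
          one_div, inv_pow]
      -- Writing the factor N as exp(2√N) at most lets `eventually_sqrt_le` compare it with the
      -- exponential decay.
      have e2 : (N : ℝ) ≤ Real.exp (2 * √(N : ℝ)) := by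
        have h1 := Real.add_one_le_exp (√(N : ℝ))
        have h2 : Real.exp (2 * √(N : ℝ)) = Real.exp (√(N : ℝ)) * Real.exp (√(N : ℝ)) := by
          rw [← Real.exp_add]; ring_nf
        have h3 := Real.mul_self_sqrt hNpos.le
        have h4 := Real.sqrt_nonneg (N : ℝ)
        rw [h2]
        nlinarith
      have e3 : (N : ℝ) * G.gap k - 1 ≤ G.cut N k.succ - G.cut N κ := by
        have h1 := G.le_cut N k.succ
        have h2 := (G.cut_lt N κ).le
        have h3 := mul_le_mul_of_nonneg_right hx hNpos.le
        unfold Params.gap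
        linarith
      calc _ ≤ Real.exp (2 * √(N : ℝ)) *
            Real.exp (-((G.cut N k.succ - G.cut N κ) * Real.log 2)) := by rw [e1]; gcongr
        _ ≤ 1 := by
          rw [← Real.exp_add, Real.exp_le_one_iff]
          have := hN k
          nlinarith [mul_le_mul_of_nonneg_right e3 hlog.le]
  refine (Finset.sum_le_sum fun k _ => hb k).trans_eq ?_
  simp

lemma expSmall_average_ge (κ : Fin (n + 1)) {ε : ℝ} (hε : 0 < ε) :
    ExpSmall fun N => (stdGaussianPi (G.Index N)).real
      {X | ∃ η : Cube N, N * ε ≤ ∑ i, G.averageWeight κ η i * X i} := by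
  -- Scaling by 2/ε moves the threshold to 2N, enough to beat the 2^N choices of η with exp(-N) to
  -- spare; the scaled variance stays bounded.
  set l := 2 / ε with hl
  have hlpos : 0 < l := by positivity
  refine ((expSmall_exp one_pos).const_mul (D := Real.exp (l ^ 2 * n / 2))
    (Real.exp_pos _).le).mono ?_
  filter_upwards [eventually_averageVariance_le (G := G) κ] with N hN
  have h1 := measureReal_exists_linear_ge_le (Finset.univ : Finset (Cube N))
    (fun η i => l * G.averageWeight κ η i) (N * 2) (l ^ 2 * n) (fun η _ => by
      simp only [mul_pow]
      rw [← Finset.mul_sum]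
      exact mul_le_mul_of_nonneg_left ((sum_averageWeight_sq_le κ η).trans hN) (sq_nonneg _))
  refine (measureReal_mono ?_).trans (h1.trans ?_)
  · rintro X ⟨η, hη⟩
    refine ⟨η, Finset.mem_univ _, ?_⟩
    simp only [mul_assoc]
    rw [← Finset.mul_sum]
    have := mul_le_mul_of_nonneg_left hη hlpos.le
    refine le_trans (le_of_eq ?_) this
    rw [hl]; field_simp
  · have hcard : ((Finset.univ : Finset (Cube N)).card : ℝ) = Real.exp (N * Real.log 2) := by
      rw [Real.exp_nat_mul, Real.exp_log (by norm_num)]; simp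
    rw [hcard, ← Real.exp_add, ← Real.exp_add]
    refine Real.exp_le_exp.2 ?_
    have : Real.log 2 ≤ 1 := by linarith [Real.log_two_lt_d9]
    nlinarith [mul_le_mul_of_nonneg_left this (Nat.cast_nonneg (α := ℝ) N)]

lemma average_potential (X : G.Index N → ℝ) (κ : Fin (n + 1)) (β : ℝ) (η : Cube N) :
    ∑ σ, tailWeight (G.cut N κ) η σ * (-β * G.potential N X σ) =
      -β * G.truncated X κ η - β * ∑ i, G.averageWeight κ η i * X i := by
  have h1 : ∀ σ, -β * G.potential N X σ = -β * G.truncated X κ σ -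
      β * ∑ k, G.restWeight N κ k * X (G.idx k σ) := by
    intro σ
    have : G.truncated X n σ = G.truncated X κ σ +
        ∑ k, G.restWeight N κ k * X (G.idx k σ) := by
      rw [Params.truncated, Params.truncated, psum_all, psum, Finset.mul_sum, Finset.mul_sum,
        ← Finset.sum_add_distrib]
      refine Finset.sum_congr rfl fun k _ => ?_
      unfold Params.restWeight
      split_ifs <;> ring
    rw [G.potential_eq, this]
    ring
  simp only [h1, mul_sub, Finset.sum_sub_distrib]
  rw [sum_tailWeight_mul (F := fun σ => -β * G.truncated X κ σ)
    (fun σ τ h => by rw [G.truncated_congr X κ h]), sum_averageWeight_mul, Finset.mul_sum]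
  congr 1
  exact Finset.sum_congr rfl fun σ _ => by ring

lemma deepEvent_indicator_congr (t : Fin n → ℝ) (κ : Fin (n + 1)) (X : G.Index N → ℝ)
    {σ η : Cube N} (h : ∀ i : Fin N, (i : ℕ) < G.cut N κ → σ i = η i) :
    (G.deepEvent t κ σ).indicator (fun _ => (1 : ℝ)) X =
      (G.deepEvent t κ η).indicator (fun _ => (1 : ℝ)) X := by
  have : G.deepEvent t κ σ = G.deepEvent t κ η := by
    ext X
    simp only [Params.deepEvent, Set.mem_ofPred_eq]
    refine forall_congr' fun k => imp_congr_right fun hk => ?_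
    have : G.idx k σ = G.idx k η := by
      rw [G.idx_eq_iff]
      intro i hi
      refine h i (hi.trans_le (G.cut_mono N ?_))
      rw [Fin.le_def, Fin.val_succ]
      omega
    rw [this]
  rw [this]

lemma neg_truncated_ge_of_mem_deepEvent {θ : Fin n → ℝ} {κ : ℕ} {η : Cube N} {X : G.Index N → ℝ}
    (hX : X ∈ G.deepEvent (fun k => θ k * √(G.a k * N)) κ η) :
    N * psum (fun k => θ k * G.a k) κ ≤ -G.truncated X κ η := by
  rw [Params.truncated, ← psum_const_mul, ← neg_one_mul, ← psum_const_mul, ← psum_const_mul]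
  refine Finset.sum_le_sum fun k _ => ?_
  split_ifs with hk
  · have h1 : X (G.idx k η) ≤ -(θ k * √(G.a k * N)) := hX k hk
    have h2 := mul_le_mul_of_nonneg_left h1
      (mul_nonneg (Real.sqrt_nonneg (N : ℝ)) (Real.sqrt_nonneg (G.a k)))
    have h3 := Real.mul_self_sqrt (Nat.cast_nonneg (α := ℝ) N)
    have h4 := Real.mul_self_sqrt (G.a_pos k).le
    rw [Real.sqrt_mul (G.a_pos k).le] at h2
    have e : √(N : ℝ) * √(G.a k) * -(θ k * (√(G.a k) * √(N : ℝ))) = -(N * (θ k * G.a k)) := by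
      calc _ = -((√(N : ℝ) * √(N : ℝ)) * (θ k * (√(G.a k) * √(G.a k)))) := by ring
        _ = _ := by rw [h3, h4]
    linarith
  · exact le_rfl

/-- Rounding up the cut removes at most one site from the paramagnetic part, which explains the
subtracted constant. -/
lemma pow_mul_cosh_pow_ge (κ : Fin (n + 1)) (t : ℝ) :
    Real.exp (N * (G.x κ * Real.log 2 + (1 - G.x κ) * Real.log (2 * Real.cosh t)) -
        Real.log (2 * Real.cosh t)) ≤ (2 : ℝ) ^ N * Real.cosh t ^ (N - G.cut N κ) := by
  have e : (2 : ℝ) ^ N * Real.cosh t ^ (N - G.cut N κ) =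
      2 ^ G.cut N κ * (2 * Real.cosh t) ^ (N - G.cut N κ) := by
    rw [mul_pow, ← mul_assoc, ← pow_add, Nat.add_sub_cancel' (G.cut_le N κ)]
  rw [e, pow_mul_cosh_pow_eq (G.cut_le N κ)]
  refine Real.exp_le_exp.2 ?_
  have hlog := Real.log_pos (by norm_num : (1 : ℝ) < 2)
  have hp := log_two_le_log_two_cosh t
  nlinarith [mul_le_mul_of_nonneg_right (G.cut_lt N κ).le (sub_nonneg.2 hp)]

/-- With overwhelming probability the pressure is not much smaller than the value attained along
deep energies at the first levels and by the paramagnet at the remaining ones. -/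
theorem expSmall_pressure_le {θ : Fin n → ℝ} (hθ : ∀ k, 0 ≤ θ k) (κ : Fin (n + 1)) {d : ℝ}
    (hd : 0 < d)
    (hgrowth : ∀ k : Fin n, d ≤ psum (fun k => G.gap k * Real.log 2 - θ k ^ 2 * G.a k / 2) (k + 1))
    {β : ℝ} (hβ : 0 ≤ β) (Γ : ℝ) {ε₀ : ℝ} (hε₀ : 0 < ε₀) :
    ExpSmall fun N => (stdGaussianPi (G.Index N)).real
      {X | pressure β (G.potential N X) (fun _ => Γ) ≤
        psum (fun k => G.gap k * Real.log 2 - θ k ^ 2 * G.a k / 2 + β * θ k * G.a k) κ +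
          (1 - G.x κ) * Real.log (2 * Real.cosh (β * Γ)) - ε₀} := by
  set p := Real.log (2 * Real.cosh (β * Γ)) with hp
  -- β counts the loss from the averaged later levels and n the loss from the Gaussian tails; the 1
  -- is slack that keeps D positive.
  set D := β + n + 1
  have hDpos : 0 < D := by positivity
  set ε := ε₀ / (2 * D) with hεdef
  have hε : 0 < ε := by positivity
  have hDε : D * ε = ε₀ / 2 := by rw [hεdef]; field_simp
  refine ((expSmall_average_ge (G := G) κ hε).add
    (expSmall_count_deepEvent (G := G) hθ κ hd hgrowth)).mono ?_
  filter_upwards [eventually_gt_atTop 0, eventually_tailProd_ge (G := G) hθ hε,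
    eventually_sqrt_le (p + Real.log 2) 0 (show 0 < ε₀ / 4 by positivity)] with N hN htail hlarge
  have hNpos : (0 : ℝ) < N := by exact_mod_cast hN
  refine (measureReal_mono ?_).trans (measureReal_union_le _ _)
  intro X hX
  by_contra hcon
  simp only [Set.mem_union, Set.mem_ofPred_eq, not_or, not_exists, not_le] at hcon hX
  obtain ⟨hA, hB⟩ := hcon
  set t : Fin n → ℝ := fun k => θ k * √(G.a k * N) with ht
  set c := G.cut N κ with hc
  set Z := ∑ σ : Cube N, (G.deepEvent t κ σ).indicator (fun _ => (1 : ℝ)) X with hZ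
  have ht0 : ∀ k, 0 ≤ t k := fun k => mul_nonneg (hθ k) (Real.sqrt_nonneg _)
  have hpeierls := sum_exp_average_le_trace_exp c (β * Γ) (fun σ => -β * G.potential N X σ)
  -- In the Peierls–Bogoliubov sum only the η in the deep event are kept; there the truncated energy
  -- is at least its threshold, and the averaged rest is below Nε.
  have hlower : Real.exp (N * (β * psum (fun k => θ k * G.a k) κ - β * ε)) *
      (Z * Real.cosh (β * Γ) ^ (N - c)) ≤ Matrix.trace (NormedSpace.exp
        (Matrix.diagonal (fun σ => -β * G.potential N X σ) +
          transversalField (fun _ => β * Γ))) := by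
    refine le_trans ?_ hpeierls
    rw [hZ, ← sum_mul_exp_tailField (G.cut_le N κ) (β * Γ)
      (fun σ η h => deepEvent_indicator_congr t κ X h), Finset.mul_sum]
    refine Finset.sum_le_sum fun η _ => ?_
    by_cases hη : X ∈ G.deepEvent t κ η
    · rw [Set.indicator_of_mem hη, one_mul, ← Real.exp_add, average_potential]
      refine Real.exp_le_exp.2 ?_
      have h1 := mul_le_mul_of_nonneg_left (neg_truncated_ge_of_mem_deepEvent hη) hβ
      have h2 := mul_le_mul_of_nonneg_left (hA η).le hβ
      linarith
    · rw [Set.indicator_of_notMem hη, zero_mul, mul_zero]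
      exact (Real.exp_pos _).le
  have hbound : Real.exp (N * (β * psum (fun k => θ k * G.a k) κ - β * ε)) *
      (Real.exp (-(N * (psum (fun k => θ k ^ 2 * G.a k / 2) κ + n * ε)) - Real.log 2) *
      Real.exp (N * (G.x κ * Real.log 2 + (1 - G.x κ) * p) - p)) ≤
      Matrix.trace (NormedSpace.exp (Matrix.diagonal (fun σ => -β * G.potential N X σ) +
          transversalField (fun _ => β * Γ))) := by
    refine le_trans ?_ hlower
    refine mul_le_mul_of_nonneg_left ?_ (Real.exp_pos _).le
    have hcosh : 0 < Real.cosh (β * Γ) := Real.cosh_pos _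
    calc _ ≤ tailProd t κ / 2 * (2 ^ N * Real.cosh (β * Γ) ^ (N - c)) := by
          refine mul_le_mul ?_ (pow_mul_cosh_pow_ge κ _) (Real.exp_pos _).le
            (half_pos (tailProd_pos ht0 κ)).le
          rw [Real.exp_sub, Real.exp_log (by norm_num)]
          have := htail κ
          gcongr
      _ = 2 ^ N * tailProd t κ / 2 * Real.cosh (β * Γ) ^ (N - c) := by ring
      _ ≤ _ := by gcongr
  rw [← Real.exp_add, ← Real.exp_add] at hbound
  have hlog := Real.log_le_log (Real.exp_pos _) hbound
  rw [Real.log_exp] at hlog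
  rw [pressure_eq, one_div, inv_mul_eq_div, div_le_iff₀ hNpos] at hX
  have h1 := hlog.trans hX
  have h2 : psum (fun k => G.gap k * Real.log 2 - θ k ^ 2 * G.a k / 2 + β * θ k * G.a k) κ =
      G.x κ * Real.log 2 - psum (fun k => θ k ^ 2 * G.a k / 2) κ +
        β * psum (fun k => θ k * G.a k) κ := by
    rw [psum_add, psum_sub, ← G.psum_gap κ, mul_comm (psum _ _) (Real.log 2), ← psum_const_mul,
      ← psum_const_mul]
    congr 2
    · congr 1
      funext k
      ring
    · funext k
      ring
  rw [h2] at h1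
  nlinarith [mul_pos hNpos hε₀, congrArg (fun z : ℝ => (N : ℝ) * z) hDε, mul_pos hNpos hε]

/-- With overwhelming probability the pressure is not much smaller than its limit. -/
theorem expSmall_pressure_le_variational {m : ℕ} {y : Fin (m + 1) → ℝ}
    (hy : G.IsHullSubdivision y) {β : ℝ} (hβ : 0 ≤ β) (Γ : ℝ) {ε₀ : ℝ} (hε₀ : 0 < ε₀) :
    ExpSmall fun N => (stdGaussianPi (G.Index N)).real
      {X | pressure β (G.potential N X) (fun _ => Γ) ≤ G.variationalPressure y β Γ - ε₀} := by
  have hlog := Real.log_pos (by norm_num : (1 : ℝ) < 2)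
  obtain ⟨h, -, hone, -, ⟨κ, hκ⟩, hgrow⟩ := exists_optimal_profile hy hβ Γ
  -- Shrinking the depths by 1 - δ turns nonnegative partial entropies into strictly positive ones
  -- and lowers the pressure by at most δβ² ≤ ε₀/2. The ε₀ in the denominator covers β = 0.
  set δ := ε₀ / (2 * (β ^ 2 + ε₀)) with hδ
  have hδ0 : 0 < δ := by positivity
  have hδ1 : δ ≤ 1 / 2 := by
    rw [hδ, div_le_div_iff₀ (by positivity) (by norm_num)]
    nlinarith [sq_nonneg β]
  have hδβ : δ * β ^ 2 ≤ ε₀ / 2 := by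
    rw [hδ, div_mul_eq_mul_div, div_le_div_iff₀ (by positivity) (by norm_num)]
    nlinarith [sq_nonneg β]
  set θ : Fin n → ℝ := fun k => (1 - δ) * (β / h k) with hθ
  have hb0 : ∀ k, 0 ≤ β / h k := fun k => div_nonneg hβ (zero_le_one.trans (hone k))
  have hb1 : ∀ k, β / h k ≤ β := fun k => div_le_self hβ (hone k)
  have hθ0 : ∀ k, 0 ≤ θ k := fun k => mul_nonneg (by linarith) (hb0 k)
  obtain ⟨d, hd, hdx⟩ : ∃ d > 0, ∀ k : Fin n, d ≤ δ * (G.x k.succ * Real.log 2) := by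
    have h1 : ∀ k : Fin n, 0 < δ * (G.x k.succ * Real.log 2) := fun k => by
      have : 0 < G.x k.succ := G.x_zero ▸ G.x_strictMono (Fin.succ_pos k)
      positivity
    have h2 : ∀ᶠ d in 𝓝[>] (0 : ℝ), 0 < d ∧ ∀ k : Fin n, d ≤ δ * (G.x k.succ * Real.log 2) :=
      eventually_mem_nhdsWithin.and (eventually_all.2 fun k =>
        nhdsWithin_le_nhds (Iic_mem_nhds (h1 k)))
    exact h2.exists
  have hgrowth : ∀ k : Fin n,
      d ≤ psum (fun k => G.gap k * Real.log 2 - θ k ^ 2 * G.a k / 2) (k + 1) := by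
    intro k
    refine (hdx k).trans ?_
    have h1 := hgrow (k + 1) (by omega)
    have h2 := G.psum_gap k.succ
    rw [Fin.val_succ] at h2
    -- Because (1 - δ)² ≤ 1 - δ, the new entropy dominates the convex combination of gap·log 2, with
    -- weight δ, and the old entropy.
    have h3 : psum (fun k => δ * (G.gap k * Real.log 2) + (1 - δ) *
        (G.gap k * Real.log 2 - (β / h k) ^ 2 * G.a k / 2)) (k + 1) ≤
        psum (fun k => G.gap k * Real.log 2 - θ k ^ 2 * G.a k / 2) (k + 1) := by
      refine psum_mono (fun k => ?_) _
      have h4 : 0 ≤ (β / h k) ^ 2 * G.a k / 2 := by have := (G.a_pos k).le; positivity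
      have h5 : θ k ^ 2 * G.a k / 2 = (1 - δ) ^ 2 * ((β / h k) ^ 2 * G.a k / 2) := by
        rw [hθ]; ring
      rw [h5]
      nlinarith [mul_nonneg (mul_nonneg hδ0.le (by linarith : 0 ≤ 1 - δ)) h4]
    refine le_trans ?_ h3
    rw [psum_add, psum_const_mul, psum_const_mul]
    have h6 : psum (fun k => G.gap k * Real.log 2) (k + 1) = G.x k.succ * Real.log 2 := by
      rw [← h2, mul_comm, ← psum_const_mul]
      congr 1
      funext k
      ring
    rw [h6]
    nlinarith [mul_nonneg (by linarith : 0 ≤ 1 - δ) h1]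
  refine (expSmall_pressure_le hθ0 κ hd hgrowth hβ Γ (half_pos hε₀)).mono
    (Eventually.of_forall fun N => measureReal_mono fun X hX => ?_)
  refine le_trans (b := G.variationalPressure y β Γ - ε₀) hX ?_
  have h1 : psum (fun k => (G.gap k * Real.log 2 - (β / h k) ^ 2 * G.a k / 2 +
      β * (β / h k) * G.a k) - δ * β ^ 2 * G.a k) κ ≤
      psum (fun k => G.gap k * Real.log 2 - θ k ^ 2 * G.a k / 2 + β * θ k * G.a k) κ := by
    refine psum_mono (fun k => ?_) _
    have ha := (G.a_pos k).le
    have h4 : 0 ≤ (β / h k) ^ 2 * G.a k / 2 := by positivity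
    have h5 : θ k ^ 2 * G.a k / 2 = (1 - δ) ^ 2 * ((β / h k) ^ 2 * G.a k / 2) := by
      rw [hθ]; ring
    have h6 : β * θ k * G.a k = β * (β / h k) * G.a k - δ * (β * (β / h k) * G.a k) := by
      rw [hθ]; ring
    have h7 : δ * (β * (β / h k) * G.a k) ≤ δ * β ^ 2 * G.a k := by
      have := hb1 k
      calc δ * (β * (β / h k) * G.a k) ≤ δ * (β * β * G.a k) := by gcongr
        _ = _ := by ring
    rw [h5, h6]
    have h8 : (1 - δ) ^ 2 ≤ 1 := by nlinarith
    nlinarith [mul_le_mul_of_nonneg_right h8 h4]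
  have h2 : psum (fun k => δ * β ^ 2 * G.a k) κ ≤ ε₀ / 2 := by
    rw [psum_const_mul, ← G.dist_x]
    have := G.dist_le_one (G.x κ)
    have h3 : 0 ≤ δ * β ^ 2 := by positivity
    nlinarith
  rw [psum_sub] at h1
  rw [hκ]
  linarith

end Lower

/-! ### Almost sure convergence -/

/-- Borel–Cantelli needs only the individual probabilities, so the laws of the single U_N determine
everything and their coupling plays no role. -/
lemma ae_eventually_of_expSmall (G : Params n) {Ω : Type*} [MeasurableSpace Ω] {P : Measure Ω}
    [IsProbabilityMeasure P] {U : (N : ℕ) → Ω → Cube N → ℝ} (hU : ∀ N, HasLaw (U N) (G.law N) P)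
    {S : (N : ℕ) → Set (Cube N → ℝ)} (hS : ∀ N, MeasurableSet (S N))
    (h : ExpSmall fun N => (stdGaussianPi (G.Index N)).real {X | G.potential N X ∈ S N}) :
    ∀ᵐ ω ∂P, ∀ᶠ N in atTop, U N ω ∉ S N := by
  refine ae_eventually_notMem_of_expSmall (s := fun N => {ω | U N ω ∈ S N})
    (h.mono (Eventually.of_forall fun N => le_of_eq ?_))
  have hmeas : Measurable (G.potential N) := by
    unfold Params.potential
    fun_prop
  rw [(hU N).measureReal_eq (p := fun u => u ∈ S N) (hS N)]
  exact map_measureReal_apply hmeas (hS N)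

/-- Almost sure convergence of the pressure. -/
theorem ae_tendsto_pressure (G : Params n) {m : ℕ} {y : Fin (m + 1) → ℝ}
    (hy : G.IsHullSubdivision y) {Ω : Type*} [MeasurableSpace Ω] {P : Measure Ω}
    [IsProbabilityMeasure P] {U : (N : ℕ) → Ω → Cube N → ℝ} (hU : ∀ N, HasLaw (U N) (G.law N) P)
    {β Γ : ℝ} (hβ : 0 ≤ β) (hΓ : 0 ≤ Γ) :
    ∀ᵐ ω ∂P, Tendsto (fun N : ℕ => pressure β (U N ω) (fun _ => Γ)) atTop
      (𝓝 (G.variationalPressure y β Γ)) := by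
  set V := G.variationalPressure y β Γ with hV
  -- Countably many tolerances 1/(j+1), so that the exceptional null sets can be united.
  have hev : ∀ j : ℕ, ∀ᵐ ω ∂P, ∀ᶠ N : ℕ in atTop,
      pressure β (U N ω) (fun _ => Γ) < V + 1 / ((j : ℝ) + 1) ∧
        V - 1 / ((j : ℝ) + 1) < pressure β (U N ω) (fun _ => Γ) := by
    intro j
    have hj : (0 : ℝ) < 1 / ((j : ℝ) + 1) := by positivity
    have h1 := ae_eventually_of_expSmall G hU
      (S := fun N => {u | V + 1 / ((j : ℝ) + 1) ≤ pressure β u (fun _ => Γ)})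
      (fun N => measurableSet_le measurable_const (measurable_pressure β Γ))
      (expSmall_pressure_ge hy hβ hΓ hj)
    have h2 := ae_eventually_of_expSmall G hU
      (S := fun N => {u | pressure β u (fun _ => Γ) ≤ V - 1 / ((j : ℝ) + 1)})
      (fun N => measurableSet_le (measurable_pressure β Γ) measurable_const)
      (expSmall_pressure_le_variational hy hβ Γ hj)
    filter_upwards [h1, h2] with ω h1 h2
    filter_upwards [h1, h2] with N h1 h2
    exact ⟨not_le.1 h1, not_le.1 h2⟩
  filter_upwards [ae_all_iff.2 hev] with ω hω
  rw [Metric.tendsto_nhds]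
  intro ε hε
  obtain ⟨j, hj⟩ := exists_nat_one_div_lt hε
  filter_upwards [hω j] with N hN
  rw [Real.dist_eq, abs_lt]
  constructor <;> linarith [hN.1, hN.2]

end QGREM

end

theorem mainTheorem6 {n : ℕ} (G : QGREM.Params n) {m : ℕ} (y : Fin (m + 1) → ℝ)
    (hy : G.IsHullSubdivision y) {Ω : Type*} [MeasurableSpace Ω] (P : Measure Ω)
    [IsProbabilityMeasure P] (U : (N : ℕ) → Ω → QGREM.Cube N → ℝ)
    (hU : ∀ N, HasLaw (U N) (G.law N) P) (β Γ : ℝ) (hβ : 0 ≤ β) (hΓ : 0 < Γ) :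
    (∀ᵐ ω ∂P, Tendsto (fun N : ℕ => QGREM.pressure β (U N ω) (fun _ => Γ)) atTop
      (𝓝 (G.variationalPressure y β Γ))) ∧
    G.variationalPressure y β Γ =
      ∑ l : Fin m, if Γ < G.criticalField y β l then G.partialPressure y β l
        else QGREM.blockLength y l * Real.log (2 * Real.cosh (β * Γ)) :=
  ⟨QGREM.ae_tendsto_pressure G hy hU hβ hΓ.le, QGREM.variationalPressure_eq_sum hy hβ hΓ⟩
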